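/- **Setting.** Let $T>0$, $\alpha\in(1/3,1/2]$, $d,m\in\mathbb N$, and let $\mathbf Z=(Z,\mathbb Z)$ be a weakly geometric $\alpha$-Hölder rough path on $[0,T]$ with values in $\mathbb R^m$: $|\delta Z_{s,t}|\lesssim |t-s|^{\alpha}$, $|\mathbb Z_{s,t}|\lesssim|t-s|^{2\alpha}$, $\mathbb Z_{s,t}-\mathbb Z_{s,u}-\mathbb Z_{u,t}=\delta Z_{s,u}\otimes\delta Z_{u,t}$ and $\delta Z_{s,t}\otimes\delta Z_{s,t}=2\,\mathrm{Sym}(\mathbb Z_{s,t})$, where $\delta Z_{s,t}=Z_t-Z_s$. For $k<\gamma\le k+1$, $f\in \mathrm{Lip}^\gamma$ means Lipschitz in the sense of Stein on the whole space: $f$ is bounded, and there are symmetric $j$-linear $\partial^jf$, $0\le j\le k$, $\partial^0f=f$, bounded for $j\ge1$, with $|\partial^jf(x_1)-\sum_{l\le k-j}\frac1{l!}\partial^{j+l}f(x_0)(\,\cdot\otimes(x_1-x_0)^{\otimes l})|\le M|x_1-x_0|^{\gamma-j}$. Let $g\in \mathrm{Lip}^3(\mathbb R^d;\mathbb R)$,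 $\mu\in \mathrm{Lip}^3(\mathbb R^d;\mathbb R^d)$, $\sigma\in \mathrm{Lip}^5(\mathbb R^d;\mathbb R^{d\times m})$. Write $\Gamma f=(Df)\,\sigma$, i.e. $(\Gamma f)(x)v=Df(x)(\sigma(x)v)$, and $\Gamma^2f=\Gamma(\Gamma f)$, $\Gamma^2 f(x)(v\otimes w)=D\big((\Gamma f)(\cdot)w\big)(x)(\sigma(x)v)$. **The RDE.** For $r\in[0,T]$, $x\in\mathbb R^d$, a solution on $[r,T]$ of $$dX_s=\mu(X_s)\,ds+\sigma(X_s)\,d\mathbf Z_s,\qquad X_r=x,$$ is a path $X$ such that $(X,\sigma(X))$ is $Z$-controlled ($|\sigma(X_t)-\sigma(X_s)|\lesssim|t-s|^\alpha$, $|\delta X_{s,t}-\sigma(X_s)\delta Z_{s,t}|\lesssim|t-s|^{2\alpha}$) and $X_t=x+\int_r^t\mu(X_s)\,ds+\int_r^t(\sigma(X),(\Gamma\sigma)(X))\,d\mathbf Z$ for $t\in[r,T]$, the last integral being the rough integral (limit of compensated Riemann sums as the mesh tends to $0$). **Controlled fields.** A strongly $\mathbf Z$-controlled $\mathrm{Lip}^3$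 field on $[0,T]\times\mathbb R^d$ is a $7$-tuple $\mathcal F=(F,F',\partial F,F'',\partial F',\partial^2F,\dot F)$ of functions on $[0,T]\times\mathbb R^d$ with values in $\mathbb R$, $\mathcal L(\mathbb R^m;\mathbb R)$, $\mathcal L(\mathbb R^d;\mathbb R)$, $\mathcal L(\mathbb R^m\otimes\mathbb R^m;\mathbb R)$, $\mathcal L(\mathbb R^d\otimes\mathbb R^m;\mathbb R)$, the symmetric elements of $\mathcal L(\mathbb R^d\otimes\mathbb R^d;\mathbb R)$, and $\mathbb R$, such that, for all $0\le t_0\le t_1\le T$ and $x_0,x_1\in\mathbb R^d$, $$\begin{aligned} F_{t_1}(x_1)&\overset3=F_{t_0}(x_0)+F'_{t_0}(x_0)\delta Z_{t_0,t_1}+\partial F_{t_0}(x_0)(x_1-x_0)+F''_{t_0}(x_0)\mathbb Z_{t_0,t_1}+\partial F'_{t_0}(x_0)\big((x_1-x_0)\otimes\delta Z_{t_0,t_1}\big)\\&\qquad+\tfrac12\partial^2F_{t_0}(x_0)(x_1-x_0)^{\otimes2}+\dot F_{t_0}(x_0)(t_1-t_0),\\ F'_{t_1}(x_1)&\overset2=F'_{t_0}(x_0)+F''_{t_0}(x_0)\delta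 Z_{t_0,t_1}+\partial F'_{t_0}(x_0)(x_1-x_0),\\ \partial F_{t_1}(x_1)&\overset2=\partial F_{t_0}(x_0)+(\partial F'_{t_0}(x_0))^{\top}\delta Z_{t_0,t_1}+\partial^2F_{t_0}(x_0)(x_1-x_0),\\ G_{t_1}(x_1)&\overset1=G_{t_0}(x_0),\qquad G\in\{F'',\partial F',\partial^2F,\dot F\}, \end{aligned}$$ where $A\overset k=B$ means $|A-B|\le C\,(|t_1-t_0|^\alpha\vee|x_1-x_0|)^k$ with $C$ independent of $t_0,t_1,x_0,x_1$. (Arguments not yet filled in are the last ones: $(F''\delta Z)(w)=F''(\delta Z\otimes w)$, $(\partial F'\,y)(v)=\partial F'(y\otimes v)$, $((\partial F')^\top v)(y)=\partial F'(y\otimes v)$.) A *space-time regular solution* of the backward rough transport equation $$-du_t=Du_t\,\mu\,dt+\Gamma u_t\,d\mathbf Z_t\ \text{ on }[0,T]\times\mathbb R^d,\qquad u_T=g,$$ is such a field $\mathcal U$ whose first component $u$ satisfies $u_T=g$ and which is of the form $$\mathcal U=\big(u,\,-\Gamma u,\,Du,\,(\Gamma^2u)^\top,\,-D(\Gamma u),\,D^2u,\,-(Du)\mu\big).\qquad(*)$$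 **Theorem.** For all $t\in[0,T]$, $x\in\mathbb R^d$ the RDE has exactly one solution $X^{t,x;\mathbf Z}$ on $[t,T]$ started from $x$ at time $t$. Put $u_t(x)=g(X_T^{t,x;\mathbf Z})$ and define $\mathcal U$ from $u$ by $(*)$. Then $\mathcal U$ is a space-time regular solution of the rough transport equation, and it is the only one: every space-time regular solution coincides with $\mathcal U$, in all seven components, on $[0,T]\times\mathbb R^d$. -/

import Mathlib

open Set
open scoped Nat

/-! ### Stein–Lipschitz functions -/

/-- `f : W → U` is `Lip^γ` (in the sense of Stein) on the whole space `W`: with `k < γ ≤ k + 1`, `f`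
is bounded and there are symmetric `j`-linear "derivatives" `p x j = ∂ʲf(x)`, `0 ≤ j ≤ k`, with
`∂⁰f = f`, bounded for `1 ≤ j ≤ k`, whose Taylor remainders
`R_j(x₀, x₁) = ∂ʲf(x₁) - ∑_{l ≤ k - j} (1 / l!) ∂ʲ⁺ˡf(x₀)(· ⊗ (x₁ - x₀)^{⊗ l})`
have (operator) norm at most `M |x₁ - x₀|^{γ - j}`. -/
def IsLip {W U : Type*} [NormedAddCommGroup W] [NormedSpace ℝ W]
    [NormedAddCommGroup U] [NormedSpace ℝ U] (γ : ℝ) (f : W → U) : Prop :=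
  ∃ k : ℕ, (k : ℝ) < γ ∧ γ ≤ k + 1 ∧
    ∃ (p : W → FormalMultilinearSeries ℝ W U) (M : ℝ),
      (∀ x, ‖f x‖ ≤ M) ∧
      (∀ x (v : Fin 0 → W), p x 0 v = f x) ∧
      (∀ x, ∀ j ≤ k, ∀ (e : Equiv.Perm (Fin j)) (v : Fin j → W), p x j (v ∘ e) = p x j v) ∧
      (∀ x, ∀ j ∈ Finset.Icc 1 k, ‖p x j‖ ≤ M) ∧
      (∀ x₀ x₁, ∀ j ≤ k, ∀ v : Fin j → W,
        ‖p x₁ j v - ∑ l ∈ Finset.range (k - j + 1),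
            ((1 : ℝ) / (l ! : ℝ)) • p x₀ (j + l) (Fin.append v (fun _ : Fin l => x₁ - x₀))‖
          ≤ M * ‖x₁ - x₀‖ ^ (γ - (j : ℝ)) * ∏ i, ‖v i‖)

/-! ### Rough paths with values in `ℝ^m`

Elements of `ℝ^m ⊗ ℝ^m` are `m × m` matrices, `v ⊗ w = v wᵀ`, and linear maps on `V ⊗ W` are
curried: `B (v ⊗ w)` is `B v w`; thus the transpose of `B` is `B.flip`. -/

/-- Evaluation `B M` of `B ∈ L(ℝ^m ⊗ ℝ^m; U)` at `M ∈ ℝ^m ⊗ ℝ^m`. -/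
noncomputable def contract {m : ℕ} {U : Type*} [NormedAddCommGroup U] [NormedSpace ℝ U]
    (B : EuclideanSpace ℝ (Fin m) →L[ℝ] EuclideanSpace ℝ (Fin m) →L[ℝ] U)
    (M : Matrix (Fin m) (Fin m) ℝ) : U :=
  ∑ i, ∑ j, M i j • B (EuclideanSpace.single i 1) (EuclideanSpace.single j 1)

/-- `(X, 𝕏)` is an `α`-Hölder rough path on `[0, T]` with values in `ℝ^m`. -/
structure IsRoughPath {m : ℕ} (α T : ℝ) (X : ℝ → EuclideanSpace ℝ (Fin m))
    (XX : ℝ → ℝ → Matrix (Fin m) (Fin m) ℝ) : Prop where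
  holder_fst : ∃ C : ℝ, ∀ s t, 0 ≤ s → s ≤ t → t ≤ T → ‖X t - X s‖ ≤ C * (t - s) ^ α
  holder_snd : ∃ C : ℝ, ∀ s t, 0 ≤ s → s ≤ t → t ≤ T → ∀ i j, |XX s t i j| ≤ C * (t - s) ^ (2 * α)
  chen : ∀ s u t, 0 ≤ s → s ≤ u → u ≤ t → t ≤ T → ∀ i j,
    XX s t i j - XX s u i j - XX u t i j = (X u - X s) i * (X t - X u) j

/-- The bracket `[𝐗]_{s,t} = δX_{s,t} ⊗ δX_{s,t} - 2 Sym 𝕏_{s,t}`. -/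
def roughBracket {m : ℕ} (X : ℝ → EuclideanSpace ℝ (Fin m))
    (XX : ℝ → ℝ → Matrix (Fin m) (Fin m) ℝ) (s t : ℝ) : Matrix (Fin m) (Fin m) ℝ :=
  Matrix.of fun i j => (X t - X s) i * (X t - X s) j - (XX s t i j + XX s t j i)

/-- `(X, 𝕏)` is a weakly geometric `α`-Hölder rough path on `[0, T]`. -/
structure IsWeaklyGeometricRoughPath {m : ℕ} (α T : ℝ) (X : ℝ → EuclideanSpace ℝ (Fin m))
    (XX : ℝ → ℝ → Matrix (Fin m) (Fin m) ℝ) : Prop extends IsRoughPath α T X XX where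
  bracket_eq_zero : ∀ s t, 0 ≤ s → s ≤ t → t ≤ T → roughBracket X XX s t = 0

/-- `(Y, Y')` is an `X`-controlled rough path on `[a, b]`. -/
structure IsControlledPath {m : ℕ} {E : Type*} [NormedAddCommGroup E] [NormedSpace ℝ E]
    (α : ℝ) (X : ℝ → EuclideanSpace ℝ (Fin m)) (a b : ℝ)
    (Y : ℝ → E) (Y' : ℝ → EuclideanSpace ℝ (Fin m) →L[ℝ] E) : Prop where
  remainder : ∃ C : ℝ, ∀ s t, a ≤ s → s ≤ t → t ≤ b →
    ‖Y t - Y s - Y' s (X t - X s)‖ ≤ C * (t - s) ^ (2 * α)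
  holder : ∃ C : ℝ, ∀ s t, a ≤ s → s ≤ t → t ≤ b → ‖Y' t - Y' s‖ ≤ C * (t - s) ^ α

/-- `I` is the rough integral `∫_a^b (Y, Y') d𝐗`: the limit, as the mesh of the partition
`a = π 0 ≤ π 1 ≤ ⋯ ≤ π n = b` tends to zero, of the compensated Riemann sums
`∑ Y_{π i} δX_{π i, π (i+1)} + Y'_{π i} 𝕏_{π i, π (i+1)}`. -/
def HasRoughIntegral {m : ℕ} {E : Type*} [NormedAddCommGroup E] [NormedSpace ℝ E]
    (X : ℝ → EuclideanSpace ℝ (Fin m)) (XX : ℝ → ℝ → Matrix (Fin m) (Fin m) ℝ)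
    (Y : ℝ → EuclideanSpace ℝ (Fin m) →L[ℝ] E)
    (Y' : ℝ → EuclideanSpace ℝ (Fin m) →L[ℝ] EuclideanSpace ℝ (Fin m) →L[ℝ] E)
    (a b : ℝ) (I : E) : Prop :=
  ∀ ε > 0, ∃ δ > 0, ∀ (n : ℕ) (π : ℕ → ℝ), Monotone π → π 0 = a → π n = b →
    (∀ i < n, π (i + 1) - π i ≤ δ) →
    ‖∑ i ∈ Finset.range n, (Y (π i) (X (π (i + 1)) - X (π i))
        + contract (Y' (π i)) (XX (π i) (π (i + 1)))) - I‖ < ε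

/-! ### The operator `Γ`, rough differential equations -/

/-- `Γ f = (Df) σ`, i.e. `(Γ f)(x)(v) = Df(x)(σ(x) v)`. -/
noncomputable def Gam {m : ℕ} {W E : Type*} [NormedAddCommGroup W] [NormedSpace ℝ W]
    [NormedAddCommGroup E] [NormedSpace ℝ E] (σ : W → EuclideanSpace ℝ (Fin m) →L[ℝ] W)
    (f : W → E) (x : W) : EuclideanSpace ℝ (Fin m) →L[ℝ] E :=
  (fderiv ℝ f x).comp (σ x)

/-- `X` solves `dX = μ(X) ds + σ(X) d𝐙` on `[r, T]`, `X_r = x`: the pair `(X, σ(X))` is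
`Z`-controlled and `X_t - x - ∫_r^t μ(X_s) ds = ∫_r^t (σ(X), (Γσ)(X)) d𝐙` for all `t ∈ [r, T]`. -/
structure IsRDESolution {m : ℕ} {W : Type*} [NormedAddCommGroup W] [NormedSpace ℝ W]
    (α T : ℝ) (Z : ℝ → EuclideanSpace ℝ (Fin m)) (ZZ : ℝ → ℝ → Matrix (Fin m) (Fin m) ℝ)
    (μ : W → W) (σ : W → EuclideanSpace ℝ (Fin m) →L[ℝ] W)
    (r : ℝ) (x : W) (X : ℝ → W) : Prop where
  controlled : IsControlledPath α Z r T X (fun s => σ (X s))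
  initial : X r = x
  equation : ∀ t ∈ Icc r T,
    HasRoughIntegral Z ZZ (fun s => σ (X s)) (fun s => Gam σ σ (X s)) r t
      (X t - x - ∫ s in r..t, μ (X s))

/-! ### Space-time controlled fields -/

/-- A `7`-tuple `(F, F', ∂F, F'', ∂F', ∂²F, Ḟ)` of functions of time and space; the time argument
is only relevant on `[0, T]`. -/
structure Jet (m : ℕ) (W U : Type*) [NormedAddCommGroup W] [NormedSpace ℝ W]
    [NormedAddCommGroup U] [NormedSpace ℝ U] where
  /-- `F` -/
  val : ℝ → W → U
  /-- `F'` -/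
  gub : ℝ → W → EuclideanSpace ℝ (Fin m) →L[ℝ] U
  /-- `∂F` -/
  dx : ℝ → W → W →L[ℝ] U
  /-- `F''` -/
  gub2 : ℝ → W → EuclideanSpace ℝ (Fin m) →L[ℝ] EuclideanSpace ℝ (Fin m) →L[ℝ] U
  /-- `∂F'` -/
  dxgub : ℝ → W → W →L[ℝ] EuclideanSpace ℝ (Fin m) →L[ℝ] U
  /-- `∂²F` -/
  dx2 : ℝ → W → W →L[ℝ] W →L[ℝ] U
  /-- `Ḟ` -/
  dot : ℝ → W → U

/-- Equality of two jets, in all seven components, on `[0, T] × W`. -/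
def Jet.EqUpTo {m : ℕ} {W U : Type*} [NormedAddCommGroup W] [NormedSpace ℝ W]
    [NormedAddCommGroup U] [NormedSpace ℝ U] (T : ℝ) (A B : Jet m W U) : Prop :=
  ∀ t ∈ Icc 0 T, A.val t = B.val t ∧ A.gub t = B.gub t ∧ A.dx t = B.dx t ∧ A.gub2 t = B.gub2 t ∧
    A.dxgub t = B.dxgub t ∧ A.dx2 t = B.dx2 t ∧ A.dot t = B.dot t

/-- `A_{s,t}(x, y)` vanishes to order `k` on `[0, T] × W` for the anisotropic scaling:
`|A_{s,t}(x, y)| ≤ C (|t - s|^α ∨ |y - x|)^k` for all `0 ≤ s ≤ t ≤ T` and all `x, y`. -/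
def VanishesToOrder {W E : Type*} [NormedAddCommGroup W] [NormedAddCommGroup E]
    (α T : ℝ) (k : ℕ) (A : ℝ → ℝ → W → W → E) : Prop :=
  ∃ C : ℝ, ∀ s t, 0 ≤ s → s ≤ t → t ≤ T → ∀ x y,
    ‖A s t x y‖ ≤ C * (max (|t - s| ^ α) ‖y - x‖) ^ k

/-- `𝓕` is a strongly `𝐗`-controlled `Lip³` field on `[0, T] × W`; below `(s, x)` is the base point
and `(t, y)` the point at which the field is expanded. -/
structure IsControlledField {m : ℕ} {W U : Type*} [NormedAddCommGroup W] [NormedSpace ℝ W]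
    [NormedAddCommGroup U] [NormedSpace ℝ U] (α T : ℝ) (X : ℝ → EuclideanSpace ℝ (Fin m))
    (XX : ℝ → ℝ → Matrix (Fin m) (Fin m) ℝ) (𝓕 : Jet m W U) : Prop where
  symm : ∀ t ∈ Icc 0 T, ∀ x v w, 𝓕.dx2 t x v w = 𝓕.dx2 t x w v
  expand_val : VanishesToOrder α T 3 fun s t x y =>
    𝓕.val t y - (𝓕.val s x + 𝓕.gub s x (X t - X s) + 𝓕.dx s x (y - x)
      + contract (𝓕.gub2 s x) (XX s t) + 𝓕.dxgub s x (y - x) (X t - X s)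
      + (1 / 2 : ℝ) • 𝓕.dx2 s x (y - x) (y - x) + (t - s) • 𝓕.dot s x)
  expand_gub : VanishesToOrder α T 2 fun s t x y =>
    𝓕.gub t y - (𝓕.gub s x + 𝓕.gub2 s x (X t - X s) + 𝓕.dxgub s x (y - x))
  expand_dx : VanishesToOrder α T 2 fun s t x y =>
    𝓕.dx t y - (𝓕.dx s x + (𝓕.dxgub s x).flip (X t - X s) + 𝓕.dx2 s x (y - x))
  expand_gub2 : VanishesToOrder α T 1 fun s t x y => 𝓕.gub2 t y - 𝓕.gub2 s x
  expand_dxgub : VanishesToOrder α T 1 fun s t x y => 𝓕.dxgub t y - 𝓕.dxgub s x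
  expand_dx2 : VanishesToOrder α T 1 fun s t x y => 𝓕.dx2 t y - 𝓕.dx2 s x
  expand_dot : VanishesToOrder α T 1 fun s t x y => 𝓕.dot t y - 𝓕.dot s x

/-! ### The rough transport equation -/

/-- The jet `(u, -Γu, Du, (Γ²u)ᵀ, -D(Γu), D²u, -(Du)μ)`. -/
noncomputable def transportJet {m : ℕ} {W U : Type*} [NormedAddCommGroup W] [NormedSpace ℝ W]
    [NormedAddCommGroup U] [NormedSpace ℝ U]
    (μ : W → W) (σ : W → EuclideanSpace ℝ (Fin m) →L[ℝ] W) (u : ℝ → W → U) : Jet m W U where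
  val t x := u t x
  gub t x := -Gam σ (u t) x
  dx t x := fderiv ℝ (u t) x
  gub2 t x := (Gam σ (Gam σ (u t)) x).flip
  dxgub t x := -fderiv ℝ (Gam σ (u t)) x
  dx2 t x := fderiv ℝ (fderiv ℝ (u t)) x
  dot t x := -(fderiv ℝ (u t) x (μ x))

/-- `𝓤` is a space-time regular solution of `-du = (Du) μ dt + Γu d𝐙`, `u_T = g`. -/
structure IsSpaceTimeRegularSolution {m : ℕ} {W U : Type*} [NormedAddCommGroup W]
    [NormedSpace ℝ W] [NormedAddCommGroup U] [NormedSpace ℝ U]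
    (α T : ℝ) (Z : ℝ → EuclideanSpace ℝ (Fin m)) (ZZ : ℝ → ℝ → Matrix (Fin m) (Fin m) ℝ)
    (μ : W → W) (σ : W → EuclideanSpace ℝ (Fin m) →L[ℝ] W) (g : W → U)
    (𝓤 : Jet m W U) : Prop where
  controlled : IsControlledField α T Z ZZ 𝓤
  terminal : ∀ x, 𝓤.val T x = g x
  expansion : 𝓤.EqUpTo T (transportJet μ σ 𝓤.val)

/-! Let Φ_{s,t} be the flow of the RDE. Then u_t = g ∘ Φ_{t,T}, hence u_s = u_t ∘ Φ_{s,t}, and every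
assertion reduces to estimates on Φ_{s,t} with errors of order h^{3α}, h = t - s. Since 3α > 1, such
errors vanish when summed over finer and finer partitions.

Flow. The Davie step x + σ(x)δZ + (Γσ)(x)ℤ + μ(x)h composes like a flow up to h^{3α}, by Chen's
relation (`exists_isAlmostFlow`). Composing steps along a finite set S of times gives an exact flow
on S, and `davie_sewing` shows that it stays close to a single step, uniformly in S. Derivatives
need no new analysis: the 2-jets of the composed steps are composed Davie steps of the twice
prolonged fields built from (x, v) ↦ (σ(x), Dσ(x)v), so the same estimates bound them (`euler_jet`).
The vector v is cut off because Dσ(x)v is unbounded in v. Two prolongations cost two derivatives,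
and the scheme needs Lip³ fields and a bounded Lipschitz drift; hence Lip⁵ for σ and Lip³ for μ. An
ultrafilter limit over finite sets S yields Φ by compactness, without proving convergence of the
scheme (`exists_flow_short`, `exists_isRDEFlow`).

RDE. A path solves the equation exactly when it follows the Davie step up to h^{3α}
(`IsRDESolution.isDavieSolution`, `IsDavieSolution.isRDESolution`). For such a path Y the increments
of s ↦ Φ_{s,t}(Y_s) are O(h^{3α}), so this map is constant and Y is the flow line
(`IsRDEFlow.eq_of_isDavieSolution`).

Transport. For existence, u_t(Φ_{s,t}(x)) is Taylor expanded at x, the Davie step is inserted, and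
derivatives of u_t are traded for those of u_s. Weak geometricity writes Γ²u(δZ ⊗ δZ) through ℤ and
its transpose, which is where the transposed Γ²u comes from
(`IsRDEFlow.isControlledField_transportJet`). For uniqueness, the expansion of any regular solution
along a flow line cancels up to h^{3α}, so the solution is constant there and its terminal value
determines it (`IsSpaceTimeRegularSolution.val_eq`); the form (*) determines the other components
from the first. -/

/-! ### Uniformly bounded families of `C^{k,1}` maps -/

/-- `f i : W → U`, `i : ι`, is a family of `k` times differentiable maps which, together with their
derivatives, are bounded and whose `k`-th derivatives are Lipschitz, all uniformly in `i`. -/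
def CB {ι W : Type} [NormedAddCommGroup W] [NormedSpace ℝ W] : ∀ (_ : ℕ) {U : Type}
    [NormedAddCommGroup U] [NormedSpace ℝ U] (_ : ι → W → U), Prop
  | 0, _, _, _, f => ∃ C : ℝ, ∀ i x y, ‖f i x‖ ≤ C ∧ ‖f i x - f i y‖ ≤ C * ‖x - y‖
  | k + 1, _, _, _, f => (∃ C : ℝ, ∀ i x, ‖f i x‖ ≤ C) ∧ (∀ i, Differentiable ℝ (f i)) ∧
      CB k (fun i x => fderiv ℝ (f i) x)

namespace CB

variable {ι W W' U V X : Type} [NormedAddCommGroup W] [NormedSpace ℝ W]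
  [NormedAddCommGroup W'] [NormedSpace ℝ W'] [NormedAddCommGroup U] [NormedSpace ℝ U]
  [NormedAddCommGroup V] [NormedSpace ℝ V] [NormedAddCommGroup X] [NormedSpace ℝ X]

theorem bounded {k : ℕ} {f : ι → W → U} (hf : CB k f) : ∃ C : ℝ, 0 ≤ C ∧ ∀ i x, ‖f i x‖ ≤ C := by
  have : ∃ C : ℝ, ∀ i x, ‖f i x‖ ≤ C := by
    cases k with
    | zero => obtain ⟨C, hC⟩ := hf; exact ⟨C, fun i x => (hC i x x).1⟩
    | succ k => exact hf.1
  obtain ⟨C, hC⟩ := this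
  exact ⟨|C|, abs_nonneg _, fun i x => (hC i x).trans (le_abs_self _)⟩

theorem differentiable {k : ℕ} {f : ι → W → U} (hf : CB (k + 1) f) (i : ι) :
    Differentiable ℝ (f i) := hf.2.1 i

theorem fderiv {k : ℕ} {f : ι → W → U} (hf : CB (k + 1) f) :
    CB k (fun i x => fderiv ℝ (f i) x) := hf.2.2

theorem lipschitz_of_fderiv_le {f : W → U} (hf : Differentiable ℝ f) {C : ℝ}
    (hC : ∀ x, ‖_root_.fderiv ℝ f x‖ ≤ C) (x y : W) : ‖f x - f y‖ ≤ C * ‖x - y‖ :=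
  convex_univ.norm_image_sub_le_of_norm_fderiv_le (fun z _ => hf z) (fun z _ => hC z)
    (mem_univ y) (mem_univ x)

theorem lipschitz {k : ℕ} {f : ι → W → U} (hf : CB k f) :
    ∃ C : ℝ, 0 ≤ C ∧ ∀ i x y, ‖f i x - f i y‖ ≤ C * ‖x - y‖ := by
  cases k with
  | zero =>
    obtain ⟨C, hC⟩ := hf
    exact ⟨|C|, abs_nonneg _, fun i x y => (hC i x y).2.trans (by gcongr; exact le_abs_self _)⟩
  | succ k =>
    obtain ⟨C, hC0, hC⟩ := hf.fderiv.bounded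
    exact ⟨C, hC0, fun i => lipschitz_of_fderiv_le (hf.differentiable i) (hC i)⟩

theorem zero_intro {f : ι → W → U} {C D : ℝ} (h1 : ∀ i x, ‖f i x‖ ≤ C)
    (h2 : ∀ i x y, ‖f i x - f i y‖ ≤ D * ‖x - y‖) : CB 0 f := by
  refine ⟨max C D, fun i x y => ⟨(h1 i x).trans (le_max_left _ _), (h2 i x y).trans ?_⟩⟩
  gcongr
  exact le_max_right _ _

theorem continuous {k : ℕ} {f : ι → W → U} (hf : CB k f) (i : ι) : Continuous (f i) := by
  obtain ⟨C, hC0, hC⟩ := hf.lipschitz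
  refine (LipschitzWith.of_dist_le_mul (K := ⟨C, hC0⟩) fun x y => ?_).continuous
  rw [dist_eq_norm, dist_eq_norm]
  exact hC i x y

theorem of_succ : ∀ {k : ℕ} {U : Type} [NormedAddCommGroup U] [NormedSpace ℝ U] {f : ι → W → U},
    CB (k + 1) f → CB k f
  | 0, _, _, _, f, hf => by
    obtain ⟨C, _, hC⟩ := hf.bounded
    obtain ⟨D, _, hD⟩ := hf.lipschitz
    exact zero_intro hC hD
  | k + 1, _, _, _, f, hf => ⟨hf.1, hf.2.1, of_succ hf.2.2⟩

theorem mono {k l : ℕ} (h : l ≤ k) {f : ι → W → U} (hf : CB k f) : CB l f := by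
  induction h with
  | refl => exact hf
  | step _ ih => exact ih hf.of_succ

theorem reindex {κ : Type} (e : κ → ι) : ∀ {k : ℕ} {U : Type} [NormedAddCommGroup U]
    [NormedSpace ℝ U] {f : ι → W → U}, CB k f → CB k (fun j => f (e j))
  | 0, _, _, _, _, hf => by
    obtain ⟨C, hC⟩ := hf
    exact ⟨C, fun j => hC (e j)⟩
  | k + 1, _, _, _, f, hf => by
    obtain ⟨⟨C, hC⟩, hd, hf'⟩ := hf
    exact ⟨⟨C, fun j => hC (e j)⟩, fun j => hd (e j), reindex e hf'⟩

theorem clm : ∀ {k : ℕ} {U V : Type} [NormedAddCommGroup U] [NormedSpace ℝ U]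
    [NormedAddCommGroup V] [NormedSpace ℝ V] {f : ι → W → U} (L : U →L[ℝ] V), CB k f →
    CB k (fun i x => L (f i x))
  | 0, _, _, _, _, _, _, f, L, hf => by
    obtain ⟨C, _, hC⟩ := hf.bounded
    obtain ⟨D, _, hD⟩ := hf.lipschitz
    refine zero_intro (C := ‖L‖ * C) (D := ‖L‖ * D) (fun i x => ?_) (fun i x y => ?_)
    · exact (L.le_opNorm _).trans (by gcongr; exact hC i x)
    · rw [← map_sub, mul_assoc]
      exact (L.le_opNorm _).trans (by gcongr; exact hD i x y)
  | k + 1, _, _, _, _, _, _, f, L, hf => by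
    obtain ⟨C, _, hC⟩ := hf.bounded
    refine ⟨⟨‖L‖ * C, fun i x => (L.le_opNorm _).trans (by gcongr; exact hC i x)⟩, fun i =>
      L.differentiable.comp (hf.differentiable i), ?_⟩
    have : (fun i x => _root_.fderiv ℝ (fun x => L (f i x)) x)
        = fun i x => (ContinuousLinearMap.compL ℝ W _ _ L) (_root_.fderiv ℝ (f i) x) := by
      funext i x
      exact (L.hasFDerivAt.comp x (hf.differentiable i x).hasFDerivAt).fderiv
    rw [this]
    exact clm _ hf.fderiv

theorem add : ∀ {k : ℕ} {U : Type} [NormedAddCommGroup U] [NormedSpace ℝ U] {f g : ι → W → U},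
    CB k f → CB k g → CB k (fun i x => f i x + g i x)
  | 0, _, _, _, f, g, hf, hg => by
    obtain ⟨C, _, hC⟩ := hf.bounded
    obtain ⟨D, _, hD⟩ := hf.lipschitz
    obtain ⟨C', _, hC'⟩ := hg.bounded
    obtain ⟨D', _, hD'⟩ := hg.lipschitz
    refine zero_intro (C := C + C') (D := D + D') (fun i x => ?_) (fun i x y => ?_)
    · exact (norm_add_le _ _).trans (add_le_add (hC i x) (hC' i x))
    · rw [add_sub_add_comm, add_mul]
      exact (norm_add_le _ _).trans (add_le_add (hD i x y) (hD' i x y))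
  | k + 1, _, _, _, f, g, hf, hg => by
    obtain ⟨C, _, hC⟩ := hf.bounded
    obtain ⟨C', _, hC'⟩ := hg.bounded
    refine ⟨⟨C + C', fun i x => (norm_add_le _ _).trans (add_le_add (hC i x) (hC' i x))⟩,
      fun i => (hf.differentiable i).add (hg.differentiable i), ?_⟩
    have : (fun i x => _root_.fderiv ℝ (fun x => f i x + g i x) x)
        = fun i x => _root_.fderiv ℝ (f i) x + _root_.fderiv ℝ (g i) x := by
      funext i x
      exact fderiv_add (hf.differentiable i x) (hg.differentiable i x)
    rw [this]
    exact add hf.fderiv hg.fderiv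

theorem const : ∀ {k : ℕ} {U : Type} [NormedAddCommGroup U] [NormedSpace ℝ U] {c : ι → U} {C : ℝ},
    (∀ i, ‖c i‖ ≤ C) → CB k (fun i (_ : W) => c i)
  | 0, _, _, _, c, C, hc => zero_intro (C := C) (D := 0) (fun i _ => hc i) (by simp)
  | k + 1, _, _, _, c, C, hc => by
    refine ⟨⟨C, fun i _ => hc i⟩, fun i => differentiable_const _, ?_⟩
    simp only [fderiv_fun_const, Pi.zero_apply]
    exact const (C := 0) (by simp)

/-- By Leibniz' rule the derivative is a sum of two bilinear expressions with the derivative on one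
factor, so the induction closes provided the bilinear map and the spaces vary. Compositions of
operators and `Gam` are instances. -/
theorem bilin : ∀ {k : ℕ} {U V X : Type} [NormedAddCommGroup U] [NormedSpace ℝ U]
    [NormedAddCommGroup V] [NormedSpace ℝ V] [NormedAddCommGroup X] [NormedSpace ℝ X]
    {f : ι → W → U} {g : ι → W → V} (B : U →L[ℝ] V →L[ℝ] X), CB k f → CB k g →
    CB k (fun i x => B (f i x) (g i x))
  | k, U, V, X, _, _, _, _, _, _, f, g, B, hf, hg => by
    obtain ⟨C, hC0, hC⟩ := hf.bounded
    obtain ⟨D, _, hD⟩ := hf.lipschitz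
    obtain ⟨C', hC0', hC'⟩ := hg.bounded
    obtain ⟨D', _, hD'⟩ := hg.lipschitz
    have hb : ∀ i x, ‖B (f i x) (g i x)‖ ≤ ‖B‖ * C * C' := fun i x =>
      (B.le_opNorm₂ _ _).trans (by gcongr; exacts [hC i x, hC' i x])
    cases k with
    | zero =>
      refine zero_intro (D := ‖B‖ * (D * C' + C * D')) hb (fun i x y => ?_)
      have e : B (f i x) (g i x) - B (f i y) (g i y)
          = B (f i x - f i y) (g i x) + B (f i y) (g i x - g i y) := by
        simp
      rw [e]
      calc _ ≤ ‖B‖ * ‖f i x - f i y‖ * ‖g i x‖ + ‖B‖ * ‖f i y‖ * ‖g i x - g i y‖ :=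
            norm_add_le_of_le (B.le_opNorm₂ _ _) (B.le_opNorm₂ _ _)
        _ ≤ ‖B‖ * (D * ‖x - y‖) * C' + ‖B‖ * C * (D' * ‖x - y‖) := by
            gcongr
            exacts [hD i x y, hC' i x, hC i y, hD' i x y]
        _ = _ := by ring
    | succ k =>
      refine ⟨⟨_, hb⟩, fun i x => ?_, ?_⟩
      · exact ((B.hasFDerivAt_of_bilinear (hf.differentiable i x).hasFDerivAt
          (hg.differentiable i x).hasFDerivAt)).differentiableAt
      · have : (fun i x => _root_.fderiv ℝ (fun x => B (f i x) (g i x)) x)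
          = fun i x => B.precompR W (f i x) (_root_.fderiv ℝ (g i) x)
            + B.precompL W (_root_.fderiv ℝ (f i) x) (g i x) := by
          funext i x
          exact (B.hasFDerivAt_of_bilinear (hf.differentiable i x).hasFDerivAt
            (hg.differentiable i x).hasFDerivAt).fderiv
        rw [this]
        exact add (bilin _ hf.of_succ hg.fderiv) (bilin _ hf.fderiv hg.of_succ)

theorem comp_zero {f : ι → W → U} {g : ι → W' → W} {D : ℝ} (hf : CB 0 f)
    (hg : ∀ i x y, ‖g i x - g i y‖ ≤ D * ‖x - y‖) : CB 0 (fun i x => f i (g i x)) := by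
  obtain ⟨C, _, hC⟩ := hf.bounded
  obtain ⟨D', _, hD'⟩ := hf.lipschitz
  refine zero_intro (C := C) (D := D' * D) (fun i x => hC i _) (fun i x y => ?_)
  rw [mul_assoc]
  exact (hD' i _ _).trans (by gcongr; exact hg i x y)

/-- Only the derivative of the inner map is required to be bounded: flow maps are perturbations of
the identity and are themselves unbounded. -/
theorem comp : ∀ {k : ℕ} {U : Type} [NormedAddCommGroup U] [NormedSpace ℝ U] {f : ι → W → U}
    {g : ι → W' → W}, CB (k + 1) f → (∀ i, Differentiable ℝ (g i)) →
    CB k (fun i x => _root_.fderiv ℝ (g i) x) → CB (k + 1) (fun i x => f i (g i x))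
  | k, U, _, _, f, g, hf, hgd, hg => by
    obtain ⟨C, _, hC⟩ := hf.bounded
    refine ⟨⟨C, fun i x => hC i _⟩, fun i => (hf.differentiable i).comp (hgd i), ?_⟩
    have : (fun i x => _root_.fderiv ℝ (fun x => f i (g i x)) x)
        = fun i x => ContinuousLinearMap.compL ℝ W' W U (_root_.fderiv ℝ (f i) (g i x))
            (_root_.fderiv ℝ (g i) x) := by
      funext i x
      exact ((hf.differentiable i _).hasFDerivAt.comp x (hgd i x).hasFDerivAt).fderiv
    rw [this]
    refine bilin _ ?_ hg
    cases k with
    | zero =>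
      obtain ⟨D, _, hD⟩ := hg.bounded
      exact comp_zero hf.fderiv fun i => lipschitz_of_fderiv_le (hgd i) (hD i)
    | succ k => exact comp hf.fderiv hgd hg.of_succ

/-- Composition with a fixed continuous linear map. -/
theorem comp_clm {k : ℕ} {f : ι → W → U} (hf : CB k f) (L : W' →L[ℝ] W) :
    CB k (fun i x => f i (L x)) := by
  cases k with
  | zero =>
    exact comp_zero (D := ‖L‖) hf fun i x y => by rw [← map_sub]; exact L.le_opNorm _
  | succ k =>
    refine comp (g := fun _ x => L x) hf (fun _ => L.differentiable) ?_
    simp only [ContinuousLinearMap.fderiv]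
    exact const (C := ‖L‖) fun _ => le_rfl

theorem prodMk {k : ℕ} {f : ι → W → U} {g : ι → W → V} (hf : CB k f) (hg : CB k g) :
    CB k (fun i x => (f i x, g i x)) := by
  have := (clm (ContinuousLinearMap.inl ℝ U V) hf).add
    (clm (ContinuousLinearMap.inr ℝ U V) hg)
  simpa using this

/-- A four point estimate for maps with Lipschitz derivative. -/
theorem four_point {f : ι → W → U} (hf : CB 1 f) : ∃ C : ℝ, 0 ≤ C ∧ ∀ i a b a' b',
    ‖f i a - f i b - (f i a' - f i b')‖
      ≤ C * (‖(a - b) - (a' - b')‖ + ‖a - b‖ * (‖b - b'‖ + ‖(a - b) - (a' - b')‖)) := by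
  obtain ⟨C, hC0, hC⟩ := hf.fderiv.bounded
  obtain ⟨D, hD0, hD⟩ := hf.fderiv.lipschitz
  refine ⟨C + D, by positivity, fun i a b a' b' => ?_⟩
  set p := a - b with hp
  set p' := a' - b' with hp'
  -- γ runs from f(b) - f(b') to f(a) - f(a'), so the four point difference is γ(1) - γ(0). Its
  -- derivative vanishes when p = p' and the base points agree.
  let γ : ℝ → U := fun t => f i (b + t • p) - f i (b' + t • p')
  have hγ : ∀ t : ℝ, HasDerivAt γ (_root_.fderiv ℝ (f i) (b + t • p) p
      - _root_.fderiv ℝ (f i) (b' + t • p') p') t := by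
    intro t
    have h1 : ∀ c q : W, HasDerivAt (fun t : ℝ => f i (c + t • q))
        (_root_.fderiv ℝ (f i) (c + t • q) q) t := by
      intro c q
      have : HasDerivAt (fun t : ℝ => c + t • q) q t := by
        simpa using ((hasDerivAt_id t).smul_const q).const_add c
      exact (hf.differentiable i _).hasFDerivAt.comp_hasDerivAt t this
    exact (h1 _ _).sub (h1 _ _)
  have key := norm_image_sub_le_of_norm_deriv_le_segment_01' (f := γ)
    (C := C * ‖p - p'‖ + D * (‖b - b'‖ + ‖p - p'‖) * ‖p‖)
    (fun t _ => (hγ t).hasDerivWithinAt) (fun t ht => by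
      have e : _root_.fderiv ℝ (f i) (b + t • p) p - _root_.fderiv ℝ (f i) (b' + t • p') p'
          = _root_.fderiv ℝ (f i) (b' + t • p') (p - p')
            + (_root_.fderiv ℝ (f i) (b + t • p) - _root_.fderiv ℝ (f i) (b' + t • p')) p := by
        simp
      rw [e]
      refine norm_add_le_of_le ?_ ?_
      · exact (ContinuousLinearMap.le_opNorm _ _).trans (by gcongr; exact hC _ _)
      · refine (ContinuousLinearMap.le_opNorm _ _).trans ?_
        gcongr
        refine (hD _ _ _).trans ?_
        gcongr
        have e2 : b + t • p - (b' + t • p') = (b - b') + t • (p - p') := by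
          module
        rw [e2]
        refine norm_add_le_of_le le_rfl ?_
        rw [norm_smul, Real.norm_of_nonneg ht.1]
        exact mul_le_of_le_one_left (norm_nonneg _) ht.2.le)
  have e3 : γ 1 - γ 0 = f i a - f i b - (f i a' - f i b') := by
    simp only [γ, hp, hp', one_smul, zero_smul, add_zero, add_sub_cancel]
    abel
  rw [e3] at key
  refine key.trans ?_
  have h1 : 0 ≤ ‖p - p'‖ := norm_nonneg _
  have h2 : 0 ≤ ‖p‖ * (‖b - b'‖ + ‖p - p'‖) := by positivity
  nlinarith [mul_nonneg hD0 h1, mul_nonneg hC0 h2]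

theorem norm_taylor_one_le {f : W → U} (hf : Differentiable ℝ f) {D : ℝ} (hD0 : 0 ≤ D)
    (hD : ∀ x y, ‖_root_.fderiv ℝ f x - _root_.fderiv ℝ f y‖ ≤ D * ‖x - y‖) (x y : W) :
    ‖f y - f x - _root_.fderiv ℝ f x (y - x)‖ ≤ D * ‖y - x‖ ^ 2 := by
  have : ‖f y - f x - _root_.fderiv ℝ f x (y - x)‖ ≤ D * ‖y - x‖ * ‖y - x‖ := by
    refine (convex_segment x y).norm_image_sub_le_of_norm_fderiv_le'
      (fun z _ => hf z) (fun z hz => (hD z x).trans ?_)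
      (left_mem_segment ℝ x y) (right_mem_segment ℝ x y)
    gcongr
    exact norm_sub_le_of_mem_segment hz
  rwa [sq, ← mul_assoc]

/-- First order Taylor remainders. -/
theorem taylor_one {f : ι → W → U} (hf : CB 1 f) : ∃ C : ℝ, 0 ≤ C ∧ ∀ i x y,
    ‖f i y - f i x - _root_.fderiv ℝ (f i) x (y - x)‖ ≤ C * ‖y - x‖ ^ 2 := by
  obtain ⟨D, hD0, hD⟩ := hf.fderiv.lipschitz
  exact ⟨D, hD0, fun i => norm_taylor_one_le (hf.differentiable i) hD0 (hD i)⟩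

/-- First order Taylor remainders `R(x, p)` depend Lipschitz continuously on `(x, p)`. -/
theorem taylor_one_lipschitz {f : ι → W → U} (hf : CB 2 f) : ∃ C : ℝ, 0 ≤ C ∧ ∀ i x p x' p',
    ‖f i (x + p) - f i x - _root_.fderiv ℝ (f i) x p
      - (f i (x' + p') - f i x' - _root_.fderiv ℝ (f i) x' p')‖
      ≤ C * (‖p‖ ^ 2 * ‖x - x'‖ + (‖p‖ + ‖p'‖) * ‖p - p'‖) := by
  obtain ⟨C, hC0, hC⟩ := hf.fderiv.taylor_one
  obtain ⟨D, hD0, hD⟩ := hf.fderiv.lipschitz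
  refine ⟨C + D, by positivity, fun i x p x' p' => ?_⟩
  -- Moving the base point with p fixed: by symmetry of D²f, the derivative of the remainder in the
  -- base point is the first order Taylor remainder of Df, of size ‖p‖².
  have h1 : ‖(f i (x + p) - f i x - _root_.fderiv ℝ (f i) x p)
      - (f i (x' + p) - f i x' - _root_.fderiv ℝ (f i) x' p)‖ ≤ C * ‖p‖ ^ 2 * ‖x - x'‖ := by
    have hd : ∀ z, HasFDerivAt (fun z => f i (z + p) - f i z - _root_.fderiv ℝ (f i) z p)
        (_root_.fderiv ℝ (f i) (z + p) - _root_.fderiv ℝ (f i) z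
          - _root_.fderiv ℝ (_root_.fderiv ℝ (f i)) z p) z := by
      intro z
      have e1 : HasFDerivAt (fun z => f i (z + p)) (_root_.fderiv ℝ (f i) (z + p)) z :=
        (hf.differentiable i (z + p)).hasFDerivAt.comp z ((hasFDerivAt_id z).add_const p)
      have e2 : HasFDerivAt (fun z => _root_.fderiv ℝ (f i) z p)
          (_root_.fderiv ℝ (_root_.fderiv ℝ (f i)) z p) z := by
        have e3 := ((hf.fderiv.differentiable i z).hasFDerivAt).clm_apply (hasFDerivAt_const p z)
        convert e3 using 1
        ext w
        simpa using second_derivative_symmetric (fun y => (hf.differentiable i y).hasFDerivAt)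
          (hf.fderiv.differentiable i z).hasFDerivAt p w
      exact (e1.sub (hf.differentiable i z).hasFDerivAt).sub e2
    refine lipschitz_of_fderiv_le (f := fun z => f i (z + p) - f i z - _root_.fderiv ℝ (f i) z p)
      (fun z => (hd z).differentiableAt) (fun z => ?_) x x'
    rw [(hd z).fderiv]
    simpa using hC i z (z + p)
  -- Moving the increment with x' fixed: on the segment, Df differs from Df(x') by at most a
  -- multiple of the distance to x'.
  have h2 : ‖f i (x' + p) - f i (x' + p') - _root_.fderiv ℝ (f i) x' (x' + p - (x' + p'))‖
      ≤ D * (‖p‖ + ‖p'‖) * ‖x' + p - (x' + p')‖ := by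
    refine (convex_segment (x' + p') (x' + p)).norm_image_sub_le_of_norm_fderiv_le'
      (fun z _ => hf.differentiable i z) (fun z hz => (hD i z x').trans ?_)
      (left_mem_segment ℝ _ _) (right_mem_segment ℝ _ _)
    gcongr
    obtain ⟨a, b, ha, hb, hab, rfl⟩ := hz
    have e : a • (x' + p') + b • (x' + p) - x' = a • p' + b • p := by
      have : x' = (a + b) • x' := by rw [hab, one_smul]
      nth_rw 3 [this]
      module
    rw [e, add_comm ‖p‖]
    refine norm_add_le_of_le ?_ ?_ <;> rw [norm_smul, Real.norm_of_nonneg (by assumption)] <;>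
      exact mul_le_of_le_one_left (norm_nonneg _) (by linarith)
  rw [add_sub_add_left_eq_sub] at h2
  have e : f i (x + p) - f i x - _root_.fderiv ℝ (f i) x p
      - (f i (x' + p') - f i x' - _root_.fderiv ℝ (f i) x' p')
      = ((f i (x + p) - f i x - _root_.fderiv ℝ (f i) x p)
        - (f i (x' + p) - f i x' - _root_.fderiv ℝ (f i) x' p))
        + (f i (x' + p) - f i (x' + p') - _root_.fderiv ℝ (f i) x' (p - p')) := by
    rw [map_sub]; abel
  rw [e]
  refine (norm_add_le_of_le h1 h2).trans ?_
  have a1 : 0 ≤ ‖p‖ ^ 2 * ‖x - x'‖ := by positivity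
  have a2 : 0 ≤ (‖p‖ + ‖p'‖) * ‖p - p'‖ := by positivity
  nlinarith [mul_nonneg hC0 a2, mul_nonneg hD0 a1]

end CB

/-! ### Examples of `C^{k,1}` maps -/

section Examples

variable {W U : Type} [NormedAddCommGroup W] [NormedSpace ℝ W] [NormedAddCommGroup U]
  [NormedSpace ℝ U]

theorem CB.of_contDiff_hasCompactSupport : ∀ {k : ℕ} {U : Type} [NormedAddCommGroup U]
    [NormedSpace ℝ U] {f : W → U}, ContDiff ℝ (⊤ : ℕ∞) f → HasCompactSupport f →
    CB k (fun (_ : Unit) => f)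
  | k, U, _, _, f, hf, hs => by
    obtain ⟨C, hC⟩ := hf.continuous.bounded_above_of_compact_support hs
    have hd : Differentiable ℝ f := hf.differentiable (by simp)
    have hf' : ContDiff ℝ (⊤ : ℕ∞) (_root_.fderiv ℝ f) := hf.fderiv_right (by simp)
    cases k with
    | zero =>
      obtain ⟨D, hD⟩ := hf'.continuous.bounded_above_of_compact_support (hs.fderiv (𝕜 := ℝ))
      exact zero_intro (fun _ => hC) fun _ => lipschitz_of_fderiv_le hd hD
    | succ k =>
      exact ⟨⟨C, fun _ => hC⟩, fun _ => hd,
        CB.of_contDiff_hasCompactSupport hf' (hs.fderiv (𝕜 := ℝ))⟩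

/-- A smooth bounded map which is the identity on the ball of radius `2`. -/
theorem exists_cutoff [FiniteDimensional ℝ W] : ∃ χ : W → W,
    (∀ k, CB k (fun (_ : Unit) => χ)) ∧ ∀ v, ‖v‖ < 2 → χ v = v := by
  -- Tangent vectors start in the unit ball and move by less than 1, so radius 2 keeps them where
  -- the cut-off is inactive.
  let f : ContDiffBump (0 : W) := ⟨2, 3, by norm_num, by norm_num⟩
  refine ⟨fun v => f v • v, fun k => ?_, fun v hv => ?_⟩
  · exact CB.of_contDiff_hasCompactSupport (f.contDiff.smul contDiff_id)
      f.hasCompactSupport.smul_right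
  · have : f v = 1 := f.one_of_mem_closedBall (by simpa using hv.le)
    simp [this]

/-- On the whole space the formal derivatives are true ones: the expansion of level j says that `p ·
j` is differentiable with derivative `p · (j + 1)`. The induction goes down in j from k, where the
expansion is just a Lipschitz bound; i counts the remaining derivatives. -/
theorem CB.of_stein {k : ℕ} {p : W → FormalMultilinearSeries ℝ W U} {M : ℝ}
    (hb : ∀ x, ∀ j ≤ k, ‖p x j‖ ≤ M)
    (hs : ∀ x, ∀ j ≤ k, ∀ (e : Equiv.Perm (Fin j)) (v : Fin j → W), p x j (v ∘ e) = p x j v)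
    (hR : ∀ x₀ x₁, ∀ j ≤ k, ∀ v : Fin j → W,
        ‖p x₁ j v - ∑ l ∈ Finset.range (k - j + 1),
            ((1 : ℝ) / (l ! : ℝ)) • p x₀ (j + l) (Fin.append v (fun _ : Fin l => x₁ - x₀))‖
          ≤ M * ‖x₁ - x₀‖ ^ (((k : ℝ) + 1) - (j : ℝ)) * ∏ i, ‖v i‖) :
    ∀ i j, i + j = k → CB i (fun (_ : Unit) x => p x j) := by
  have hM : 0 ≤ M := (norm_nonneg _).trans (hb 0 0 (Nat.zero_le _))
  have hzero : ∀ x j (v : Fin j → W) (w : Fin 0 → W), p x (j + 0) (Fin.append v w) = p x j v := by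
    intro x j v w
    congr 1
    funext i
    exact Fin.append_left v w i
  intro i
  induction i with
  | zero =>
    intro j hj
    obtain rfl : k = j := by omega
    refine zero_intro (C := M) (D := M) (fun _ x => hb x _ le_rfl) (fun _ x y => ?_)
    refine ContinuousMultilinearMap.opNorm_le_bound (by positivity) fun v => ?_
    have := hR y x k le_rfl v
    rw [Nat.sub_self, zero_add, Finset.sum_range_one, hzero] at this
    simpa using this
  | succ i ih =>
    intro j hj
    have IH := ih (j + 1) (by omega)
    have hd : ∀ x, HasFDerivAt (fun x => p x j) ((p x (j + 1)).curryLeft) x := by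
      intro x
      rw [hasFDerivAt_iff_isLittleO_nhds_zero]
      -- Beyond the constant and linear terms, everything is O(‖h‖²) for ‖h‖ ≤ 1: the Taylor terms
      -- with l ≥ 2, and the remainder, whose exponent k + 1 - j equals i + 2.
      have hO : (fun h : W => p (x + h) j - p x j - (p x (j + 1)).curryLeft h)
          =O[nhds 0] fun h => ‖h‖ ^ 2 := by
        refine Asymptotics.IsBigO.of_bound (M * (k + 3)) ?_
        filter_upwards [Metric.ball_mem_nhds (0 : W) one_pos] with h hh
        have hh1 : ‖h‖ ≤ 1 := by simpa using (mem_ball_zero_iff.1 hh).le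
        rw [norm_pow, norm_norm]
        refine ContinuousMultilinearMap.opNorm_le_bound (by positivity) fun v => ?_
        have key := hR x (x + h) j (by omega) v
        rw [add_sub_cancel_left] at key
        have hkj : k - j + 1 = i + 1 + 1 := by omega
        rw [hkj, Finset.sum_range_succ', Finset.sum_range_succ', hzero] at key
        set P := ∏ i, ‖v i‖
        have hP : 0 ≤ P := Finset.prod_nonneg fun _ _ => norm_nonneg _
        -- The Taylor formula inserts h in the last slot and `curryLeft` in the first; a cyclic
        -- rotation and symmetry identify the two.
        have t1 : p x (j + 1) (Fin.append v (fun _ : Fin 1 => h)) = p x (j + 1) (Fin.cons h v) := by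
          rw [← hs x (j + 1) (by omega) (finRotate (j + 1)) (Fin.cons h v)]
          congr 1
          funext a
          refine Fin.lastCases ?_ (fun b => ?_) a
          · simp only [Function.comp_apply, finRotate_last, Fin.cons_zero]
            exact Fin.append_right v (fun _ : Fin 1 => h) 0
          · simp only [Function.comp_apply, finRotate_apply, Fin.coeSucc_eq_succ, Fin.cons_succ]
            exact Fin.append_left v (fun _ : Fin 1 => h) b
        have t2 : ‖∑ l ∈ Finset.range i, ((1 : ℝ) / ((l + 1 + 1)! : ℝ)) • p x (j + (l + 1 + 1))
            (Fin.append v (fun _ : Fin (l + 1 + 1) => h))‖ ≤ k * (M * ‖h‖ ^ 2 * P) := by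
          refine (norm_sum_le_of_le (n := fun _ => M * ‖h‖ ^ 2 * P) _ fun l hl => ?_).trans ?_
          · rw [norm_smul, Real.norm_of_nonneg (by positivity)]
            refine (mul_le_of_le_one_left (norm_nonneg _) ?_).trans ?_
            · rw [div_le_one (by positivity)]
              exact_mod_cast Nat.succ_le_of_lt (Nat.factorial_pos _)
            · refine ((p x (j + (l + 1 + 1))).le_opNorm _).trans ?_
              have hl' := Finset.mem_range.1 hl
              rw [Fin.prod_univ_add, mul_assoc, mul_comm (‖h‖ ^ 2)]
              simp only [Fin.append_left, Fin.append_right, Finset.prod_const, Finset.card_univ,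
                Fintype.card_fin]
              have h2 : ‖h‖ ^ (l + 1 + 1) ≤ ‖h‖ ^ 2 :=
                pow_le_pow_of_le_one (norm_nonneg _) hh1 (by omega)
              exact mul_le_mul (hb x _ (by omega)) (mul_le_mul_of_nonneg_left h2 hP)
                (by positivity) hM
          · rw [Finset.sum_const, Finset.card_range, nsmul_eq_mul]
            gcongr
            omega
        have t3 : ‖h‖ ^ ((k : ℝ) + 1 - j) ≤ ‖h‖ ^ 2 := by
          have : (k : ℝ) + 1 - j = ((i + 2 : ℕ) : ℝ) := by
            rw [← hj]; push_cast; ring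
          rw [this, Real.rpow_natCast]
          exact pow_le_pow_of_le_one (norm_nonneg _) hh1 (by omega)
        have e : (p (x + h) j - p x j - (p x (j + 1)).curryLeft h) v
            = (p (x + h) j v - (∑ l ∈ Finset.range i, ((1 : ℝ) / ((l + 1 + 1)! : ℝ)) •
                p x (j + (l + 1 + 1)) (Fin.append v (fun _ : Fin (l + 1 + 1) => h))
              + ((1 : ℝ) / ((0 + 1)! : ℝ)) • p x (j + (0 + 1)) (Fin.append v fun _ => h)
              + ((1 : ℝ) / (0 ! : ℝ)) • p x j v))
              + ∑ l ∈ Finset.range i, ((1 : ℝ) / ((l + 1 + 1)! : ℝ)) •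
                p x (j + (l + 1 + 1)) (Fin.append v (fun _ : Fin (l + 1 + 1) => h)) := by
          have : p x (j + (0 + 1)) (Fin.append v fun _ : Fin (0 + 1) => h)
              = p x (j + 1) (Fin.cons h v) := t1
          rw [this]
          simp only [sub_apply, ContinuousMultilinearMap.curryLeft_apply,
            zero_add, Nat.factorial_one, Nat.factorial_zero, Nat.cast_one, div_one, one_smul]
          abel
        rw [e]
        refine (norm_add_le_of_le key t2).trans ?_
        have : M * ‖h‖ ^ ((k : ℝ) + 1 - j) * P ≤ M * ‖h‖ ^ 2 * P := by gcongr
        nlinarith [mul_nonneg (mul_nonneg hM (sq_nonneg ‖h‖)) hP]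
      refine hO.trans_isLittleO ?_
      refine Asymptotics.IsLittleO.of_norm_right ?_
      exact (Asymptotics.isLittleO_pow_id (𝕜 := ℝ) one_lt_two).comp_tendsto tendsto_norm_zero
    refine ⟨⟨M, fun _ x => hb x _ (by omega)⟩, fun _ x => (hd x).differentiableAt, ?_⟩
    have : (fun (_ : Unit) x => _root_.fderiv ℝ (fun x => p x j) x) = fun _ x =>
        (continuousMultilinearCurryLeftEquiv ℝ (fun _ : Fin (j + 1) =>
          W) U).toContinuousLinearEquiv.toContinuousLinearMap (p x (j + 1)) := by
      funext _ x
      exact (hd x).fderiv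
    rw [this]
    exact IH.clm _

theorem IsLip.cb {k : ℕ} {f : W → U} (hf : IsLip (k + 1) f) : CB k (fun (_ : Unit) => f) := by
  obtain ⟨k', h1, h2, p, M, hfb, hp0, hs, hb, hR⟩ := hf
  have : k' = k := by
    have h1' : k' < k + 1 := by exact_mod_cast h1
    have h2' : k + 1 ≤ k' + 1 := by exact_mod_cast h2
    omega
  subst this
  have hM : 0 ≤ M := (norm_nonneg _).trans (hfb 0)
  have := CB.of_stein (k := k') (p := p) (M := M) (fun x j hj => ?_) hs hR k' 0 rfl
  · have h3 := this.clm (ContinuousMultilinearMap.apply ℝ (fun _ : Fin 0 => W) U 0)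
    convert h3 using 3 with _ x
    exact (hp0 x 0).symm
  · rcases Nat.eq_zero_or_pos j with rfl | h
    · refine ContinuousMultilinearMap.opNorm_le_bound hM fun v => ?_
      rw [hp0]
      simpa using hfb x
    · exact hb x j (by simp; omega)

end Examples

/-! ### Discrete sewing -/

theorem le_rpow_sq {α h : ℝ} (hα' : α ≤ 1 / 2) (h0 : 0 ≤ h) (h1 : h ≤ 1) : h ≤ (h ^ α) ^ 2 := by
  rcases h0.eq_or_lt with rfl | h0
  · positivity
  · rw [← Real.rpow_mul_natCast h0.le]
    nth_rw 1 [← Real.rpow_one h]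
    exact Real.rpow_le_rpow_of_exponent_ge h0 h1 (by push_cast; linarith)

theorem mul_rpow_le_cube {α h : ℝ} (hα' : α ≤ 1 / 2) (h0 : 0 ≤ h) (h1 : h ≤ 1) :
    h * h ^ α ≤ (h ^ α) ^ 3 := by
  have := le_rpow_sq hα' h0 h1
  have h2 : 0 ≤ h ^ α := Real.rpow_nonneg h0 _
  nlinarith

theorem exists_pos_forall_mul_rpow_le {α : ℝ} (hα : 0 < α) (c : ℝ) {e : ℝ} (he : 0 < e) :
    ∃ h₀ : ℝ, 0 < h₀ ∧ h₀ ≤ 1 ∧ ∀ h, 0 ≤ h → h ≤ h₀ → c * h ^ α ≤ e := by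
  have hc : Continuous fun h : ℝ => c * h ^ α := by
    have := Real.continuous_rpow_const (q := α) hα.le
    fun_prop
  have h1 : ∀ᶠ h in nhds (0 : ℝ), c * h ^ α < e :=
    hc.continuousAt.eventually_lt continuousAt_const (by simpa [Real.zero_rpow hα.ne'] using he)
  obtain ⟨ε, hε, hb⟩ := Metric.eventually_nhds_iff.1 h1
  refine ⟨min (ε / 2) 1, by positivity, min_le_right _ _, fun h h0 hh => (hb ?_).le⟩
  rw [Real.dist_eq, sub_zero, abs_of_nonneg h0]
  linarith [hh.trans (min_le_left _ _)]

theorem half_rpow_cube {α h : ℝ} (h0 : 0 ≤ h) :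
    2 * ((h / 2) ^ α) ^ 3 = (2 : ℝ) ^ (1 - 3 * α) * (h ^ α) ^ 3 := by
  rw [Real.div_rpow h0 zero_le_two, div_pow, Real.rpow_sub two_pos, Real.rpow_one, mul_comm 3 α,
    show (3 : ℝ) = ((3 : ℕ) : ℝ) by norm_num, Real.rpow_mul_natCast zero_le_two]
  ring

theorem two_rpow_lt_one {α : ℝ} (hα : 1 / 3 < α) : (2 : ℝ) ^ (1 - 3 * α) < 1 :=
  Real.rpow_lt_one_of_one_lt_of_neg one_lt_two (by linarith)

/-- The arithmetic of one induction step of `davie_sewing`: x, y, z are the lengths of the left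
piece, the gap and the right piece, and g, G, H, g' are the α-powers of the lengths of the left
piece, the left piece with the gap, the whole and the right piece. The first two conclusions are the
smallness conditions for composing twice; the third closes the induction, because the outer pieces
use only r₀ B H³ of the available B H³. -/
theorem sewing_arith {K K₀ B r₀ r H g g' G x y z : ℝ} (hK : 0 ≤ K) (hK₀ : 0 ≤ K₀) (hB : 0 ≤ B)
    (hBr : 3 * K * K₀ + 3 * K = B - r * B) (hH0 : 0 ≤ H) (hH1 : H ≤ 1)
    (ha : (4 * K₀ + 2 * B + 4 * K) * H ≤ 1) (hb : 3 * K * r₀ * H ≤ r - r₀) (hx : 0 ≤ x)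
    (hy : 0 ≤ y) (hz : 0 ≤ z) (hg : 0 ≤ g) (hgG : g ≤ G) (hGH : G ≤ H) (hxg : x ≤ g ^ 2)
    (hh : x + y + z ≤ H ^ 2) (hhH : (x + y + z) * H ≤ H ^ 3) (hg' : 0 ≤ g')
    (hsum : g ^ 3 + g' ^ 3 ≤ r₀ * H ^ 3) :
    K₀ * x + B * g ^ 3 ≤ G ∧
    (1 + K * H) * (K₀ * x + B * g ^ 3 + K₀ * y) + K * H ^ 3 ≤ H ∧
    (1 + K * H) * ((1 + K * H) * (K₀ * x + B * g ^ 3 + K₀ * y) + K * H ^ 3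
      + (K₀ * z + B * g' ^ 3)) + K * H ^ 3 ≤ K₀ * (x + y + z) + B * H ^ 3 := by
  have k1 : 0 ≤ K * H := by positivity
  have k2 : 0 ≤ K₀ * H := by positivity
  have k3 : 0 ≤ B * H := by positivity
  have hKH : K * H ≤ 1 := by linarith
  have hgH : g ≤ H := hgG.trans hGH
  have hG : 0 ≤ G := hg.trans hgG
  refine ⟨?_, ?_, ?_⟩
  · have h3 : K₀ * x ≤ (K₀ * H) * g := by
      have : x ≤ H * g := by nlinarith
      nlinarith [mul_le_mul_of_nonneg_left this hK₀]
    have h4 : B * g ^ 3 ≤ (B * H) * g := by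
      have : g ^ 3 ≤ H * g := by
        have h5 : g ^ 2 ≤ H := by nlinarith
        nlinarith [mul_le_mul_of_nonneg_left h5 hg]
      nlinarith [mul_le_mul_of_nonneg_left this hB]
    have h6 : (K₀ * H + B * H) * g ≤ 1 * g := mul_le_mul_of_nonneg_right (by linarith) hg
    linarith
  · have g3 : g ^ 3 ≤ H ^ 3 := by gcongr
    have H3 : H ^ 3 ≤ H ^ 2 := pow_le_pow_of_le_one hH0 hH1 (by norm_num)
    have a1 : K₀ * x ≤ K₀ * H ^ 2 := mul_le_mul_of_nonneg_left (by linarith) hK₀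
    have a2 : K₀ * y ≤ K₀ * H ^ 2 := mul_le_mul_of_nonneg_left (by linarith) hK₀
    have a3 : B * g ^ 3 ≤ B * H ^ 2 := mul_le_mul_of_nonneg_left (by linarith) hB
    have a4 : K * H ^ 3 ≤ K * H ^ 2 := mul_le_mul_of_nonneg_left H3 hK
    have a5 : (1 + K * H) * (K₀ * x + B * g ^ 3 + K₀ * y) ≤ 2 * (2 * K₀ * H ^ 2 + B * H ^ 2) :=
      mul_le_mul (by linarith) (by linarith) (by positivity) (by norm_num)
    have a6 : ((4 * K₀ + 2 * B + 4 * K) * H) * H ≤ 1 * H := mul_le_mul_of_nonneg_right ha hH0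
    have a7 : 0 ≤ K * H ^ 2 := by positivity
    linarith
  · set c := K₀ * x + B * g ^ 3 + K₀ * y with hc
    set c3 := K₀ * z + B * g' ^ 3 with hc3
    have c0 : 0 ≤ c := by positivity
    have c30 : 0 ≤ c3 := by positivity
    have csum : c + c3 ≤ K₀ * (x + y + z) + r₀ * H ^ 3 * B := by
      have := mul_le_mul_of_nonneg_left hsum hB
      rw [hc, hc3]; linarith
    have x1 : 0 ≤ K * H ^ 3 := by positivity
    have f1 : (1 + K * H) * ((1 + K * H) * c + K * H ^ 3 + c3) + K * H ^ 3
        ≤ (1 + 3 * (K * H)) * (c + c3) + 3 * (K * H ^ 3) := by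
      have y1 : K * H * (K * H) * c ≤ K * H * 1 * c := by gcongr
      have y2 : K * H * (K * H ^ 3) ≤ 1 * (K * H ^ 3) := by gcongr
      have y3 : 0 ≤ K * H * c3 := by positivity
      linarith
    have f2 : (1 + 3 * (K * H)) * (c + c3)
        ≤ (1 + 3 * (K * H)) * (K₀ * (x + y + z) + r₀ * H ^ 3 * B) :=
      mul_le_mul_of_nonneg_left csum (by positivity)
    have f3 : 3 * K * K₀ * ((x + y + z) * H) ≤ 3 * K * K₀ * H ^ 3 := by gcongr
    have f4 : (r₀ + 3 * K * r₀ * H) * (H ^ 3 * B) ≤ r * (H ^ 3 * B) := by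
      gcongr
      linarith
    have f5 : (3 * K * K₀ + 3 * K) * H ^ 3 = (B - r * B) * H ^ 3 := by rw [hBr]
    linarith

/-- Davie's discrete sewing lemma for almost additive bounds `Q s t c` on a finite set of times. -/
theorem davie_sewing {α : ℝ} (hα : 1 / 3 < α) (hα' : α ≤ 1 / 2) {K K₀ : ℝ} (hK : 0 ≤ K)
    (hK₀ : 0 ≤ K₀) : ∃ h₀ : ℝ, 0 < h₀ ∧ h₀ ≤ 1 ∧ ∃ B : ℝ, 0 ≤ B ∧ ∀ h₁ ≤ h₀, ∀ (S : Finset ℝ)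
    (a b : ℝ) (Q : ℝ → ℝ → ℝ → Prop), (∀ s t c c', c ≤ c' → Q s t c → Q s t c') →
    (∀ s ∈ S, a ≤ s → s ≤ b → Q s s 0) →
    (∀ s ∈ S, ∀ t ∈ S, a ≤ s → s < t → t ≤ b → t - s ≤ h₁ → (∀ u ∈ S, u ≤ s ∨ t ≤ u) →
      Q s t (K₀ * (t - s))) →
    (∀ s ∈ S, ∀ u ∈ S, ∀ t ∈ S, a ≤ s → s ≤ u → u ≤ t → t ≤ b → t - s ≤ h₁ → ∀ c c', 0 ≤ c →
      0 ≤ c' → c ≤ (t - s) ^ α → Q s u c → Q u t c' →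
      Q s t ((1 + K * (t - s) ^ α) * (c + c') + K * ((t - s) ^ α) ^ 3)) →
    ∀ s ∈ S, ∀ t ∈ S, a ≤ s → s ≤ t → t ≤ b → t - s ≤ h₁ →
      Q s t (K₀ * (t - s) + B * ((t - s) ^ α) ^ 3) := by
  have hα0 : 0 < α := by linarith
  set r₀ : ℝ := 2 ^ (1 - 3 * α) with hr₀
  have hr₀1 : r₀ < 1 := two_rpow_lt_one hα
  -- The factor r lies strictly between r₀ and 1. The gap r - r₀ pays for the multiplicative error 1
  -- + 3KH, and the gap 1 - r for the additive errors, which dictates B.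
  set r := (1 + r₀) / 2 with hr
  have hr1 : 0 < 1 - r := by linarith
  set B := (3 * K * K₀ + 3 * K) / (1 - r) with hB
  have hB0 : 0 ≤ B := by positivity
  have hBr : 3 * K * K₀ + 3 * K = B - r * B := by
    rw [hB]; field_simp
  obtain ⟨h₂, h₂0, h₂1, hh₂⟩ := exists_pos_forall_mul_rpow_le hα0 (4 * K₀ + 2 * B + 4 * K) one_pos
  obtain ⟨h₃, h₃0, h₃1, hh₃⟩ := exists_pos_forall_mul_rpow_le hα0 (3 * K * r₀)
    (e := r - r₀) (by linarith)
  refine ⟨min h₂ h₃, by positivity, (min_le_left _ _).trans h₂1, B, hB0, ?_⟩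
  -- `Q s t c` stands for "the error over [s, t] is at most c". Being a predicate, it covers both
  -- sup norms and Lipschitz constants. The window h₁ can be shrunk to where earlier estimates are
  -- available.
  intro h₁ hh₁ S a b Q mono refl step comb
  have main : ∀ n : ℕ, ∀ s ∈ S, ∀ t ∈ S, a ≤ s → s ≤ t → t ≤ b → t - s ≤ h₁ →
      (S.filter fun u => s < u ∧ u ≤ t).card = n →
      Q s t (K₀ * (t - s) + B * ((t - s) ^ α) ^ 3) := by
    intro n
    induction n using Nat.strong_induction_on with
    | _ n ih =>
    intro s hs t ht has hst htb hh hn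
    rcases hst.eq_or_lt with rfl | hst'
    · exact mono _ _ _ _ (by rw [sub_self]; positivity) (refl s hs has htb)
    -- Cut at the consecutive points u ≤ m < v of S. Both outer pieces have length at most h/2, so
    -- their cubes sum to at most 2^{1-3α} h^{3α}, with a factor below 1; the gap [u, v] is a single
    -- step.
    set m := (s + t) / 2 with hm
    obtain ⟨u, hu, hu'⟩ := (S.filter fun x => s ≤ x ∧ x ≤ m).exists_max_image id
      ⟨s, by rw [Finset.mem_filter]; exact ⟨hs, le_rfl, by linarith⟩⟩
    obtain ⟨v, hv, hv'⟩ := (S.filter fun x => m < x ∧ x ≤ t).exists_min_image id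
      ⟨t, by rw [Finset.mem_filter]; exact ⟨ht, by linarith, le_rfl⟩⟩
    simp only [Finset.mem_filter, id, and_imp] at hu hu' hv hv'
    obtain ⟨huS, hsu, hum⟩ := hu
    obtain ⟨hvS, hmv, hvt⟩ := hv
    have huv : u < v := by linarith
    have hcons : ∀ x ∈ S, x ≤ u ∨ v ≤ x := by
      intro x hx
      rcases le_or_gt x m with hxm | hxm
      · rcases le_or_gt s x with h | h
        · exact Or.inl (hu' x hx h hxm)
        · exact Or.inl (by linarith)
      · rcases le_or_gt x t with h | h
        · exact Or.inr (hv' x hx hxm h)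
        · exact Or.inr (by linarith)
    have q1 := ih _ (by
      rw [← hn]
      refine Finset.card_lt_card (Finset.ssubset_iff_of_subset ?_ |>.2 ⟨t, ?_, ?_⟩)
      · intro x; simp only [Finset.mem_filter]; rintro ⟨h1, h2, h3⟩; exact ⟨h1, h2, by linarith⟩
      · simp only [Finset.mem_filter]; exact ⟨ht, hst', le_rfl⟩
      · simp only [Finset.mem_filter]; rintro ⟨_, _, h3⟩; linarith) s hs u huS has hsu (by linarith)
      (by linarith) rfl
    have q3 := ih _ (by
      rw [← hn]
      refine Finset.card_lt_card (Finset.ssubset_iff_of_subset ?_ |>.2 ⟨v, ?_, ?_⟩)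
      · intro x; simp only [Finset.mem_filter]; rintro ⟨h1, h2, h3⟩; exact ⟨h1, by linarith, h3⟩
      · simp only [Finset.mem_filter]; exact ⟨hvS, by linarith, hvt⟩
      · simp only [Finset.mem_filter]; rintro ⟨_, h3, _⟩; linarith) v hvS t ht (by linarith) hvt htb
      (by linarith) rfl
    have q2 := step u huS v hvS (by linarith) huv (by linarith) (by linarith) hcons
    set h := t - s with hh'
    have hpos : 0 < h := by linarith
    have hle1 : h ≤ 1 := by linarith [min_le_left h₂ h₃]
    set H := h ^ α with hH
    have hH0 : 0 < H := Real.rpow_pos_of_pos hpos _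
    have hH1 : H ≤ 1 := Real.rpow_le_one hpos.le hle1 hα0.le
    have hHa := hh₂ h hpos.le (hh.trans (hh₁.trans (min_le_left _ _)))
    have hHb := hh₃ h hpos.le (hh.trans (hh₁.trans (min_le_right _ _)))
    rw [← hH] at hHa hHb
    have hhH : h ≤ H ^ 2 := le_rpow_sq hα' hpos.le hle1
    have hhH3 : h * H ≤ H ^ 3 := mul_rpow_le_cube hα' hpos.le hle1
    set g := (u - s) ^ α with hg
    set g' := (t - v) ^ α with hg'
    have hg0 : 0 ≤ g := Real.rpow_nonneg (by linarith) _
    have hg0' : 0 ≤ g' := Real.rpow_nonneg (by linarith) _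
    have hgh : g ^ 3 ≤ ((h / 2) ^ α) ^ 3 :=
      pow_le_pow_left₀ hg0 (Real.rpow_le_rpow (by linarith) (by linarith) hα0.le) 3
    have hgh' : g' ^ 3 ≤ ((h / 2) ^ α) ^ 3 :=
      pow_le_pow_left₀ hg0' (Real.rpow_le_rpow (by linarith) (by linarith) hα0.le) 3
    have hhalf := half_rpow_cube (α := α) hpos.le
    rw [← hr₀, ← hH] at hhalf
    set G := (v - s) ^ α with hG
    have hGH : G ≤ H := Real.rpow_le_rpow (by linarith) (by linarith) hα0.le
    have hgG : g ≤ G := Real.rpow_le_rpow (by linarith) (by linarith) hα0.le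
    have hxyz : (u - s) + (v - u) + (t - v) = h := by rw [hh']; ring
    obtain ⟨r1, r2, r3⟩ := sewing_arith (x := u - s) (y := v - u) (z := t - v) hK hK₀ hB0
      hBr hH0.le hH1 hHa hHb (by linarith) (by linarith) (by linarith) hg0 hgG hGH
      (le_rpow_sq hα' (by linarith) (by linarith)) (by rwa [hxyz]) (by rwa [hxyz]) hg0'
      (by linarith)
    rw [hxyz] at r3
    have c1n : 0 ≤ K₀ * (u - s) + B * g ^ 3 :=
      add_nonneg (mul_nonneg hK₀ (by linarith)) (by positivity)
    have c2n : 0 ≤ K₀ * (v - u) := mul_nonneg hK₀ (by linarith)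
    have c3n : 0 ≤ K₀ * (t - v) + B * g' ^ 3 :=
      add_nonneg (mul_nonneg hK₀ (by linarith)) (by positivity)
    have q12 : Q s v ((1 + K * H) * (K₀ * (u - s) + B * g ^ 3 + K₀ * (v - u)) + K * H ^ 3) := by
      refine mono _ _ _ _ ?_ (comb s hs u huS v hvS has hsu huv.le (by linarith) (by linarith)
        _ _ c1n c2n r1 q1 q2)
      have hG0 : 0 ≤ G := hg0.trans hgG
      have hG3 : G ^ 3 ≤ H ^ 3 := pow_le_pow_left₀ hG0 hGH 3
      gcongr
    exact mono _ _ _ _ r3 (comb s hs v hvS t ht has (by linarith) hvt htb hh _ _ (by positivity) c3n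
      r2 q12 q3)
  intro s hs t ht has hst htb hh
  exact main _ s hs t ht has hst htb hh rfl

/-! ### Euler flows on finite sets of times -/

/-- On the finite set of times `S`, `Φ` is the flow obtained by composing the one-step maps `ψ`. -/
structure IsEulerFlow {E : Type} (ψ : ℝ → ℝ → E → E) (S : Finset ℝ) (Φ : ℝ → ℝ → E → E) :
    Prop where
  refl : ∀ s ∈ S, ∀ y, Φ s s y = y
  comp : ∀ s ∈ S, ∀ u ∈ S, ∀ t ∈ S, s ≤ u → u ≤ t → ∀ y, Φ s t y = Φ u t (Φ s u y)
  step : ∀ s ∈ S, ∀ t ∈ S, s < t → (∀ u ∈ S, u ≤ s ∨ t ≤ u) → ∀ y, Φ s t y = ψ s t y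

/-- When a new largest time a is added, the flow up to a is the flow up to the previous maximum b
followed by one step. Values at times outside S are irrelevant. -/
theorem exists_isEulerFlow {E : Type} (ψ : ℝ → ℝ → E → E) (S : Finset ℝ) :
    ∃ Φ, IsEulerFlow ψ S Φ := by
  induction S using Finset.induction_on_max with
  | empty => exact ⟨fun _ _ y => y, by simp, by simp, by simp⟩
  | insert a S hlt ih =>
    obtain ⟨Φ, hΦ⟩ := ih
    rcases S.eq_empty_or_nonempty with rfl | hne
    · refine ⟨fun _ _ y => y, by simp, by simp, ?_⟩
      intro s hs t ht hst
      simp only [insert_empty_eq, Finset.mem_singleton] at hs ht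
      linarith
    set b := S.max' hne with hb
    have hbS : b ∈ S := S.max'_mem hne
    have hba : b < a := hlt b hbS
    have hle : ∀ x ∈ S, x ≤ b := fun x hx => S.le_max' x hx
    refine ⟨fun s t y => if t = a then (if s = a then y else ψ b a (Φ s b y)) else Φ s t y,
      ?_, ?_, ?_⟩
    · intro s hs y
      rcases Finset.mem_insert.1 hs with rfl | hs
      · simp
      · simp [(hlt s hs).ne, hΦ.refl s hs]
    · intro s hs u hu t ht hsu hut y
      rcases Finset.mem_insert.1 ht with rfl | ht
      · rcases Finset.mem_insert.1 hu with rfl | hu'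
        · simp
        · have hs' : s ∈ S := by
            rcases Finset.mem_insert.1 hs with rfl | hs
            · exact absurd (hlt u hu') (by linarith)
            · exact hs
          simp only [if_true, (hlt u hu').ne, (hlt s hs').ne, if_false]
          rw [hΦ.comp s hs' u hu' b hbS hsu (hle u hu')]
      · have hta := hlt t ht
        have hu' : u ∈ S := by
          rcases Finset.mem_insert.1 hu with rfl | hu
          · exact absurd hta (by linarith)
          · exact hu
        have hs' : s ∈ S := by
          rcases Finset.mem_insert.1 hs with rfl | hs
          · exact absurd hta (by linarith)
          · exact hs
        simp only [hta.ne, (hlt u hu').ne, if_false]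
        exact hΦ.comp s hs' u hu' t ht hsu hut y
    · intro s hs t ht hst hcons y
      rcases Finset.mem_insert.1 ht with rfl | ht
      · have hs' : s ∈ S := by
          rcases Finset.mem_insert.1 hs with rfl | hs
          · exact absurd hst (lt_irrefl _)
          · exact hs
        have : s = b := by
          rcases hcons b (Finset.mem_insert_of_mem hbS) with h | h
          · exact le_antisymm (hle s hs') h
          · linarith
        simp only [if_true, hst.ne, if_false]
        rw [this, hΦ.refl b hbS]
      · have hta := hlt t ht
        have hs' : s ∈ S := by
          rcases Finset.mem_insert.1 hs with rfl | hs
          · linarith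
          · exact hs
        simp only [hta.ne, if_false]
        exact hΦ.step s hs' t ht hst (fun u hu => hcons u (Finset.mem_insert_of_mem hu)) y

/-- Induction along an Euler flow: a property which holds initially and is preserved by one-step
maps. -/
theorem IsEulerFlow.induction {E : Type} {ψ : ℝ → ℝ → E → E} {S : Finset ℝ} {Φ : ℝ → ℝ → E → E}
    (hΦ : IsEulerFlow ψ S Φ) {s : ℝ} (hs : s ∈ S) {Q : ℝ → (E → E) → Prop}
    (h0 : Q s id)
    (h1 : ∀ u ∈ S, ∀ t ∈ S, s ≤ u → u < t → (∀ x ∈ S, x ≤ u ∨ t ≤ x) → Q u (Φ s u) →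
      Q t (fun y => ψ u t (Φ s u y))) :
    ∀ t ∈ S, s ≤ t → Q t (Φ s t) := by
  have main : ∀ n : ℕ, ∀ t ∈ S, s ≤ t → (S.filter fun u => u ≤ t).card = n → Q t (Φ s t) := by
    intro n
    induction n using Nat.strong_induction_on with
    | _ n ih =>
    intro t ht hst hn
    rcases hst.eq_or_lt with rfl | hst
    · rwa [show Φ s s = id from funext (hΦ.refl s hs)]
    obtain ⟨u, hu, hu'⟩ := (S.filter fun x => s ≤ x ∧ x < t).exists_max_image id
      ⟨s, by rw [Finset.mem_filter]; exact ⟨hs, le_rfl, hst⟩⟩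
    simp only [Finset.mem_filter, id, and_imp] at hu hu'
    obtain ⟨huS, hsu, hut⟩ := hu
    have q := ih _ (by
      rw [← hn]
      refine Finset.card_lt_card (Finset.ssubset_iff_of_subset ?_ |>.2 ⟨t, ?_, ?_⟩)
      · intro x; simp only [Finset.mem_filter]; rintro ⟨h1, h2⟩; exact ⟨h1, by linarith⟩
      · simp only [Finset.mem_filter]; exact ⟨ht, le_rfl⟩
      · simp only [Finset.mem_filter]; rintro ⟨_, h3⟩; linarith) u huS hsu rfl
    have hcons : ∀ x ∈ S, x ≤ u ∨ t ≤ x := by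
      intro x hx
      rcases lt_or_ge x t with h | h
      · rcases le_or_gt s x with h' | h'
        · exact Or.inl (hu' x hx h' h)
        · exact Or.inl (by linarith)
      · exact Or.inr h
    have e : Φ s t = fun y => ψ u t (Φ s u y) := by
      funext y
      rw [hΦ.comp s hs u huS t ht hsu hut.le, hΦ.step u huS t ht hut hcons]
    rw [e]
    exact h1 u huS t ht hsu hut hcons q
  intro t ht hst
  exact main _ t ht hst rfl

/-- The one-step maps `y ↦ y + P_{s,t}(y)` are almost a flow, with Lipschitz estimates; `b` is a
bounded Lipschitz drift. -/
structure IsAlmostFlow {E : Type} [NormedAddCommGroup E] [NormedSpace ℝ E] (α T K : ℝ)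
    (P : ℝ → ℝ → E → E) (b : E → E) : Prop where
  nonneg : 0 ≤ K
  bound : ∀ s t, 0 ≤ s → s ≤ t → t ≤ T → t - s ≤ 1 → ∀ y, ‖P s t y‖ ≤ K * (t - s) ^ α
  lip : ∀ s t, 0 ≤ s → s ≤ t → t ≤ T → t - s ≤ 1 → ∀ y y',
    ‖P s t y - P s t y'‖ ≤ K * (t - s) ^ α * ‖y - y'‖
  four : ∀ s t, 0 ≤ s → s ≤ t → t ≤ T → t - s ≤ 1 → ∀ y r y' r',
    ‖P s t (y + r) - P s t y - (P s t (y' + r') - P s t y')‖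
      ≤ K * (t - s) ^ α * (‖r - r'‖ + ‖r‖ * (‖y - y'‖ + ‖r - r'‖))
  defect : ∀ s u t, 0 ≤ s → s ≤ u → u ≤ t → t ≤ T → t - s ≤ 1 → ∀ y,
    ‖P s u y + P u t (y + P s u y) - P s t y‖ ≤ K * ((t - s) ^ α) ^ 3
  defect_lip : ∀ s u t, 0 ≤ s → s ≤ u → u ≤ t → t ≤ T → t - s ≤ 1 → ∀ y y',
    ‖P s u y + P u t (y + P s u y) - P s t y - (P s u y' + P u t (y' + P s u y') - P s t y')‖
      ≤ K * ((t - s) ^ α) ^ 3 * ‖y - y'‖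
  drift : ∀ y, ‖b y‖ ≤ K
  drift_lip : ∀ y y', ‖b y - b y'‖ ≤ K * ‖y - y'‖

/-! ### Estimates for Euler flows, uniform in the set of times -/

section AlmostFlow

variable {E : Type} [NormedAddCommGroup E] [NormedSpace ℝ E] {α T K : ℝ} {P : ℝ → ℝ → E → E}
  {b : E → E}

theorem IsAlmostFlow.zero (hP : IsAlmostFlow α T K P b) (hα : 0 < α) {s : ℝ} (hs : 0 ≤ s)
    (hsT : s ≤ T) (y : E) : P s s y = 0 := by
  have := hP.bound s s hs le_rfl hsT (by simp) y
  rw [sub_self, Real.zero_rpow hα.ne', mul_zero] at this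
  exact norm_le_zero_iff.1 this

/-- The drift is left out of the comparison map and enters the sewing as the one-step error K₀(t -
s). Here its boundedness suffices, and in `euler_lipschitz` its Lipschitz continuity; the twice
prolonged drift has no more regularity than that. -/
theorem IsAlmostFlow.euler_bound (hP : IsAlmostFlow α T K P b) (hα : 1 / 3 < α) (hα' : α ≤ 1 / 2) :
    ∃ h₀ : ℝ, 0 < h₀ ∧ h₀ ≤ 1 ∧ ∃ L : ℝ, 0 ≤ L ∧ ∀ (S : Finset ℝ) (Φ : ℝ → ℝ → E → E),
      IsEulerFlow (fun s t y => y + P s t y + (t - s) • b y) S Φ →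
      ∀ s ∈ S, ∀ t ∈ S, 0 ≤ s → s ≤ t → t ≤ T → t - s ≤ h₀ → ∀ y,
        ‖Φ s t y - y - P s t y‖ ≤ L * ((t - s) ^ α) ^ 2 := by
  have hK := hP.nonneg
  have hα0 : 0 < α := by linarith
  obtain ⟨h₀, h0, h1, B, hB, key⟩ := davie_sewing hα hα' hK hK
  refine ⟨h₀, h0, h1, K + B, by positivity, fun S Φ hΦ => ?_⟩
  have := key h₀ le_rfl S 0 T (fun s t c => ∀ y, ‖Φ s t y - y - P s t y‖ ≤ c)
    (fun s t c c' hc h y => (h y).trans hc) ?_ ?_ ?_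
  · intro s hs t ht hs0 hst htT hh y
    refine (this s hs t ht hs0 hst htT hh y).trans ?_
    have hH0 : 0 ≤ (t - s) ^ α := Real.rpow_nonneg (by linarith) _
    have hH1 : (t - s) ^ α ≤ 1 := Real.rpow_le_one (by linarith) (by linarith) hα0.le
    have a1 := le_rpow_sq hα' (by linarith : 0 ≤ t - s) (by linarith)
    have a2 : ((t - s) ^ α) ^ 3 ≤ ((t - s) ^ α) ^ 2 :=
      pow_le_pow_of_le_one hH0 hH1 (by norm_num)
    rw [add_mul]
    gcongr
  · intro s hs hs0 hsT y
    rw [hΦ.refl s hs, hP.zero (by linarith) hs0 hsT]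
    simp
  · intro s hs t ht hs0 hst htT hh hcons y
    rw [hΦ.step s hs t ht hst hcons]
    have : y + P s t y + (t - s) • b y - y - P s t y = (t - s) • b y := by abel
    rw [this, norm_smul, Real.norm_of_nonneg (by linarith), mul_comm]
    exact mul_le_mul_of_nonneg_right (hP.drift y) (by linarith)
  · intro s hs u hu t ht hs0 hsu hut htT hh c c' hc hc' hcH q q' y
    set z := Φ s u y with hz
    set r := z - y - P s u y with hr
    have hzr : z = y + P s u y + r := by rw [hr]; abel
    -- Four contributions: the error made after u, the error r made before u, the effect of r on
    -- P_{u,t}, and the defect of the almost flow.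
    have e : Φ s t y - y - P s t y = (Φ u t z - z - P u t z) + r
        + (P u t (y + P s u y + r) - P u t (y + P s u y))
        + (P s u y + P u t (y + P s u y) - P s t y) := by
      rw [hΦ.comp s hs u hu t ht hsu hut y, ← hz, ← hzr, hr]; abel
    have hrc : ‖r‖ ≤ c := q y
    have hmono : (t - u) ^ α ≤ (t - s) ^ α :=
      Real.rpow_le_rpow (by linarith) (by linarith) hα0.le
    have hH0 : 0 ≤ (t - s) ^ α := Real.rpow_nonneg (by linarith) _
    have l1 : ‖P u t (y + P s u y + r) - P u t (y + P s u y)‖ ≤ K * (t - s) ^ α * c := by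
      refine (hP.lip u t (by linarith) hut htT (by linarith) _ _).trans ?_
      rw [add_sub_cancel_left]
      gcongr
    have l2 := hP.defect s u t hs0 hsu hut htT (by linarith) y
    rw [e]
    refine (norm_add₄_le.trans (add_le_add (add_le_add (add_le_add (q' z) hrc) l1) l2)).trans ?_
    have : 0 ≤ K * (t - s) ^ α * c' := by positivity
    linarith

theorem IsAlmostFlow.euler_displacement (hP : IsAlmostFlow α T K P b) (hα : 0 < α) {L h₀ : ℝ}
    (h1 : h₀ ≤ 1) (hL : 0 ≤ L) {Φ : ℝ → ℝ → E → E} {s t : ℝ} (hs : 0 ≤ s) (hst : s ≤ t)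
    (htT : t ≤ T) (hh : t - s ≤ h₀) {y : E}
    (h : ‖Φ s t y - y - P s t y‖ ≤ L * ((t - s) ^ α) ^ 2) :
    ‖Φ s t y - y‖ ≤ (K + L) * (t - s) ^ α := by
  have e : Φ s t y - y = P s t y + (Φ s t y - y - P s t y) := by abel
  rw [e, add_mul]
  refine norm_add_le_of_le (hP.bound s t hs hst htT (by linarith) y) (h.trans ?_)
  have hH0 : 0 ≤ (t - s) ^ α := Real.rpow_nonneg (by linarith) _
  have hH1 : (t - s) ^ α ≤ 1 := Real.rpow_le_one (by linarith) (by linarith) hα.le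
  gcongr
  nlinarith

/-- An Euler flow is close to the one-step map. -/
theorem IsAlmostFlow.euler_sub_step (hP : IsAlmostFlow α T K P b) (hα : 1 / 3 < α)
    (hα' : α ≤ 1 / 2) :
    ∃ h₀ : ℝ, 0 < h₀ ∧ h₀ ≤ 1 ∧ ∃ L : ℝ, 0 ≤ L ∧ ∀ (S : Finset ℝ) (Φ : ℝ → ℝ → E → E),
      IsEulerFlow (fun s t y => y + P s t y + (t - s) • b y) S Φ →
      ∀ s ∈ S, ∀ t ∈ S, 0 ≤ s → s ≤ t → t ≤ T → t - s ≤ h₀ → ∀ y,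
        ‖Φ s t y - (y + P s t y + (t - s) • b y)‖ ≤ L * ((t - s) ^ α) ^ 3 := by
  have hK := hP.nonneg
  have hα0 : 0 < α := by linarith
  obtain ⟨h₂, h20, h21, L, hL, hbd⟩ := hP.euler_bound hα hα'
  -- Now the comparison map contains the drift, so a single step has no error and K₀ = 0. The defect
  -- of the drift is of size h · h^α, which is at most h^{3α} because α ≤ 1/2.
  obtain ⟨h₀, h0, h1, B, hB, key⟩ := davie_sewing hα hα' (K := K * (K + L) + K * L + K)
    (K₀ := 0) (by positivity) le_rfl
  refine ⟨min h₂ h₀, by positivity, (min_le_left _ _).trans h21, B, hB, fun S Φ hΦ => ?_⟩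
  have := key (min h₂ h₀) (min_le_right _ _) S 0 T
    (fun s t c => ∀ y, ‖Φ s t y - (y + P s t y + (t - s) • b y)‖ ≤ c)
    (fun s t c c' hc h y => (h y).trans hc) ?_ ?_ ?_
  · intro s hs t ht hs0 hst htT hh y
    simpa using this s hs t ht hs0 hst htT hh y
  · intro s hs hs0 hsT y
    rw [hΦ.refl s hs, hP.zero (by linarith) hs0 hsT]
    simp
  · intro s hs t ht hs0 hst htT hh hcons y
    rw [hΦ.step s hs t ht hst hcons]
    simp
  · intro s hs u hu t ht hs0 hsu hut htT hh c c' hc hc' hcH q q' y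
    have hh2 : t - s ≤ h₂ := hh.trans (min_le_left _ _)
    set z := Φ s u y with hz
    set r := z - y - P s u y with hr
    have hzr : z = y + P s u y + r := by rw [hr]; abel
    have e : Φ s t y - (y + P s t y + (t - s) • b y) = (Φ u t z - (z + P u t z + (t - u) • b z))
        + (z - (y + P s u y + (u - s) • b y)) + (t - u) • (b z - b y)
        + (P u t (y + P s u y + r) - P u t (y + P s u y))
        + (P s u y + P u t (y + P s u y) - P s t y) := by
      rw [hΦ.comp s hs u hu t ht hsu hut y, ← hz, ← hzr, smul_sub,
        show t - s = (t - u) + (u - s) by ring, add_smul]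
      abel
    set H := (t - s) ^ α with hH
    have hH0 : 0 ≤ H := Real.rpow_nonneg (by linarith) _
    have hmu : (u - s) ^ α ≤ H := Real.rpow_le_rpow (by linarith) (by linarith) hα0.le
    have hmt : (t - u) ^ α ≤ H := Real.rpow_le_rpow (by linarith) (by linarith) hα0.le
    have hu0 : 0 ≤ (u - s) ^ α := Real.rpow_nonneg (by linarith) _
    have hr0 := hbd S Φ hΦ s hs u hu hs0 hsu (by linarith) (by linarith) y
    have hrL : ‖r‖ ≤ L * H ^ 2 := by
      refine hr0.trans ?_
      gcongr
    have hzy : ‖z - y‖ ≤ (K + L) * H := by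
      refine (hP.euler_displacement hα0 h21 hL hs0 hsu (by linarith) (by linarith) hr0).trans ?_
      gcongr
    have l0 : ‖(t - u) • (b z - b y)‖ ≤ K * (K + L) * H ^ 3 := by
      rw [norm_smul, Real.norm_of_nonneg (by linarith)]
      calc (t - u) * ‖b z - b y‖ ≤ (t - s) * (K * ((K + L) * H)) := by
            gcongr
            · linarith
            · exact (hP.drift_lip z y).trans (by gcongr)
        _ = K * (K + L) * ((t - s) * H) := by ring
        _ ≤ _ := by
            gcongr
            exact mul_rpow_le_cube hα' (by linarith) (by linarith)
    have l1 : ‖P u t (y + P s u y + r) - P u t (y + P s u y)‖ ≤ K * L * H ^ 3 := by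
      refine (hP.lip u t (by linarith) hut htT (by linarith) _ _).trans ?_
      rw [add_sub_cancel_left]
      calc K * (t - u) ^ α * ‖r‖ ≤ K * H * (L * H ^ 2) := by gcongr
        _ = _ := by ring
    have l2 := hP.defect s u t hs0 hsu hut htT (by linarith) y
    rw [e]
    refine (norm_add_le_of_le (norm_add_le_of_le (norm_add_le_of_le
      (norm_add_le_of_le (q' z) (q y)) l0) l1) l2).trans ?_
    have : 0 ≤ (K * (K + L) + K * L + K) * H * (c + c') := by positivity
    rw [← hH]
    linarith

/-- The remainder of an Euler flow is Lipschitz with a small constant. -/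
theorem IsAlmostFlow.euler_lipschitz (hP : IsAlmostFlow α T K P b) (hα : 1 / 3 < α)
    (hα' : α ≤ 1 / 2) :
    ∃ h₀ : ℝ, 0 < h₀ ∧ h₀ ≤ 1 ∧ ∃ L : ℝ, 0 ≤ L ∧ ∀ (S : Finset ℝ) (Φ : ℝ → ℝ → E → E),
      IsEulerFlow (fun s t y => y + P s t y + (t - s) • b y) S Φ →
      ∀ s ∈ S, ∀ t ∈ S, 0 ≤ s → s ≤ t → t ≤ T → t - s ≤ h₀ → ∀ y y',
        ‖Φ s t y - Φ s t y'‖ ≤ L * ‖y - y'‖ := by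
  have hK := hP.nonneg
  have hα0 : 0 < α := by linarith
  obtain ⟨h₂, h20, h21, L, hL, hbd⟩ := hP.euler_bound hα hα'
  obtain ⟨h₀, h0, h1, B, hB, key⟩ := davie_sewing hα hα' (K := K * L * (2 + K) + K + 1)
    (K₀ := K) (by positivity) hK
  refine ⟨min h₂ h₀, by positivity, (min_le_left _ _).trans h21, 1 + K + (K + B), by positivity,
    fun S Φ hΦ => ?_⟩
  -- What is sewn is the Lipschitz constant of the remainder Φ - id - P, since that of Φ itself is
  -- not small.
  have := key (min h₂ h₀) (min_le_right _ _) S 0 T (fun s t c => ∀ y y',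
    ‖Φ s t y - y - P s t y - (Φ s t y' - y' - P s t y')‖ ≤ c * ‖y - y'‖)
    (fun s t c c' hc h y y' => (h y y').trans (by gcongr)) ?_ ?_ ?_
  · intro s hs t ht hs0 hst htT hh y y'
    have hh1 : t - s ≤ 1 := hh.trans ((min_le_left _ _).trans h21)
    have hH0 : 0 ≤ (t - s) ^ α := Real.rpow_nonneg (by linarith) _
    have hH1 : (t - s) ^ α ≤ 1 := Real.rpow_le_one (by linarith) hh1 hα0.le
    have e : Φ s t y - Φ s t y' = (y - y') + (P s t y - P s t y')
        + (Φ s t y - y - P s t y - (Φ s t y' - y' - P s t y')) := by abel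
    rw [e]
    refine (norm_add₃_le.trans (add_le_add (add_le_add le_rfl
      (hP.lip s t hs0 hst htT hh1 y y')) (this s hs t ht hs0 hst htT hh y y'))).trans ?_
    have a1 : K * (t - s) ^ α * ‖y - y'‖ ≤ K * 1 * ‖y - y'‖ := by gcongr
    have a2 : (K * (t - s) + B * ((t - s) ^ α) ^ 3) * ‖y - y'‖ ≤ (K * 1 + B * 1) * ‖y - y'‖ := by
      have : ((t - s) ^ α) ^ 3 ≤ 1 := pow_le_one₀ hH0 hH1
      gcongr
    linarith
  · intro s hs hs0 hsT y y'
    rw [hΦ.refl s hs, hΦ.refl s hs, hP.zero (by linarith) hs0 hsT, hP.zero (by linarith) hs0 hsT]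
    simp
  · intro s hs t ht hs0 hst htT hh hcons y y'
    rw [hΦ.step s hs t ht hst hcons, hΦ.step s hs t ht hst hcons]
    have : y + P s t y + (t - s) • b y - y - P s t y
        - (y' + P s t y' + (t - s) • b y' - y' - P s t y') = (t - s) • (b y - b y') := by
      rw [smul_sub]; abel
    rw [this, norm_smul, Real.norm_of_nonneg (by linarith), mul_comm K, mul_assoc]
    exact mul_le_mul_of_nonneg_left (hP.drift_lip y y') (by linarith)
  · intro s hs u hu t ht hs0 hsu hut htT hh c c' hc hc' hcH q q' y y'
    have hh2 : t - s ≤ h₂ := hh.trans (min_le_left _ _)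
    set z := Φ s u y with hz
    set r := z - y - P s u y with hr
    have hzr : z = y + P s u y + r := by rw [hr]; abel
    set z' := Φ s u y' with hz'
    set r' := z' - y' - P s u y' with hr'
    have hzr' : z' = y' + P s u y' + r' := by rw [hr']; abel
    have e : Φ s t y - y - P s t y - (Φ s t y' - y' - P s t y')
        = (Φ u t z - z - P u t z - (Φ u t z' - z' - P u t z')) + (r - r')
        + (P u t (y + P s u y + r) - P u t (y + P s u y)
            - (P u t (y' + P s u y' + r') - P u t (y' + P s u y')))
        + (P s u y + P u t (y + P s u y) - P s t y
            - (P s u y' + P u t (y' + P s u y') - P s t y')) := by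
      rw [hΦ.comp s hs u hu t ht hsu hut y, ← hz, ← hzr, hr,
        hΦ.comp s hs u hu t ht hsu hut y', ← hz', ← hzr', hr']
      abel
    set H := (t - s) ^ α with hH
    have hH0 : 0 ≤ H := Real.rpow_nonneg (by linarith) _
    have hH1 : H ≤ 1 := Real.rpow_le_one (by linarith) (by linarith) hα0.le
    have hmu : (u - s) ^ α ≤ H := Real.rpow_le_rpow (by linarith) (by linarith) hα0.le
    have hmt : (t - u) ^ α ≤ H := Real.rpow_le_rpow (by linarith) (by linarith) hα0.le
    have hu0 : 0 ≤ (u - s) ^ α := Real.rpow_nonneg (by linarith) _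
    have ht0 : 0 ≤ (t - u) ^ α := Real.rpow_nonneg (by linarith) _
    set D := ‖y - y'‖ with hD
    have hD0 : 0 ≤ D := norm_nonneg _
    have hrL : ‖r‖ ≤ L * H ^ 2 := by
      refine (hbd S Φ hΦ s hs u hu hs0 hsu (by linarith) (by linarith) y).trans ?_
      gcongr
    have hrr : ‖r - r'‖ ≤ c * D := q y y'
    have hpp : ‖P s u y - P s u y'‖ ≤ K * H * D := by
      refine (hP.lip s u hs0 hsu (by linarith) (by linarith) y y').trans ?_
      gcongr
    have hyy : ‖y + P s u y - (y' + P s u y')‖ ≤ (1 + K * H) * D := by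
      rw [add_sub_add_comm]
      exact (norm_add_le_of_le le_rfl hpp).trans (by rw [← hD]; linarith)
    have hzz : ‖z - z'‖ ≤ (1 + K * H + c) * D := by
      rw [hzr, hzr', add_sub_add_comm]
      exact (norm_add_le_of_le hyy hrr).trans (by linarith)
    have l0 : ‖Φ u t z - z - P u t z - (Φ u t z' - z' - P u t z')‖
        ≤ c' * ((1 + K * H + c) * D) := (q' z z').trans (by gcongr)
    have l1 : ‖P u t (y + P s u y + r) - P u t (y + P s u y)
            - (P u t (y' + P s u y' + r') - P u t (y' + P s u y'))‖
        ≤ K * H * (c * D + L * H ^ 2 * ((1 + K * H) * D + c * D)) := by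
      refine (hP.four u t (by linarith) hut htT (by linarith) _ _ _ _).trans ?_
      gcongr
    have l2 := hP.defect_lip s u t hs0 hsu hut htT (by linarith) y y'
    rw [e]
    refine (norm_add_le_of_le (norm_add_le_of_le (norm_add_le_of_le l0 hrr) l1) l2).trans ?_
    rw [← hH, ← hD]
    -- Composing remainders produces the product c c' of their Lipschitz constants. The condition c
    -- ≤ H in `davie_sewing` serves to make it linear.
    have b1 : c' * ((1 + K * H + c) * D) ≤ c' * ((1 + K * H + H) * D) := by gcongr
    have b2 : K * H * (c * D + L * H ^ 2 * ((1 + K * H) * D + c * D))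
        ≤ K * H * (c * D + L * H ^ 2 * ((1 + K * 1) * D + 1 * D)) := by
      gcongr
      exact hcH.trans hH1
    have b3 : 0 ≤ K * L * (2 + K) * H * (c + c') * D := by positivity
    have b4 : 0 ≤ H * c * D := by positivity
    have b5 : 0 ≤ H ^ 3 * D := by positivity
    linarith

end AlmostFlow

/-! ### Rough increments -/

section Contract

variable {m : ℕ} {U V : Type} [NormedAddCommGroup U] [NormedSpace ℝ U] [NormedAddCommGroup V]
  [NormedSpace ℝ V]

/-- `contract` as a continuous linear map of the bilinear form. -/
noncomputable def contractL (U : Type) [NormedAddCommGroup U] [NormedSpace ℝ U]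
    (M : Matrix (Fin m) (Fin m) ℝ) :
    (EuclideanSpace ℝ (Fin m) →L[ℝ] EuclideanSpace ℝ (Fin m) →L[ℝ] U) →L[ℝ] U :=
  ∑ i, ∑ j, M i j • (ContinuousLinearMap.apply ℝ U (EuclideanSpace.single j (1 : ℝ))).comp
    (ContinuousLinearMap.apply ℝ (EuclideanSpace ℝ (Fin m) →L[ℝ] U)
      (EuclideanSpace.single i (1 : ℝ)))

theorem contractL_apply (M : Matrix (Fin m) (Fin m) ℝ)
    (B : EuclideanSpace ℝ (Fin m) →L[ℝ] EuclideanSpace ℝ (Fin m) →L[ℝ] U) :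
    contractL U M B = contract B M := by
  simp [contractL, contract]

theorem contract_sub (M : Matrix (Fin m) (Fin m) ℝ)
    (B B' : EuclideanSpace ℝ (Fin m) →L[ℝ] EuclideanSpace ℝ (Fin m) →L[ℝ] U) :
    contract (B - B') M = contract B M - contract B' M := by
  simp only [← contractL_apply, map_sub]

theorem contract_add (M : Matrix (Fin m) (Fin m) ℝ)
    (B B' : EuclideanSpace ℝ (Fin m) →L[ℝ] EuclideanSpace ℝ (Fin m) →L[ℝ] U) :
    contract (B + B') M = contract B M + contract B' M := by
  simp only [← contractL_apply, map_add]

theorem map_contract (L : U →L[ℝ] V) (M : Matrix (Fin m) (Fin m) ℝ)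
    (B : EuclideanSpace ℝ (Fin m) →L[ℝ] EuclideanSpace ℝ (Fin m) →L[ℝ] U) :
    L (contract B M) = contract ((ContinuousLinearMap.compL ℝ _ U V L).comp B) M := by
  simp [contract]

theorem apply_apply_eq_sum (B : EuclideanSpace ℝ (Fin m) →L[ℝ] EuclideanSpace ℝ (Fin m) →L[ℝ] U)
    (a b : EuclideanSpace ℝ (Fin m)) : B a b = ∑ i, ∑ j, (a i * b j) •
      B (EuclideanSpace.single i 1) (EuclideanSpace.single j 1) := by
  have h : ∀ a : EuclideanSpace ℝ (Fin m), a = ∑ i, a i • EuclideanSpace.single i (1 : ℝ) := by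
    intro a
    ext j
    simp [Pi.single_apply]
  conv_lhs => rw [h a, h b]
  simp only [map_sum, map_smul, sum_apply, smul_apply, Finset.smul_sum, smul_smul]
  rw [Finset.sum_comm]
  simp only [mul_comm]

theorem norm_contract_le {M : Matrix (Fin m) (Fin m) ℝ} {c : ℝ} (hM : ∀ i j, |M i j| ≤ c)
    (B : EuclideanSpace ℝ (Fin m) →L[ℝ] EuclideanSpace ℝ (Fin m) →L[ℝ] U) :
    ‖contract B M‖ ≤ (m : ℝ) ^ 2 * c * ‖B‖ := by
  have h1 : ∀ i j, ‖M i j • B (EuclideanSpace.single i 1) (EuclideanSpace.single j 1)‖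
      ≤ c * ‖B‖ := by
    intro i j
    rw [norm_smul]
    have h2 := B.le_opNorm₂ (EuclideanSpace.single i (1 : ℝ)) (EuclideanSpace.single j (1 : ℝ))
    simp only [PiLp.norm_single, norm_one, mul_one] at h2
    exact mul_le_mul (hM i j) h2 (norm_nonneg _) ((abs_nonneg _).trans (hM i j))
  calc ‖contract B M‖ ≤ ∑ _i : Fin m, ∑ _j : Fin m, c * ‖B‖ :=
        norm_sum_le_of_le _ fun i _ => norm_sum_le_of_le _ fun j _ => h1 i j
    _ = _ := by simp; ring

end Contract

namespace IsRoughPath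

variable {m : ℕ} {α T : ℝ} {Z : ℝ → EuclideanSpace ℝ (Fin m)}
  {ZZ : ℝ → ℝ → Matrix (Fin m) (Fin m) ℝ}

theorem bounds (hZ : IsRoughPath α T Z ZZ) : ∃ C : ℝ, 0 ≤ C ∧ ∀ s t, 0 ≤ s → s ≤ t → t ≤ T →
    ‖Z t - Z s‖ ≤ C * (t - s) ^ α ∧ ∀ (U : Type) [NormedAddCommGroup U] [NormedSpace ℝ U]
      (B : EuclideanSpace ℝ (Fin m) →L[ℝ] EuclideanSpace ℝ (Fin m) →L[ℝ] U),
      ‖contract B (ZZ s t)‖ ≤ C * ((t - s) ^ α) ^ 2 * ‖B‖ := by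
  obtain ⟨C₁, h1⟩ := hZ.holder_fst
  obtain ⟨C₂, h2⟩ := hZ.holder_snd
  refine ⟨max |C₁| ((m : ℝ) ^ 2 * |C₂|), le_max_of_le_left (abs_nonneg _),
    fun s t hs hst htT => ⟨?_, ?_⟩⟩
  · have : 0 ≤ (t - s) ^ α := Real.rpow_nonneg (by linarith) _
    exact (h1 s t hs hst htT).trans (by
      gcongr; exact (le_abs_self _).trans (le_max_left _ _))
  · intro U _ _ B
    have : (t - s) ^ (2 * α) = ((t - s) ^ α) ^ 2 := by
      rw [← Real.rpow_mul_natCast (by linarith), mul_comm]; norm_num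
    have h3 := norm_contract_le (h2 s t hs hst htT) B
    rw [this] at h3
    refine h3.trans ?_
    have h4 : (m : ℝ) ^ 2 * C₂ ≤ max |C₁| ((m : ℝ) ^ 2 * |C₂|) :=
      (mul_le_mul_of_nonneg_left (le_abs_self _) (by positivity)).trans (le_max_right _ _)
    rw [← mul_assoc]
    gcongr

theorem contract_chen (hZ : IsRoughPath α T Z ZZ) {s u t : ℝ} (hs : 0 ≤ s) (hsu : s ≤ u)
    (hut : u ≤ t) (htT : t ≤ T) {U : Type} [NormedAddCommGroup U] [NormedSpace ℝ U]
    (B : EuclideanSpace ℝ (Fin m) →L[ℝ] EuclideanSpace ℝ (Fin m) →L[ℝ] U) :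
    contract B (ZZ s t)
      = contract B (ZZ s u) + contract B (ZZ u t) + B (Z u - Z s) (Z t - Z u) := by
  rw [apply_apply_eq_sum]
  simp only [contract, ← Finset.sum_add_distrib, ← add_smul]
  refine Finset.sum_congr rfl fun i _ => Finset.sum_congr rfl fun j _ => ?_
  rw [← hZ.chen s u t hs hsu hut htT i j]
  congr 1
  ring

end IsRoughPath

theorem CB.gam {ι W U : Type} [NormedAddCommGroup W] [NormedSpace ℝ W] [NormedAddCommGroup U]
    [NormedSpace ℝ U] {m k : ℕ} {V : W → EuclideanSpace ℝ (Fin m) →L[ℝ] W}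
    (hV : CB k (fun _ : ι => V)) {f : ι → W → U} (hf : CB (k + 1) f) :
    CB k (fun i x => Gam V (f i) x) :=
  bilin (ContinuousLinearMap.compL ℝ (EuclideanSpace ℝ (Fin m)) W U) hf.fderiv hV

/-- The rough increment `V(y) δZ + (Γ V)(y) ℤ` of the differential equation `dY = V(Y) d𝐙`. -/
noncomputable def roughInc {m : ℕ} {E : Type} [NormedAddCommGroup E] [NormedSpace ℝ E]
    (Z : ℝ → EuclideanSpace ℝ (Fin m)) (ZZ : ℝ → ℝ → Matrix (Fin m) (Fin m) ℝ)
    (V : E → EuclideanSpace ℝ (Fin m) →L[ℝ] E) (s t : ℝ) (y : E) : E :=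
  V y (Z t - Z s) + contract (Gam V V y) (ZZ s t)

/-! ### The Davie step is an almost flow -/

section AlmostFlow

variable {m : ℕ} {α T : ℝ} {Z : ℝ → EuclideanSpace ℝ (Fin m)}
  {ZZ : ℝ → ℝ → Matrix (Fin m) (Fin m) ℝ} {E : Type} [NormedAddCommGroup E] [NormedSpace ℝ E]
  {V : E → EuclideanSpace ℝ (Fin m) →L[ℝ] E} {b : E → E}

/-- Chen's relation cancels the terms of orders one and two: DV(y)V(y)δZ_{s,u} applied to δZ_{u,t}
is the action of (ΓV)(y) on δZ_{s,u} ⊗ δZ_{u,t}. Each surviving term has order three: a quadratic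
remainder times δZ, ℤ times δZ, and an increment of ΓV times ℤ. -/
theorem roughInc_defect (hZ : IsRoughPath α T Z ZZ) {s u t : ℝ} (hs : 0 ≤ s) (hsu : s ≤ u)
    (hut : u ≤ t) (htT : t ≤ T) (y p : E) (hp : p = roughInc Z ZZ V s u y) :
    roughInc Z ZZ V s u y + roughInc Z ZZ V u t (y + p) - roughInc Z ZZ V s t y
      = (V (y + p) - V y - fderiv ℝ V y p) (Z t - Z u)
        + fderiv ℝ V y (contract (Gam V V y) (ZZ s u)) (Z t - Z u)
        + contract (Gam V V (y + p) - Gam V V y) (ZZ u t) := by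
  have e1 : Z t - Z s = (Z u - Z s) + (Z t - Z u) := by abel
  have e2 : fderiv ℝ V y p = fderiv ℝ V y (V y (Z u - Z s))
      + fderiv ℝ V y (contract (Gam V V y) (ZZ s u)) := by
    rw [hp, roughInc, map_add]
  have e3 : Gam V V y (Z u - Z s) = fderiv ℝ V y (V y (Z u - Z s)) := rfl
  rw [e2, contract_sub]
  simp only [roughInc]
  rw [hZ.contract_chen hs hsu hut htT, e1, map_add, e3]
  simp only [sub_apply, add_apply]
  abel

-- C^{2,1} regularity of V is what a Lipschitz bound on the defect uses: the Taylor remainder of V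
-- must itself be Lipschitz, and ΓV must satisfy a four point estimate.
set_option maxHeartbeats 1000000 in
theorem exists_isAlmostFlow (hα : 0 < α) (hZ : IsRoughPath α T Z ZZ)
    (hV : CB 2 (fun _ : Unit => V)) (hb : CB 0 (fun _ : Unit => b)) :
    ∃ K, IsAlmostFlow α T K (roughInc Z ZZ V) b := by
  have hG : CB 1 (fun _ : Unit => Gam V V) := CB.gam hV.of_succ hV
  obtain ⟨A₀, hA₀, hz⟩ := hZ.bounds
  obtain ⟨A₁, hA₁, v0⟩ := hV.bounded
  obtain ⟨A₂, hA₂, v1⟩ := hV.lipschitz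
  obtain ⟨A₃, hA₃, v2⟩ := hV.of_succ.four_point
  obtain ⟨A₄, hA₄, v3⟩ := hV.of_succ.taylor_one
  obtain ⟨A₅, hA₅, v4⟩ := hV.taylor_one_lipschitz
  obtain ⟨A₆, hA₆, v5⟩ := hV.fderiv.bounded
  obtain ⟨A₇, hA₇, v6⟩ := hV.fderiv.lipschitz
  obtain ⟨A₈, hA₈, g0⟩ := hG.bounded
  obtain ⟨A₉, hA₉, g1⟩ := hG.lipschitz
  obtain ⟨A₁₀, hA₁₀, g2⟩ := hG.four_point
  obtain ⟨B₀, hB₀, b0⟩ := hb.bounded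
  obtain ⟨B₁, hB₁, b1⟩ := hb.lipschitz
  obtain ⟨A, hA, hA0, hA1, hA2, hA3, hA4, hA5, hA6, hA7, hA8, hA9, hA10, hB0, hB1⟩ :
      ∃ A : ℝ, 0 ≤ A ∧ A₀ ≤ A ∧ A₁ ≤ A ∧ A₂ ≤ A ∧ A₃ ≤ A ∧ A₄ ≤ A ∧ A₅ ≤ A ∧ A₆ ≤ A ∧ A₇ ≤ A
        ∧ A₈ ≤ A ∧ A₉ ≤ A ∧ A₁₀ ≤ A ∧ B₀ ≤ A ∧ B₁ ≤ A := by
    refine ⟨A₀ + A₁ + A₂ + A₃ + A₄ + A₅ + A₆ + A₇ + A₈ + A₉ + A₁₀ + B₀ + B₁, by positivity, ?_⟩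
    refine ⟨?_, ?_, ?_, ?_, ?_, ?_, ?_, ?_, ?_, ?_, ?_, ?_, ?_⟩ <;> linarith
  have Z0 : ∀ s t, 0 ≤ s → s ≤ t → t ≤ T → ∀ {H : ℝ}, (t - s) ^ α ≤ H → 0 ≤ H →
      ‖Z t - Z s‖ ≤ A * H := fun s t hs hst htT H hH h0 =>
    (hz s t hs hst htT).1.trans (mul_le_mul hA0 hH (Real.rpow_nonneg (by linarith) _) hA)
  have Z1 : ∀ s t, 0 ≤ s → s ≤ t → t ≤ T → ∀ {H : ℝ}, (t - s) ^ α ≤ H → 0 ≤ H →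
      ∀ (U : Type) [NormedAddCommGroup U] [NormedSpace ℝ U]
      (B : EuclideanSpace ℝ (Fin m) →L[ℝ] EuclideanSpace ℝ (Fin m) →L[ℝ] U) {c : ℝ}, ‖B‖ ≤ c →
      ‖contract B (ZZ s t)‖ ≤ A * H ^ 2 * c := by
    intro s t hs hst htT H hH h0 U _ _ B c hc
    have := Real.rpow_nonneg (by linarith : 0 ≤ t - s) α
    exact ((hz s t hs hst htT).2 U B).trans (by gcongr)
  have app : ∀ {U : Type} [NormedAddCommGroup U] [NormedSpace ℝ U]
      (L : EuclideanSpace ℝ (Fin m) →L[ℝ] U) {z : EuclideanSpace ℝ (Fin m)} {c c' : ℝ},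
      ‖L‖ ≤ c → ‖z‖ ≤ c' → ‖L z‖ ≤ c * c' := fun L z c c' h h' => L.le_of_opNorm_le_of_le h h'
  have P0 : ∀ s t, 0 ≤ s → s ≤ t → t ≤ T → ∀ {H : ℝ}, (t - s) ^ α ≤ H → 0 ≤ H → H ≤ 1 → ∀ y,
      ‖roughInc Z ZZ V s t y‖ ≤ 2 * A ^ 2 * H := by
    intro s t hs hst htT H hH h0 h1 y
    refine (norm_add_le_of_le (app _ ((v0 () y).trans hA1) (Z0 s t hs hst htT hH h0))
      (Z1 s t hs hst htT hH h0 _ _ ((g0 () y).trans hA8))).trans ?_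
    have : H ^ 2 ≤ H := by nlinarith
    nlinarith [mul_le_mul_of_nonneg_left this (sq_nonneg A)]
  have P1 : ∀ s t, 0 ≤ s → s ≤ t → t ≤ T → ∀ {H : ℝ}, (t - s) ^ α ≤ H → 0 ≤ H → H ≤ 1 → ∀ y y',
      ‖roughInc Z ZZ V s t y - roughInc Z ZZ V s t y'‖ ≤ 2 * A ^ 2 * H * ‖y - y'‖ := by
    intro s t hs hst htT H hH h0 h1 y y'
    have e : roughInc Z ZZ V s t y - roughInc Z ZZ V s t y' = (V y - V y') (Z t - Z s)
        + contract (Gam V V y - Gam V V y') (ZZ s t) := by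
      rw [contract_sub, sub_apply]; simp only [roughInc]; abel
    rw [e]
    have a1 : ‖V y - V y'‖ ≤ A * ‖y - y'‖ := (v1 () y y').trans (by gcongr)
    have a2 : ‖Gam V V y - Gam V V y'‖ ≤ A * ‖y - y'‖ := (g1 () y y').trans (by gcongr)
    refine (norm_add_le_of_le (app _ a1 (Z0 s t hs hst htT hH h0))
      (Z1 s t hs hst htT hH h0 _ _ a2)).trans ?_
    have h3 : H ^ 2 ≤ H := by nlinarith
    have h4 : 0 ≤ A ^ 2 * ‖y - y'‖ := by positivity
    nlinarith [mul_le_mul_of_nonneg_left h3 h4]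
  have hKm : ∀ {x : ℝ} {c : ℝ}, 0 ≤ c → x ≤ 2 * A ^ 2 * c →
      x ≤ (16 * A ^ 6 + 6 * A ^ 4 + 2 * A ^ 2 + A) * c := by
    intro x c hc hx
    have : 0 ≤ (16 * A ^ 6 + 6 * A ^ 4 + A) * c := by positivity
    linarith
  have hH : ∀ {s t : ℝ}, s ≤ t → t - s ≤ 1 → 0 ≤ (t - s) ^ α ∧ (t - s) ^ α ≤ 1 := by
    intro s t hst h
    exact ⟨Real.rpow_nonneg (by linarith) _, Real.rpow_le_one (by linarith) h hα.le⟩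
  -- The coefficients 16A⁶ + 6A⁴ are those of the Lipschitz bound on the defect; 2A² serves the
  -- bounds on P, and A those on the drift.
  refine ⟨16 * A ^ 6 + 6 * A ^ 4 + 2 * A ^ 2 + A, ⟨by positivity, ?_, ?_, ?_, ?_, ?_, ?_, ?_⟩⟩
  · intro s t hs hst htT h y
    obtain ⟨h0, h1⟩ := hH hst h
    exact hKm h0 (P0 s t hs hst htT le_rfl h0 h1 y)
  · intro s t hs hst htT h y y'
    obtain ⟨h0, h1⟩ := hH hst h
    rw [mul_assoc]
    exact hKm (by positivity) ((P1 s t hs hst htT le_rfl h0 h1 y y').trans (by linarith))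
  · intro s t hs hst htT h y r y' r'
    obtain ⟨h0, h1⟩ := hH hst h
    set H := (t - s) ^ α
    set F := ‖r - r'‖ + ‖r‖ * (‖y - y'‖ + ‖r - r'‖) with hF
    have hF0 : 0 ≤ F := by positivity
    have e : roughInc Z ZZ V s t (y + r) - roughInc Z ZZ V s t y
        - (roughInc Z ZZ V s t (y' + r') - roughInc Z ZZ V s t y')
        = (V (y + r) - V y - (V (y' + r') - V y')) (Z t - Z s)
        + contract (Gam V V (y + r) - Gam V V y - (Gam V V (y' + r') - Gam V V y')) (ZZ s t) := by
      simp only [contract_sub, sub_apply, roughInc]; abel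
    rw [e, mul_assoc]
    have a1 : ‖V (y + r) - V y - (V (y' + r') - V y')‖ ≤ A * F := by
      have := v2 () (y + r) y (y' + r') y'
      simp only [add_sub_cancel_left] at this
      exact this.trans (by rw [← hF]; gcongr)
    have a2 : ‖Gam V V (y + r) - Gam V V y - (Gam V V (y' + r') - Gam V V y')‖ ≤ A * F := by
      have := g2 () (y + r) y (y' + r') y'
      simp only [add_sub_cancel_left] at this
      exact this.trans (by rw [← hF]; gcongr)
    refine hKm (by positivity) ((norm_add_le_of_le (app _ a1 (Z0 s t hs hst htT le_rfl h0))
      (Z1 s t hs hst htT le_rfl h0 _ _ a2)).trans ?_)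
    have h3 : H ^ 2 ≤ H := by nlinarith
    have h4 : 0 ≤ A ^ 2 * F := by positivity
    nlinarith [mul_le_mul_of_nonneg_left h3 h4]
  · intro s u t hs hsu hut htT h y
    obtain ⟨h0, h1⟩ := hH (hsu.trans hut) h
    set H := (t - s) ^ α
    have hm1 : (u - s) ^ α ≤ H := Real.rpow_le_rpow (by linarith) (by linarith) hα.le
    have hm2 : (t - u) ^ α ≤ H := Real.rpow_le_rpow (by linarith) (by linarith) hα.le
    rw [roughInc_defect hZ hs hsu hut htT y _ rfl]
    set p := roughInc Z ZZ V s u y with hp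
    have p0 : ‖p‖ ≤ 2 * A ^ 2 * H := P0 s u hs hsu (by linarith) hm1 h0 h1 y
    have hb := Z0 u t (by linarith) hut htT hm2 h0
    have a1 : ‖V (y + p) - V y - fderiv ℝ V y p‖ ≤ A * (2 * A ^ 2 * H) ^ 2 := by
      have := v3 () y (y + p)
      simp only [add_sub_cancel_left] at this
      exact this.trans (by gcongr)
    have a2 : ‖fderiv ℝ V y (contract (Gam V V y) (ZZ s u))‖ ≤ A * (A * H ^ 2 * A) :=
      (fderiv ℝ V y).le_of_opNorm_le_of_le ((v5 () y).trans hA6)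
        (Z1 s u hs hsu (by linarith) hm1 h0 _ _ ((g0 () y).trans hA8))
    have a3 : ‖Gam V V (y + p) - Gam V V y‖ ≤ A * (2 * A ^ 2 * H) := by
      have := g1 () (y + p) y
      simp only [add_sub_cancel_left] at this
      exact this.trans (by gcongr)
    refine (norm_add_le_of_le (norm_add_le_of_le (app _ a1 hb) (app _ a2 hb))
      (Z1 u t (by linarith) hut htT hm2 h0 _ _ a3)).trans ?_
    have h4 : 0 ≤ (12 * A ^ 6 + 3 * A ^ 4 + 2 * A ^ 2 + A) * H ^ 3 := by positivity
    linarith only [h4]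
  · intro s u t hs hsu hut htT h y y'
    obtain ⟨h0, h1⟩ := hH (hsu.trans hut) h
    set H := (t - s) ^ α
    have hm1 : (u - s) ^ α ≤ H := Real.rpow_le_rpow (by linarith) (by linarith) hα.le
    have hm2 : (t - u) ^ α ≤ H := Real.rpow_le_rpow (by linarith) (by linarith) hα.le
    rw [roughInc_defect hZ hs hsu hut htT y _ rfl, roughInc_defect hZ hs hsu hut htT y' _ rfl]
    set p := roughInc Z ZZ V s u y with hp
    set p' := roughInc Z ZZ V s u y' with hp'
    set D := ‖y - y'‖ with hD
    have hD0 : 0 ≤ D := norm_nonneg _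
    have p0 : ‖p‖ ≤ 2 * A ^ 2 * H := P0 s u hs hsu (by linarith) hm1 h0 h1 y
    have p0' : ‖p'‖ ≤ 2 * A ^ 2 * H := P0 s u hs hsu (by linarith) hm1 h0 h1 y'
    have pp : ‖p - p'‖ ≤ 2 * A ^ 2 * H * D := P1 s u hs hsu (by linarith) hm1 h0 h1 y y'
    have hb := Z0 u t (by linarith) hut htT hm2 h0
    have e : (V (y + p) - V y - fderiv ℝ V y p) (Z t - Z u)
        + fderiv ℝ V y (contract (Gam V V y) (ZZ s u)) (Z t - Z u)
        + contract (Gam V V (y + p) - Gam V V y) (ZZ u t)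
        - ((V (y' + p') - V y' - fderiv ℝ V y' p') (Z t - Z u)
        + fderiv ℝ V y' (contract (Gam V V y') (ZZ s u)) (Z t - Z u)
        + contract (Gam V V (y' + p') - Gam V V y') (ZZ u t))
        = (V (y + p) - V y - fderiv ℝ V y p - (V (y' + p') - V y' - fderiv ℝ V y' p')) (Z t - Z u)
        + ((fderiv ℝ V y - fderiv ℝ V y') (contract (Gam V V y) (ZZ s u))
          + fderiv ℝ V y' (contract (Gam V V y - Gam V V y') (ZZ s u))) (Z t - Z u)
        + contract (Gam V V (y + p) - Gam V V y - (Gam V V (y' + p') - Gam V V y')) (ZZ u t) := by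
      simp only [contract_sub, sub_apply, add_apply, map_sub]; abel
    rw [e]
    have a1 : ‖V (y + p) - V y - fderiv ℝ V y p - (V (y' + p') - V y' - fderiv ℝ V y' p')‖
        ≤ A * ((2 * A ^ 2 * H) ^ 2 * D
          + (2 * A ^ 2 * H + 2 * A ^ 2 * H) * (2 * A ^ 2 * H * D)) :=
      (v4 () y p y' p').trans (by gcongr)
    have a2 : ‖(fderiv ℝ V y - fderiv ℝ V y') (contract (Gam V V y) (ZZ s u))
          + fderiv ℝ V y' (contract (Gam V V y - Gam V V y') (ZZ s u))‖
        ≤ (A * D) * (A * H ^ 2 * A) + A * (A * H ^ 2 * (A * D)) := by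
      refine norm_add_le_of_le (ContinuousLinearMap.le_of_opNorm_le_of_le _ ?_ ?_)
        (ContinuousLinearMap.le_of_opNorm_le_of_le _ ?_ ?_)
      · exact (v6 () y y').trans (by gcongr)
      · exact Z1 s u hs hsu (by linarith) hm1 h0 _ _ ((g0 () y).trans hA8)
      · exact (v5 () y').trans hA6
      · exact Z1 s u hs hsu (by linarith) hm1 h0 _ _ ((g1 () y y').trans (by gcongr))
    have a3 : ‖Gam V V (y + p) - Gam V V y - (Gam V V (y' + p') - Gam V V y')‖
        ≤ A * (2 * A ^ 2 * H * D + 2 * A ^ 2 * H * (D + 2 * A ^ 2 * 1 * D)) := by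
      have := g2 () (y + p) y (y' + p') y'
      simp only [add_sub_cancel_left] at this
      refine this.trans ?_
      have pp1 : ‖p - p'‖ ≤ 2 * A ^ 2 * 1 * D := pp.trans (by gcongr)
      gcongr
    refine (norm_add_le_of_le (norm_add_le_of_le (app _ a1 hb) (app _ a2 hb))
      (Z1 u t (by linarith) hut htT hm2 h0 _ _ a3)).trans ?_
    have h4 : 0 ≤ (2 * A ^ 2 + A) * H ^ 3 * D := by positivity
    linarith only [h4]
  · intro y
    have : 0 ≤ 16 * A ^ 6 + 6 * A ^ 4 + 2 * A ^ 2 := by positivity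
    linarith [b0 () y]
  · intro y y'
    refine (b1 () y y').trans ?_
    have : 0 ≤ 16 * A ^ 6 + 6 * A ^ 4 + 2 * A ^ 2 := by positivity
    gcongr
    linarith

end AlmostFlow

/-! ### Tangent vector fields -/

section Tangent

variable {m : ℕ} {α T : ℝ} {Z : ℝ → EuclideanSpace ℝ (Fin m)}
  {ZZ : ℝ → ℝ → Matrix (Fin m) (Fin m) ℝ} {E : Type} [NormedAddCommGroup E] [NormedSpace ℝ E]
  {V : E → EuclideanSpace ℝ (Fin m) →L[ℝ] E} {b χ : E → E}

/-- The tangent `(x, v) ↦ (V(x), DV(x) v)` of the vector fields `V`, with `v` cut off by `χ`. -/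
noncomputable def tang (χ : E → E) (V : E → EuclideanSpace ℝ (Fin m) →L[ℝ] E) (p : E × E) :
    EuclideanSpace ℝ (Fin m) →L[ℝ] E × E :=
  (V p.1).prod (fderiv ℝ V p.1 (χ p.2))

/-- The tangent of the vector field `b`, with cut-off. -/
noncomputable def tangDrift (χ b : E → E) (p : E × E) : E × E :=
  (b p.1, fderiv ℝ b p.1 (χ p.2))

/-- One step `y + V(y) δZ + (Γ V)(y) ℤ + b(y) δt` of the Davie scheme. -/
noncomputable def rdeStep (Z : ℝ → EuclideanSpace ℝ (Fin m))
    (ZZ : ℝ → ℝ → Matrix (Fin m) (Fin m) ℝ) (V : E → EuclideanSpace ℝ (Fin m) →L[ℝ] E) (b : E → E)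
    (s t : ℝ) (y : E) : E :=
  y + roughInc Z ZZ V s t y + (t - s) • b y

theorem CB.tang {k : ℕ} (hV : CB (k + 1) (fun _ : Unit => V)) (hχ : CB k (fun _ : Unit => χ)) :
    CB k (fun _ : Unit => tang χ V) := by
  have h1 : CB k (fun (_ : Unit) (p : E × E) => V p.1) :=
    hV.of_succ.comp_clm (ContinuousLinearMap.fst ℝ E E)
  have h2 : CB k (fun (_ : Unit) (p : E × E) => _root_.fderiv ℝ V p.1 (χ p.2)) :=
    bilin (ContinuousLinearMap.id ℝ (E →L[ℝ] EuclideanSpace ℝ (Fin m) →L[ℝ] E))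
      (hV.fderiv.comp_clm (ContinuousLinearMap.fst ℝ E E))
      (hχ.comp_clm (ContinuousLinearMap.snd ℝ E E))
  have h3 := (h1.clm (ContinuousLinearMap.compL ℝ (EuclideanSpace ℝ (Fin m)) E (E × E)
    (ContinuousLinearMap.inl ℝ E E))).add
    (h2.clm (ContinuousLinearMap.compL ℝ (EuclideanSpace ℝ (Fin m)) E (E × E)
    (ContinuousLinearMap.inr ℝ E E)))
  convert h3 using 3 with _ p
  ext z <;> simp [_root_.tang]

theorem CB.tangDrift {k : ℕ} (hb : CB (k + 1) (fun _ : Unit => b))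
    (hχ : CB k (fun _ : Unit => χ)) : CB k (fun _ : Unit => tangDrift χ b) :=
  prodMk (hb.of_succ.comp_clm (ContinuousLinearMap.fst ℝ E E))
    (bilin (ContinuousLinearMap.id ℝ (E →L[ℝ] E))
      (hb.fderiv.comp_clm (ContinuousLinearMap.fst ℝ E E))
      (hχ.comp_clm (ContinuousLinearMap.snd ℝ E E)))

theorem hasFDerivAt_tangent_pair {F : Type} [NormedAddCommGroup F] [NormedSpace ℝ F] {f : E → F}
    (hf : Differentiable ℝ f) (hf' : Differentiable ℝ (fderiv ℝ f)) (p : E × E) :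
    HasFDerivAt (fun p : E × E => (f p.1, fderiv ℝ f p.1 p.2))
      (((fderiv ℝ f p.1).comp (ContinuousLinearMap.fst ℝ E E)).prod
        ((fderiv ℝ f p.1).comp (ContinuousLinearMap.snd ℝ E E)
          + ((fderiv ℝ (fderiv ℝ f) p.1).comp (ContinuousLinearMap.fst ℝ E E)).flip p.2)) p := by
  have h1 : HasFDerivAt (fun p : E × E => f p.1)
      ((fderiv ℝ f p.1).comp (ContinuousLinearMap.fst ℝ E E)) p :=
    (hf p.1).hasFDerivAt.comp p hasFDerivAt_fst
  have h2 : HasFDerivAt (fun p : E × E => fderiv ℝ f p.1)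
      ((fderiv ℝ (fderiv ℝ f) p.1).comp (ContinuousLinearMap.fst ℝ E E)) p :=
    (hf' p.1).hasFDerivAt.comp p hasFDerivAt_fst
  exact h1.prodMk (h2.clm_apply hasFDerivAt_snd)

theorem hasFDerivAt_gam (hV : CB 2 (fun _ : Unit => V)) (x : E) :
    HasFDerivAt (Gam V V) ((ContinuousLinearMap.compL ℝ (EuclideanSpace ℝ (Fin m)) E
          (EuclideanSpace ℝ (Fin m) →L[ℝ] E) (fderiv ℝ V x)).comp (fderiv ℝ V x)
      + ((ContinuousLinearMap.compL ℝ (EuclideanSpace ℝ (Fin m)) E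
          (EuclideanSpace ℝ (Fin m) →L[ℝ] E)).flip (V x)).comp (fderiv ℝ (fderiv ℝ V) x)) x :=
  (hV.fderiv.differentiable () x).hasFDerivAt.clm_comp (hV.differentiable () x).hasFDerivAt

theorem fderiv_gam_apply (hV : CB 2 (fun _ : Unit => V)) (x v : E)
    (a c : EuclideanSpace ℝ (Fin m)) : fderiv ℝ (Gam V V) x v a c
      = fderiv ℝ (fderiv ℝ V) x v (V x a) c + fderiv ℝ V x (fderiv ℝ V x v a) c := by
  rw [(hasFDerivAt_gam hV x).fderiv]
  simp [add_comm]

theorem norm_snd_lt_eventually {F : Type} [NormedAddCommGroup F] {p : F × F} (hp : ‖p.2‖ < 2) :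
    ∀ᶠ q in nhds p, ‖q.2‖ < 2 :=
  (continuous_snd.norm.continuousAt).eventually_lt continuousAt_const hp

/-- Prolongation commutes with Γ: differentiating (V, DV v) along itself gives D²V and DV·DV terms
in the second component which, by symmetry of D²V, form D(ΓV)v. The cut-off disappears since it is
the identity near the point. -/
theorem gam_tang (hV : CB 2 (fun _ : Unit => V)) (hχ : ∀ v, ‖v‖ < 2 → χ v = v) {p : E × E}
    (hp : ‖p.2‖ < 2) :
    Gam (tang χ V) (tang χ V) p = (ContinuousLinearMap.compL ℝ (EuclideanSpace ℝ (Fin m)) E (E × E)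
        (ContinuousLinearMap.inl ℝ E E)).comp (Gam V V p.1)
      + (ContinuousLinearMap.compL ℝ (EuclideanSpace ℝ (Fin m)) E (E × E)
        (ContinuousLinearMap.inr ℝ E E)).comp (fderiv ℝ (Gam V V) p.1 p.2) := by
  let Λ : ((EuclideanSpace ℝ (Fin m) →L[ℝ] E) × (EuclideanSpace ℝ (Fin m) →L[ℝ] E)) ≃L[ℝ]
      (EuclideanSpace ℝ (Fin m) →L[ℝ] E × E) :=
    (ContinuousLinearMap.prodₗᵢ ℝ).toContinuousLinearEquiv
  have hΛ : ∀ q, Λ q = q.1.prod q.2 := fun q => rfl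
  have hd := Λ.hasFDerivAt.comp p
    (hasFDerivAt_tangent_pair (hV.differentiable ()) (hV.fderiv.differentiable ()) p)
  have hd' := hd.congr_of_eventuallyEq (f₁ := tang χ V) (by
    filter_upwards [norm_snd_lt_eventually hp] with q hq
    simp [tang, hχ _ hq, hΛ])
  ext a c
  · simp [Gam, hd'.fderiv, tang, hΛ]
  · have := second_derivative_symmetric (fun y => (hV.differentiable () y).hasFDerivAt)
      (hV.fderiv.differentiable () p.1).hasFDerivAt p.2 (V p.1 a)
    simp [Gam, hd'.fderiv, tang, hχ _ hp, fderiv_gam_apply hV, this, hΛ]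
    abel

theorem hasFDerivAt_roughInc (hV : CB 2 (fun _ : Unit => V)) (s t : ℝ) (x : E) :
    HasFDerivAt (roughInc Z ZZ V s t) ((fderiv ℝ V x).flip (Z t - Z s)
      + (contractL E (ZZ s t)).comp (fderiv ℝ (Gam V V) x)) x := by
  have h1 := (hV.differentiable () x).hasFDerivAt.clm_apply (hasFDerivAt_const (Z t - Z s) x)
  have h2 := (contractL E (ZZ s t)).hasFDerivAt.comp x
    (hasFDerivAt_gam hV x).differentiableAt.hasFDerivAt
  convert h1.add h2 using 1
  · funext y
    simp [roughInc, contractL_apply]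
  · simp

theorem roughInc_tang (hV : CB 2 (fun _ : Unit => V)) (hχ : ∀ v, ‖v‖ < 2 → χ v = v) {p : E × E}
    (hp : ‖p.2‖ < 2) (s t : ℝ) : roughInc Z ZZ (tang χ V) s t p
      = (roughInc Z ZZ V s t p.1, fderiv ℝ (roughInc Z ZZ V s t) p.1 p.2) := by
  rw [(hasFDerivAt_roughInc hV s t p.1).fderiv, roughInc, gam_tang hV hχ hp, contract_add,
    ← map_contract, ← map_contract]
  ext <;> simp [tang, hχ _ hp, roughInc, contractL_apply]

theorem hasFDerivAt_rdeStep (hV : CB 2 (fun _ : Unit => V)) (hb : Differentiable ℝ b) (s t : ℝ)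
    (x : E) : HasFDerivAt (rdeStep Z ZZ V b s t) (ContinuousLinearMap.id ℝ E
      + fderiv ℝ (roughInc Z ZZ V s t) x + (t - s) • fderiv ℝ b x) x :=
  ((hasFDerivAt_id x).add (hasFDerivAt_roughInc hV s t x).differentiableAt.hasFDerivAt).add
    ((hb x).hasFDerivAt.const_smul (t - s))

/-- The Davie step of the prolonged equation is exactly the tangent map of the Davie step, not
merely up to higher order. Hence derivatives of composed steps are composed steps of the same kind.
-/
theorem rdeStep_tang (hV : CB 2 (fun _ : Unit => V)) (hb : Differentiable ℝ b)
    (hχ : ∀ v, ‖v‖ < 2 → χ v = v) {p : E × E} (hp : ‖p.2‖ < 2) (s t : ℝ) :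
    rdeStep Z ZZ (tang χ V) (tangDrift χ b) s t p
      = (rdeStep Z ZZ V b s t p.1, fderiv ℝ (rdeStep Z ZZ V b s t) p.1 p.2) := by
  rw [(hasFDerivAt_rdeStep hV hb s t p.1).fderiv, rdeStep, roughInc_tang hV hχ hp]
  ext <;> simp [tangDrift, hχ _ hp, rdeStep]

theorem differentiable_fderiv_rdeStep (hV : CB 3 (fun _ : Unit => V))
    (hb : CB 2 (fun _ : Unit => b)) (s t : ℝ) :
    Differentiable ℝ (fderiv ℝ (rdeStep Z ZZ V b s t)) := by
  have h1 : CB 2 (fun (_ : Unit) y => V y (Z t - Z s)) :=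
    hV.of_succ.clm (ContinuousLinearMap.apply ℝ E (Z t - Z s))
  have h2 : CB 2 (fun (_ : Unit) y => contractL E (ZZ s t) (Gam V V y)) :=
    (CB.gam hV.of_succ hV).clm _
  have h3 : CB 2 (fun (_ : Unit) y => ((t - s) • ContinuousLinearMap.id ℝ E) (b y)) := hb.clm _
  have h4 := (h1.add h2).add h3
  have e : fderiv ℝ (rdeStep Z ZZ V b s t) = fun x => ContinuousLinearMap.id ℝ E
      + fderiv ℝ (fun y => V y (Z t - Z s) + contractL E (ZZ s t) (Gam V V y)
          + ((t - s) • ContinuousLinearMap.id ℝ E) (b y)) x := by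
    funext x
    rw [← ((hasFDerivAt_id x).add (h4.differentiable () x).hasFDerivAt).fderiv]
    congr 1
    funext y
    simp [rdeStep, roughInc, contractL_apply, add_assoc]
  rw [e]
  exact (h4.fderiv.differentiable ()).const_add _

end Tangent

/-! ### Derivatives of Euler flows -/

section Jets

variable {m : ℕ} {α T : ℝ} {Z : ℝ → EuclideanSpace ℝ (Fin m)}
  {ZZ : ℝ → ℝ → Matrix (Fin m) (Fin m) ℝ} {E : Type} [NormedAddCommGroup E] [NormedSpace ℝ E]
  {V : E → EuclideanSpace ℝ (Fin m) →L[ℝ] E} {b : E → E}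

theorem opNorm_le_of_unit_ball {U W : Type} [NormedAddCommGroup U] [NormedSpace ℝ U]
    [NormedAddCommGroup W] [NormedSpace ℝ W] {L : U →L[ℝ] W} {C : ℝ} (hC : 0 ≤ C)
    (h : ∀ v, ‖v‖ ≤ 1 → ‖L v‖ ≤ C) : ‖L‖ ≤ C := by
  refine L.opNorm_le_bound hC fun v => ?_
  rcases eq_or_ne v 0 with rfl | hv
  · simp
  · have hv' : ‖v‖ ≠ 0 := norm_ne_zero_iff.2 hv
    have := h (‖v‖⁻¹ • v) (by rw [norm_smul, norm_inv, norm_norm, inv_mul_cancel₀ hv'])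
    rw [map_smul, norm_smul, norm_inv, norm_norm, inv_mul_le_iff₀ (by positivity)] at this
    linarith

/-- The second tangent step acts on `(x, v, w, z)` as the `2`-jet of the step. -/
theorem rdeStep_tang_tang {χ : E → E} {χ₂ : E × E → E × E} (hV : CB 3 (fun _ : Unit => V))
    (hb : CB 2 (fun _ : Unit => b)) (hχc : ∀ k, CB k (fun _ : Unit => χ))
    (hχ : ∀ v, ‖v‖ < 2 → χ v = v) (hχ₂ : ∀ v, ‖v‖ < 2 → χ₂ v = v) {x v w z : E}
    (hv : ‖v‖ < 2) (hw : ‖w‖ < 2) (hz : ‖z‖ < 2) (s t : ℝ) :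
    rdeStep Z ZZ (tang χ₂ (tang χ V)) (tangDrift χ₂ (tangDrift χ b)) s t ((x, v), (w, z))
      = ((rdeStep Z ZZ V b s t x, fderiv ℝ (rdeStep Z ZZ V b s t) x v),
        (fderiv ℝ (rdeStep Z ZZ V b s t) x w,
          fderiv ℝ (fderiv ℝ (rdeStep Z ZZ V b s t)) x w v
            + fderiv ℝ (rdeStep Z ZZ V b s t) x z)) := by
  have hV2 := hV.of_succ
  have hTV : CB 2 (fun _ : Unit => tang χ V) := hV.tang (hχc 2)
  have hTb : CB 1 (fun _ : Unit => tangDrift χ b) := hb.tangDrift (hχc 1)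
  have hwz : ‖(w, z)‖ < 2 := by rw [Prod.norm_mk]; exact max_lt hw hz
  rw [rdeStep_tang hTV (hTb.differentiable ()) hχ₂ hwz]
  have hd := hasFDerivAt_tangent_pair (f := rdeStep Z ZZ V b s t)
    (fun y => (hasFDerivAt_rdeStep hV2 (hb.differentiable ()) s t y).differentiableAt)
    (differentiable_fderiv_rdeStep hV hb s t) (x, v)
  have hd' := hd.congr_of_eventuallyEq
    (f₁ := rdeStep Z ZZ (tang χ V) (tangDrift χ b) s t) (by
    filter_upwards [norm_snd_lt_eventually (p := (x, v)) hv] with q hq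
    exact rdeStep_tang hV2 (hb.differentiable ()) hχ hq s t)
  rw [hd'.fderiv, rdeStep_tang hV2 (hb.differentiable ()) hχ (p := (x, v)) hv]
  simp [add_comm]

theorem norm_fst_snd_le {F : Type} [NormedAddCommGroup F]
    (p : (F × F) × (F × F)) : ‖p.1.2‖ ≤ ‖p‖ :=
  (norm_snd_le p.1).trans (norm_fst_le p)

theorem norm_snd_fst_le {F : Type} [NormedAddCommGroup F]
    (p : (F × F) × (F × F)) : ‖p.2.1‖ ≤ ‖p‖ :=
  (norm_fst_le p.2).trans (norm_snd_le p)

theorem norm_snd_snd_le {F : Type} [NormedAddCommGroup F]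
    (p : (F × F) × (F × F)) : ‖p.2.2‖ ≤ ‖p‖ :=
  (norm_snd_le p.2).trans (norm_snd_le p)

/-- The `2`-jets of Euler flows are the Euler flows of the second tangent fields. -/
theorem euler_tang_tang {χ : E → E} {χ₂ : E × E → E × E} (hV : CB 3 (fun _ : Unit => V))
    (hb : CB 2 (fun _ : Unit => b)) (hχc : ∀ k, CB k (fun _ : Unit => χ))
    (hχ : ∀ v, ‖v‖ < 2 → χ v = v) (hχ₂ : ∀ v, ‖v‖ < 2 → χ₂ v = v) {h₀ : ℝ}
    {S : Finset ℝ} {Φ : ℝ → ℝ → E → E}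
    {Ψ : ℝ → ℝ → (E × E) × (E × E) → (E × E) × (E × E)}
    (hΦ : IsEulerFlow (rdeStep Z ZZ V b) S Φ)
    (hΨ : IsEulerFlow (rdeStep Z ZZ (tang χ₂ (tang χ V)) (tangDrift χ₂ (tangDrift χ b))) S Ψ)
    (hclose : ∀ s ∈ S, ∀ t ∈ S, 0 ≤ s → s ≤ t → t ≤ T → t - s ≤ h₀ → ∀ p, ‖Ψ s t p - p‖ < 1)
    {s : ℝ} (hs : s ∈ S) (hs0 : 0 ≤ s) : ∀ t ∈ S, s ≤ t → t ≤ T → t - s ≤ h₀ →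
      Differentiable ℝ (Φ s t) ∧ Differentiable ℝ (fderiv ℝ (Φ s t)) ∧
      ∀ x v w, ‖v‖ ≤ 1 → ‖w‖ ≤ 1 → Ψ s t ((x, v), (w, 0))
        = ((Φ s t x, fderiv ℝ (Φ s t) x v),
          (fderiv ℝ (Φ s t) x w, fderiv ℝ (fderiv ℝ (Φ s t)) x w v)) := by
  refine hΦ.induction hs (Q := fun t f => t ≤ T → t - s ≤ h₀ →
      Differentiable ℝ f ∧ Differentiable ℝ (fderiv ℝ f) ∧
      ∀ x v w, ‖v‖ ≤ 1 → ‖w‖ ≤ 1 → Ψ s t ((x, v), (w, 0))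
        = ((f x, fderiv ℝ f x v), (fderiv ℝ f x w, fderiv ℝ (fderiv ℝ f) x w v))) ?_ ?_
  · intro _ _
    have e : fderiv ℝ (id : E → E) = fun _ => ContinuousLinearMap.id ℝ E := by
      funext x; exact fderiv_id
    refine ⟨differentiable_id, by rw [e]; exact differentiable_const _, fun x v w _ _ => ?_⟩
    rw [hΨ.refl s hs, e]
    simp
  · intro u hu t ht hsu hut hcons ih htT hh
    obtain ⟨d1, d2, hj⟩ := ih (by linarith) (by linarith)
    set ψ := rdeStep Z ZZ V b u t with hψ
    have e1 : Differentiable ℝ ψ := fun y =>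
      (hasFDerivAt_rdeStep hV.of_succ (hb.differentiable ()) u t y).differentiableAt
    have e2 : Differentiable ℝ (fderiv ℝ ψ) := differentiable_fderiv_rdeStep hV hb u t
    have f1 : fderiv ℝ (fun y => ψ (Φ s u y))
        = fun y => (fderiv ℝ ψ (Φ s u y)).comp (fderiv ℝ (Φ s u) y) := by
      funext y
      exact ((e1 _).hasFDerivAt.comp y (d1 y).hasFDerivAt).fderiv
    have f2 : ∀ y, HasFDerivAt (fun y => (fderiv ℝ ψ (Φ s u y)).comp (fderiv ℝ (Φ s u) y)) _ y :=
      fun y => ((e2 _).hasFDerivAt.comp y (d1 y).hasFDerivAt).clm_comp (d2 y).hasFDerivAt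
    refine ⟨e1.comp d1, by rw [f1]; exact fun y => (f2 y).differentiableAt, ?_⟩
    intro x v w hv hw
    -- Starting from vectors of norm at most 1, and 0 in the last slot, displacements below 1 keep
    -- all tangent components inside the ball of radius 2, so the next step still acts as the true
    -- 2-jet.
    have hc := hclose s hs u hu hs0 hsu (by linarith) (by linarith) ((x, v), (w, 0))
    rw [hΨ.comp s hs u hu t ht hsu hut.le, hΨ.step u hu t ht hut hcons]
    rw [hj x v w hv hw] at hc ⊢
    have c1 : ‖fderiv ℝ (Φ s u) x v - v‖ < 1 :=
      (norm_fst_snd_le _).trans_lt hc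
    have c2 : ‖fderiv ℝ (Φ s u) x w - w‖ < 1 :=
      (norm_snd_fst_le _).trans_lt hc
    have c3 : ‖fderiv ℝ (fderiv ℝ (Φ s u)) x w v - 0‖ < 1 :=
      (norm_snd_snd_le _).trans_lt hc
    have g : ∀ a c : E, ‖a - c‖ < 1 → ‖c‖ ≤ 1 → ‖a‖ < 2 := fun a c h h' => by
      have := norm_add_le (a - c) c
      rw [sub_add_cancel] at this
      linarith
    rw [rdeStep_tang_tang hV hb hχc hχ hχ₂ (g _ _ c1 hv) (g _ _ c2 hw) (g _ _ c3 (by simp)),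
      f1, (f2 x).fderiv]
    simp [hψ, add_comm]

/-- These are the almost flow estimates for the twice prolonged fields, read off by components: (x,
v) carries the first derivative, the last slot the second one, and Lipschitz dependence of the last
slot on x bounds the variation of the second derivative. -/
theorem euler_jet [FiniteDimensional ℝ E] (hα : 1 / 3 < α) (hα' : α ≤ 1 / 2)
    (hZ : IsRoughPath α T Z ZZ) (hV : CB 4 (fun _ : Unit => V)) (hb : CB 2 (fun _ : Unit => b)) :
    ∃ h₀ : ℝ, 0 < h₀ ∧ h₀ ≤ 1 ∧ ∃ C : ℝ, 0 ≤ C ∧ ∀ (S : Finset ℝ) (Φ : ℝ → ℝ → E → E),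
      IsEulerFlow (rdeStep Z ZZ V b) S Φ →
      ∀ s ∈ S, ∀ t ∈ S, 0 ≤ s → s ≤ t → t ≤ T → t - s ≤ h₀ →
        Differentiable ℝ (Φ s t) ∧ Differentiable ℝ (fderiv ℝ (Φ s t)) ∧
        (∀ x, ‖fderiv ℝ (Φ s t) x - ContinuousLinearMap.id ℝ E
          - (fderiv ℝ V x).flip (Z t - Z s)‖ ≤ C * ((t - s) ^ α) ^ 2) ∧
        (∀ x, ‖fderiv ℝ (fderiv ℝ (Φ s t)) x‖ ≤ C * (t - s) ^ α) ∧
        ∀ x x', ‖fderiv ℝ (fderiv ℝ (Φ s t)) x - fderiv ℝ (fderiv ℝ (Φ s t)) x'‖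
          ≤ C * ‖x - x'‖ := by
  have hα0 : 0 < α := by linarith
  obtain ⟨χ, hχc, hχ⟩ := exists_cutoff (W := E)
  obtain ⟨χ₂, hχ₂c, hχ₂⟩ := exists_cutoff (W := E × E)
  have hV2 : CB 2 (fun _ : Unit => V) := hV.of_succ.of_succ
  have hTTV : CB 2 (fun _ : Unit => tang χ₂ (tang χ V)) := (hV.tang (hχc 3)).tang (hχ₂c 2)
  have hTTb : CB 0 (fun _ : Unit => tangDrift χ₂ (tangDrift χ b)) :=
    (hb.tangDrift (hχc 1)).tangDrift (hχ₂c 0)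
  obtain ⟨K, hP⟩ := exists_isAlmostFlow hα0 hZ hTTV hTTb
  have hK := hP.nonneg
  obtain ⟨h₁, h10, h11, L₁, hL₁, H1⟩ := hP.euler_bound hα hα'
  obtain ⟨h₂, h20, h21, L₂, hL₂, H2⟩ := hP.euler_lipschitz hα hα'
  -- On this window displacements are at most 1/2, hence below the 1 demanded by `euler_tang_tang`.
  obtain ⟨h₃, h30, h31, H3⟩ := exists_pos_forall_mul_rpow_le hα0 (K + L₁) (e := 1 / 2) (by norm_num)
  obtain ⟨Cz, hCz, hz⟩ := hZ.bounds
  obtain ⟨Cg, hCg, hg⟩ := (CB.gam hV2.of_succ hV2).fderiv.bounded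
  set h₀ := min h₁ (min h₂ h₃)
  have l1 : h₀ ≤ h₁ := min_le_left _ _
  have l2 : h₀ ≤ h₂ := (min_le_right _ _).trans (min_le_left _ _)
  have l3 : h₀ ≤ h₃ := (min_le_right _ _).trans (min_le_right _ _)
  refine ⟨h₀, by positivity, l1.trans h11, (L₁ + Cz * Cg) + (K + L₁) + L₂, by positivity, ?_⟩
  intro S Φ hΦ s hs t ht hs0 hst htT hh
  obtain ⟨Ψ, hΨ⟩ := exists_isEulerFlow
    (rdeStep Z ZZ (tang χ₂ (tang χ V)) (tangDrift χ₂ (tangDrift χ b))) S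
  have hdisp : ∀ s ∈ S, ∀ t ∈ S, 0 ≤ s → s ≤ t → t ≤ T → t - s ≤ h₀ → ∀ p,
      ‖Ψ s t p - p‖ ≤ (K + L₁) * (t - s) ^ α := fun s hs t ht hs0 hst htT hh p =>
    hP.euler_displacement hα0 h11 hL₁ hs0 hst htT (hh.trans l1)
      (H1 S Ψ hΨ s hs t ht hs0 hst htT (hh.trans l1) p)
  obtain ⟨d1, d2, hj⟩ := euler_tang_tang (T := T) (h₀ := h₀) hV.of_succ hb hχc hχ hχ₂ hΦ hΨ
    (fun s hs t ht hs0 hst htT hh p => (hdisp s hs t ht hs0 hst htT hh p).trans_lt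
      ((H3 (t - s) (by linarith) (hh.trans l3)).trans_lt (by norm_num))) hs hs0 t ht hst htT hh
  set H := (t - s) ^ α
  have hH0 : 0 ≤ H := Real.rpow_nonneg (by linarith) _
  refine ⟨d1, d2, fun x => ?_, fun x => ?_, fun x x' => ?_⟩
  · refine opNorm_le_of_unit_ball (by positivity) fun v hv => ?_
    have h1 := H1 S Ψ hΨ s hs t ht hs0 hst htT (hh.trans l1) ((x, v), (0, 0))
    rw [hj x v 0 hv (by simp), roughInc_tang (hV.of_succ.tang (hχc 2)) hχ₂ (by simp),
      roughInc_tang hV2 hχ (p := (x, v)) (by simpa using hv.trans_lt one_lt_two)] at h1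
    have h2 := (norm_fst_snd_le _).trans h1
    simp only [Prod.fst_sub, Prod.snd_sub] at h2
    rw [(hasFDerivAt_roughInc hV2 s t x).fderiv] at h2
    have h3 : ‖contract (fderiv ℝ (Gam V V) x v) (ZZ s t)‖ ≤ Cz * H ^ 2 * Cg := by
      refine ((hz s t hs0 hst htT).2 _ _).trans ?_
      gcongr
      exact ((fderiv ℝ (Gam V V) x).le_of_opNorm_le_of_le (hg () x) hv).trans (by simp)
    have e : (fderiv ℝ (Φ s t) x - ContinuousLinearMap.id ℝ E
          - (fderiv ℝ V x).flip (Z t - Z s)) v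
        = (fderiv ℝ (Φ s t) x v - v - ((fderiv ℝ V x).flip (Z t - Z s)
          + (contractL E (ZZ s t)).comp (fderiv ℝ (Gam V V) x)) v)
          + contract (fderiv ℝ (Gam V V) x v) (ZZ s t) := by
      simp [contractL_apply]
      abel
    rw [e]
    refine (norm_add_le_of_le h2 h3).trans ?_
    have : 0 ≤ ((K + L₁) + L₂) * H ^ 2 := by positivity
    linarith
  · refine opNorm_le_of_unit_ball (by positivity) fun w hw =>
      opNorm_le_of_unit_ball (by positivity) fun v hv => ?_
    have h1 := hdisp s hs t ht hs0 hst htT hh ((x, v), (w, 0))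
    rw [hj x v w hv hw] at h1
    have h2 := (norm_snd_snd_le _).trans h1
    simp only [Prod.snd_sub, sub_zero] at h2
    refine h2.trans ?_
    have : 0 ≤ (L₁ + Cz * Cg + L₂) * H := by positivity
    linarith
  · refine opNorm_le_of_unit_ball (by positivity) fun w hw =>
      opNorm_le_of_unit_ball (by positivity) fun v hv => ?_
    have h1 := H2 S Ψ hΨ s hs t ht hs0 hst htT (hh.trans l2) ((x, v), (w, 0)) ((x', v), (w, 0))
    rw [hj x v w hv hw, hj x' v w hv hw] at h1
    have h2 := (norm_snd_snd_le _).trans h1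
    simp only [Prod.mk_sub_mk, sub_self, Prod.norm_mk, norm_zero, norm_nonneg, max_eq_left] at h2
    refine h2.trans ?_
    have : 0 ≤ (L₁ + Cz * Cg + (K + L₁)) * ‖x - x'‖ := by positivity
    linarith

end Jets

/-! ### The flow -/

theorem hasFDerivAt_of_norm_sub_le_sq {E F : Type} [NormedAddCommGroup E] [NormedSpace ℝ E]
    [NormedAddCommGroup F] [NormedSpace ℝ F] {f : E → F} {L : E →L[ℝ] F} {x : E} {C : ℝ}
    (h : ∀ y, ‖y - x‖ ≤ 1 → ‖f y - f x - L (y - x)‖ ≤ C * ‖y - x‖ ^ 2) : HasFDerivAt f L x := by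
  rw [hasFDerivAt_iff_isLittleO]
  have hO : (fun y => f y - f x - L (y - x)) =O[nhds x] fun y => ‖y - x‖ ^ 2 := by
    refine Asymptotics.IsBigO.of_bound C ?_
    filter_upwards [Metric.ball_mem_nhds x one_pos] with y hy
    rw [norm_pow, norm_norm]
    exact h y (mem_ball_iff_norm.1 hy).le
  refine hO.trans_isLittleO (Asymptotics.IsLittleO.of_norm_right ?_)
  refine (Asymptotics.isLittleO_pow_id (𝕜 := ℝ) one_lt_two).comp_tendsto ?_
  have : Filter.Tendsto (fun y => ‖y - x‖) (nhds x) (nhds ‖x - x‖) := by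
    exact (continuous_id.sub continuous_const).norm.tendsto x
  simpa using this

/-- An ultrafilter gives limits for all s, t, x and all derivatives at once, with no extraction of
subsequences. -/
theorem exists_tendsto_of_bounded {ι F : Type} [NormedAddCommGroup F] [NormedSpace ℝ F]
    [FiniteDimensional ℝ F] (l : Ultrafilter ι) {f : ι → F} {C : ℝ} {c : F}
    (h : ∀ᶠ i in (l : Filter ι), ‖f i - c‖ ≤ C) :
    ∃ y, Filter.Tendsto f l (nhds y) := by
  have := FiniteDimensional.proper ℝ F
  obtain ⟨y, _, hy⟩ := (isCompact_closedBall c C).ultrafilter_le_nhds (l.map f) (by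
    rw [Filter.le_principal_iff, Ultrafilter.mem_coe, Ultrafilter.mem_map]
    filter_upwards [h] with i hi
    rwa [mem_preimage, mem_closedBall_iff_norm])
  exact ⟨y, hy⟩

/-- Limits of uniformly `C^{1,1}` maps are differentiable, and the derivatives converge. -/
theorem tendsto_fderiv_of_tendsto {ι E F : Type} [NormedAddCommGroup E] [NormedSpace ℝ E]
    [FiniteDimensional ℝ E] [NormedAddCommGroup F] [NormedSpace ℝ F] [FiniteDimensional ℝ F]
    (l : Ultrafilter ι) {f : ι → E → F} {g : E → F} {C : ℝ} (hC : 0 ≤ C)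
    (hd : ∀ᶠ i in (l : Filter ι), Differentiable ℝ (f i) ∧ (∀ x, ‖fderiv ℝ (f i) x‖ ≤ C) ∧
      ∀ x y, ‖fderiv ℝ (f i) x - fderiv ℝ (f i) y‖ ≤ C * ‖x - y‖)
    (hg : ∀ x, Filter.Tendsto (fun i => f i x) l (nhds (g x))) :
    Differentiable ℝ g ∧ ∀ x, Filter.Tendsto (fun i => fderiv ℝ (f i) x) l
      (nhds (fderiv ℝ g x)) := by
  have key : ∀ x, ∃ L, HasFDerivAt g L x ∧
      Filter.Tendsto (fun i => fderiv ℝ (f i) x) l (nhds L) := by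
    intro x
    obtain ⟨L, hL⟩ := exists_tendsto_of_bounded l (f := fun i => fderiv ℝ (f i) x) (c := 0) (C := C)
      (by filter_upwards [hd] with i hi; simpa using hi.2.1 x)
    -- The first order Taylor bound is uniform in i, so it passes to the limit and identifies the
    -- limit L of the derivatives as the derivative of g.
    refine ⟨L, hasFDerivAt_of_norm_sub_le_sq (C := C) fun y _ => ?_, hL⟩
    have ht : Filter.Tendsto (fun i => ‖f i y - f i x - fderiv ℝ (f i) x (y - x)‖) l
        (nhds ‖g y - g x - L (y - x)‖) :=
      (((hg y).sub (hg x)).sub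
        (((ContinuousLinearMap.apply ℝ F (y - x)).continuous.tendsto L).comp hL)).norm
    refine le_of_tendsto ht ?_
    filter_upwards [hd] with i hi
    exact CB.norm_taylor_one_le hi.1 hC hi.2.2 x y
  choose L hL hL' using key
  refine ⟨fun x => (hL x).differentiableAt, fun x => ?_⟩
  rw [(hL x).fderiv]
  exact hL' x

/-- `Φ` is the flow of the rough differential equation `dX = μ(X) dt + σ(X) d𝐙`, with the estimates
for its jets. -/
structure IsRDEFlow {m : ℕ} {E : Type} [NormedAddCommGroup E] [NormedSpace ℝ E] (α T C : ℝ)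
    (Z : ℝ → EuclideanSpace ℝ (Fin m)) (ZZ : ℝ → ℝ → Matrix (Fin m) (Fin m) ℝ) (μ : E → E)
    (σ : E → EuclideanSpace ℝ (Fin m) →L[ℝ] E) (Φ : ℝ → ℝ → E → E) : Prop where
  nonneg : 0 ≤ C
  refl : ∀ s, 0 ≤ s → s ≤ T → ∀ x, Φ s s x = x
  comp : ∀ s u t, 0 ≤ s → s ≤ u → u ≤ t → t ≤ T → ∀ x, Φ s t x = Φ u t (Φ s u x)
  step : ∀ s t, 0 ≤ s → s ≤ t → t ≤ T → ∀ x,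
    ‖Φ s t x - rdeStep Z ZZ σ μ s t x‖ ≤ C * ((t - s) ^ α) ^ 3
  diff : ∀ s t, 0 ≤ s → s ≤ t → t ≤ T → Differentiable ℝ (Φ s t)
  diff₂ : ∀ s t, 0 ≤ s → s ≤ t → t ≤ T → Differentiable ℝ (fderiv ℝ (Φ s t))
  deriv : ∀ s t, 0 ≤ s → s ≤ t → t ≤ T → ∀ x, ‖fderiv ℝ (Φ s t) x - ContinuousLinearMap.id ℝ E
    - (fderiv ℝ σ x).flip (Z t - Z s)‖ ≤ C * ((t - s) ^ α) ^ 2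
  deriv₂ : ∀ s t, 0 ≤ s → s ≤ t → t ≤ T → ∀ x,
    ‖fderiv ℝ (fderiv ℝ (Φ s t)) x‖ ≤ C * (t - s) ^ α
  deriv₂_lip : ∀ s t, 0 ≤ s → s ≤ t → t ≤ T → ∀ x y,
    ‖fderiv ℝ (fderiv ℝ (Φ s t)) x - fderiv ℝ (fderiv ℝ (Φ s t)) y‖ ≤ C * ‖x - y‖

section Flow

variable {m : ℕ} {α T : ℝ} {Z : ℝ → EuclideanSpace ℝ (Fin m)}
  {ZZ : ℝ → ℝ → Matrix (Fin m) (Fin m) ℝ} {E : Type} [NormedAddCommGroup E] [NormedSpace ℝ E]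
  {V : E → EuclideanSpace ℝ (Fin m) →L[ℝ] E} {b : E → E}

/-- A flow with estimates on short time intervals. -/
theorem exists_flow_short [FiniteDimensional ℝ E] (hα : 1 / 3 < α) (hα' : α ≤ 1 / 2)
    (hZ : IsRoughPath α T Z ZZ) (hV : CB 4 (fun _ : Unit => V)) (hb : CB 2 (fun _ : Unit => b)) :
    ∃ (h₀ C : ℝ) (D : ℕ → ℝ) (Φ : ℝ → ℝ → E → E), 0 < h₀ ∧ 0 ≤ C ∧
      (∀ s, 0 ≤ s → s ≤ T → ∀ x, Φ s s x = x) ∧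
      (∀ s u t, 0 ≤ s → s ≤ u → u ≤ t → t ≤ T → ∀ x, Φ s t x = Φ u t (Φ s u x)) ∧
      (∀ n : ℕ, ∀ s t, 0 ≤ s → s ≤ t → t ≤ T → t - s ≤ n * h₀ → ∀ x, ‖Φ s t x - x‖ ≤ D n) ∧
      ∀ s t, 0 ≤ s → s ≤ t → t ≤ T → t - s ≤ h₀ →
        (∀ x, ‖Φ s t x - rdeStep Z ZZ V b s t x‖ ≤ C * ((t - s) ^ α) ^ 3) ∧
        Differentiable ℝ (Φ s t) ∧ Differentiable ℝ (fderiv ℝ (Φ s t)) ∧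
        (∀ x, ‖fderiv ℝ (Φ s t) x - ContinuousLinearMap.id ℝ E
          - (fderiv ℝ V x).flip (Z t - Z s)‖ ≤ C * ((t - s) ^ α) ^ 2) ∧
        (∀ x, ‖fderiv ℝ (fderiv ℝ (Φ s t)) x‖ ≤ C * (t - s) ^ α) ∧
        ∀ x x', ‖fderiv ℝ (fderiv ℝ (Φ s t)) x - fderiv ℝ (fderiv ℝ (Φ s t)) x'‖
          ≤ C * ‖x - x'‖ := by
  have hα0 : 0 < α := by linarith
  have hV2 : CB 2 (fun _ : Unit => V) := hV.of_succ.of_succ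
  obtain ⟨K, hP⟩ := exists_isAlmostFlow hα0 hZ hV2 hb.of_succ.of_succ
  have hK := hP.nonneg
  obtain ⟨h₁, h10, h11, L₁, hL₁, H1⟩ := hP.euler_bound hα hα'
  obtain ⟨h₂, h20, h21, L₂, hL₂, H2⟩ := hP.euler_lipschitz hα hα'
  obtain ⟨h₃, h30, h31, L₃, hL₃, H3⟩ := hP.euler_sub_step hα hα'
  obtain ⟨h₄, h40, h41, L₄, hL₄, H4⟩ := euler_jet hα hα' hZ hV hb
  set h₀ := min (min h₁ h₂) (min h₃ h₄)
  have h00 : 0 < h₀ := by positivity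
  have l1 : h₀ ≤ h₁ := (min_le_left _ _).trans (min_le_left _ _)
  have l2 : h₀ ≤ h₂ := (min_le_left _ _).trans (min_le_right _ _)
  have l3 : h₀ ≤ h₃ := (min_le_right _ _).trans (min_le_left _ _)
  have l4 : h₀ ≤ h₄ := (min_le_right _ _).trans (min_le_right _ _)
  choose Ψ hΨ using exists_isEulerFlow (rdeStep Z ZZ V b)
  -- Each fixed time eventually belongs to S, so the identities valid on S hold in the limit for all
  -- real times.
  have hmem : ∀ s : ℝ, ∀ᶠ S : Finset ℝ in Filter.atTop, s ∈ S := fun s => by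
    filter_upwards [Filter.eventually_ge_atTop ({s} : Finset ℝ)] with S hS
    exact hS (Finset.mem_singleton_self s)
  -- Crude bounds over any number of short windows, obtained by peeling off a last piece of length
  -- at most h₀. They give limits for all s ≤ t and let compositions pass to the limit.
  have hlong : ∀ n : ℕ, ∃ D : ℝ, 0 ≤ D ∧ ∀ s t, 0 ≤ s → s ≤ t → t ≤ T → t - s ≤ n * h₀ →
      ∀ᶠ S in Filter.atTop, ∀ x x', ‖Ψ S s t x - x‖ ≤ D ∧
        ‖Ψ S s t x - Ψ S s t x'‖ ≤ D * ‖x - x'‖ := by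
    intro n
    induction n with
    | zero =>
      refine ⟨1, zero_le_one, fun s t hs hst htT hh => ?_⟩
      obtain rfl : s = t := by simp at hh; linarith
      filter_upwards [hmem s] with S hS x x'
      rw [(hΨ S).refl s hS, (hΨ S).refl s hS]
      simp
    | succ n ih =>
      obtain ⟨D, hD, ih⟩ := ih
      refine ⟨(K + L₁) + D + L₂ * D, by positivity, fun s t hs hst htT hh => ?_⟩
      push_cast at hh
      set u := max s (t - h₀) with hu
      have hsu : s ≤ u := le_max_left _ _
      have hut : u ≤ t := max_le hst (by linarith)
      have hus : u - s ≤ n * h₀ := by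
        have : u ≤ s + n * h₀ := max_le (by have := h00.le; nlinarith [n.cast_nonneg (α := ℝ)])
          (by linarith)
        linarith
      have htu : t - u ≤ h₀ := by linarith [le_max_right s (t - h₀)]
      filter_upwards [hmem s, hmem u, hmem t, ih s u hs hsu (by linarith) hus]
        with S hS hU hT IH x x'
      rw [(hΨ S).comp s hS u hU t hT hsu hut, (hΨ S).comp s hS u hU t hT hsu hut]
      constructor
      · have a1 := hP.euler_displacement hα0 h11 hL₁ (by linarith) hut htT (htu.trans l1)
          (H1 S (Ψ S) (hΨ S) u hU t hT (by linarith) hut htT (htu.trans l1) (Ψ S s u x))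
        have a2 : (t - u) ^ α ≤ 1 :=
          Real.rpow_le_one (by linarith) (htu.trans (l1.trans h11)) hα0.le
        have e : Ψ S u t (Ψ S s u x) - x = (Ψ S u t (Ψ S s u x) - Ψ S s u x) + (Ψ S s u x - x) := by
          abel
        rw [e]
        refine (norm_add_le_of_le a1 (IH x x').1).trans ?_
        have : (K + L₁) * (t - u) ^ α ≤ (K + L₁) * 1 := by gcongr
        have : 0 ≤ L₂ * D := by positivity
        linarith
      · refine (H2 S (Ψ S) (hΨ S) u hU t hT (by linarith) hut htT (htu.trans l2) _ _).trans ?_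
        have : L₂ * ‖Ψ S s u x - Ψ S s u x'‖ ≤ L₂ * (D * ‖x - x'‖) := by
          gcongr; exact (IH x x').2
        have : 0 ≤ (K + L₁ + D) * ‖x - x'‖ := by positivity
        linarith
  choose D hD hlong using hlong
  let l : Ultrafilter (Finset ℝ) := Ultrafilter.of Filter.atTop
  have hl : (l : Filter (Finset ℝ)) ≤ Filter.atTop := Ultrafilter.of_le _
  have hex : ∀ s t : ℝ, ∃ n : ℕ, t - s ≤ n * h₀ := fun s t => by
    obtain ⟨n, hn⟩ := exists_nat_ge ((t - s) / h₀)
    exact ⟨n, by rwa [div_le_iff₀ h00] at hn⟩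
  have hlim : ∀ s t x, ∃ y, 0 ≤ s → s ≤ t → t ≤ T →
      Filter.Tendsto (fun S => Ψ S s t x) l (nhds y) := by
    intro s t x
    by_cases h : 0 ≤ s ∧ s ≤ t ∧ t ≤ T
    · obtain ⟨n, hn⟩ := hex s t
      obtain ⟨y, hy⟩ := exists_tendsto_of_bounded l (f := fun S => Ψ S s t x) (c := x) (C := D n)
        (hl (by
          filter_upwards [hlong n s t h.1 h.2.1 h.2.2 hn] with S hS
          exact (hS x x).1))
      exact ⟨y, fun _ _ _ => hy⟩
    · exact ⟨x, fun h1 h2 h3 => absurd ⟨h1, h2, h3⟩ h⟩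
  choose Φ hΦ using hlim
  obtain ⟨Cz, hCz, hz⟩ := hZ.bounds
  obtain ⟨Cv, hCv, hv⟩ := hV.fderiv.bounded
  refine ⟨h₀, L₃ + L₄, D, Φ, h00, by positivity, ?_, ?_, ?_, ?_⟩
  · intro s hs hsT x
    refine tendsto_nhds_unique (hΦ s s x hs le_rfl hsT) ?_
    refine tendsto_const_nhds.congr' ?_
    filter_upwards [hl (hmem s)] with S hS
    exact ((hΨ S).refl s hS x).symm
  · intro s u t hs hsu hut htT x
    obtain ⟨n, hn⟩ := hex u t
    refine tendsto_nhds_unique (hΦ s t x hs (hsu.trans hut) htT) ?_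
    have h1 := hΦ u t (Φ s u x) (hs.trans hsu) hut htT
    have h2 := hΦ s u x hs hsu (hut.trans htT)
    -- The Lipschitz bound, eventually uniform in S, allows the inner point to be replaced by its
    -- limit.
    have h3 : Filter.Tendsto (fun S => Ψ S u t (Ψ S s u x) - Ψ S u t (Φ s u x)) l (nhds 0) := by
      refine squeeze_zero_norm' (a := fun S => D n * ‖Ψ S s u x - Φ s u x‖) ?_ ?_
      · filter_upwards [hl (hlong n u t (hs.trans hsu) hut htT hn)] with S hS
        exact (hS _ _).2
      · have := ((h2.sub_const (Φ s u x)).norm).const_mul (D n)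
        simpa using this
    have h4 := h3.add h1
    rw [zero_add] at h4
    refine h4.congr' ?_
    filter_upwards [hl (hmem s), hl (hmem u), hl (hmem t)] with S hS hU hT
    rw [sub_add_cancel, (hΨ S).comp s hS u hU t hT hsu hut]
  · intro n s t hs hst htT hh x
    refine le_of_tendsto (((hΦ s t x hs hst htT).sub_const x).norm) ?_
    filter_upwards [hl (hlong n s t hs hst htT hh)] with S hS
    exact (hS x x).1
  · intro s t hs hst htT hh
    have hH0 : 0 ≤ (t - s) ^ α := Real.rpow_nonneg (by linarith) _
    have hH1 : (t - s) ^ α ≤ 1 := Real.rpow_le_one (by linarith) (by linarith) hα0.le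
    have hev : ∀ᶠ S in (l : Filter (Finset ℝ)), s ∈ S ∧ t ∈ S :=
      Filter.Eventually.and (hl (hmem s)) (hl (hmem t))
    have hjet := hev.mono fun S hS =>
      H4 S (Ψ S) (hΨ S) s hS.1 t hS.2 hs hst htT (hh.trans l4)
    have hflip : ∀ x, ‖(fderiv ℝ V x).flip (Z t - Z s)‖ ≤ Cv * (Cz * 1) := fun x => by
      refine ((fderiv ℝ V x).flip.le_opNorm _).trans ?_
      rw [ContinuousLinearMap.opNorm_flip]
      gcongr
      · exact hv () x
      · exact (hz s t hs hst htT).1.trans (by gcongr)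
    have hb1 : ∀ᶠ S in (l : Filter (Finset ℝ)), ∀ x,
        ‖fderiv ℝ (Ψ S s t) x‖ ≤ L₄ + (1 + Cv * (Cz * 1)) := by
      filter_upwards [hjet] with S hS x
      have e : fderiv ℝ (Ψ S s t) x = (fderiv ℝ (Ψ S s t) x - ContinuousLinearMap.id ℝ E
          - (fderiv ℝ V x).flip (Z t - Z s))
          + (ContinuousLinearMap.id ℝ E + (fderiv ℝ V x).flip (Z t - Z s)) := by abel
      rw [e]
      refine norm_add_le_of_le ((hS.2.2.1 x).trans ?_)
        (norm_add_le_of_le ContinuousLinearMap.norm_id_le (hflip x))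
      exact mul_le_of_le_one_right hL₄ (pow_le_one₀ hH0 hH1)
    have hb2 : ∀ᶠ S in (l : Filter (Finset ℝ)), ∀ x, ‖fderiv ℝ (fderiv ℝ (Ψ S s t)) x‖ ≤ L₄ := by
      filter_upwards [hjet] with S hS x
      exact (hS.2.2.2.1 x).trans (mul_le_of_le_one_right hL₄ hH1)
    obtain ⟨g1, g2⟩ := tendsto_fderiv_of_tendsto l (C := L₄ + (1 + Cv * (Cz * 1))) (by positivity)
      (f := fun S => Ψ S s t) (g := Φ s t) (by
        filter_upwards [hjet, hb1, hb2] with S hS hS1 hS2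
        refine ⟨hS.1, hS1, fun x y => (CB.lipschitz_of_fderiv_le hS.2.1 hS2 x y).trans ?_⟩
        gcongr
        have : 0 ≤ Cv * (Cz * 1) := by positivity
        linarith) (fun x => hΦ s t x hs hst htT)
    obtain ⟨g3, g4⟩ := tendsto_fderiv_of_tendsto l hL₄ (f := fun S => fderiv ℝ (Ψ S s t))
      (g := fderiv ℝ (Φ s t)) (by
        filter_upwards [hjet, hb2] with S hS hS2
        exact ⟨hS.2.1, hS2, hS.2.2.2.2⟩) g2
    refine ⟨fun x => ?_, g1, g3, fun x => ?_, fun x => ?_, fun x x' => ?_⟩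
    · refine (le_of_tendsto (((hΦ s t x hs hst htT).sub_const _).norm) (b := L₃ * _) ?_).trans
        (mul_le_mul_of_nonneg_right (by linarith) (by positivity))
      filter_upwards [hev] with S hS
      exact H3 S (Ψ S) (hΨ S) s hS.1 t hS.2 hs hst htT (hh.trans l3) x
    · refine (le_of_tendsto ((((g2 x).sub_const _).sub_const _).norm) (b := L₄ * _) ?_).trans
        (mul_le_mul_of_nonneg_right (by linarith) (by positivity))
      filter_upwards [hjet] with S hS
      exact hS.2.2.1 x
    · refine (le_of_tendsto ((g4 x).norm) (b := L₄ * _) ?_).trans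
        (mul_le_mul_of_nonneg_right (by linarith) (by positivity))
      filter_upwards [hjet] with S hS
      exact hS.2.2.2.1 x
    · refine (le_of_tendsto (((g4 x).sub (g4 x')).norm) (b := L₄ * _) ?_).trans
        (mul_le_mul_of_nonneg_right (by linarith) (by positivity))
      filter_upwards [hjet] with S hS
      exact hS.2.2.2.2 x x'

end Flow

/-! ### From short to arbitrary time intervals -/

section LongFlow

variable {m : ℕ} {α T : ℝ} {Z : ℝ → EuclideanSpace ℝ (Fin m)}
  {ZZ : ℝ → ℝ → Matrix (Fin m) (Fin m) ℝ} {E : Type} [NormedAddCommGroup E] [NormedSpace ℝ E]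
  {V : E → EuclideanSpace ℝ (Fin m) →L[ℝ] E} {b : E → E}

/-- A bound of order k on short intervals extends to long ones as soon as the quantity is bounded:
for h > h₀ the power of h is bounded below by that of h₀. -/
theorem le_mul_pow_of_dichotomy {h₀ h M C a : ℝ} (hα : 0 < α) (h0 : 0 < h₀) (hh : 0 ≤ h)
    (hM : 0 ≤ M) (hC : 0 ≤ C) (k : ℕ) (h1 : h ≤ h₀ → a ≤ C * (h ^ α) ^ k) (h2 : a ≤ M) :
    a ≤ (C + M / (h₀ ^ α) ^ k) * (h ^ α) ^ k := by
  have hH : 0 ≤ h ^ α := Real.rpow_nonneg hh _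
  have hη : 0 < h₀ ^ α := Real.rpow_pos_of_pos h0 _
  rw [add_mul]
  rcases le_or_gt h h₀ with h3 | h3
  · have : 0 ≤ M / (h₀ ^ α) ^ k * (h ^ α) ^ k := by positivity
    linarith [h1 h3]
  · have h4 : (h₀ ^ α) ^ k ≤ (h ^ α) ^ k :=
      pow_le_pow_left₀ hη.le (Real.rpow_le_rpow h0.le h3.le hα.le) k
    have h5 : M ≤ M / (h₀ ^ α) ^ k * (h ^ α) ^ k := by
      rw [div_mul_eq_mul_div, le_div_iff₀ (by positivity)]
      gcongr
    have : 0 ≤ C * (h ^ α) ^ k := by positivity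
    linarith

/-- The times `s ≤ t` in `[0, T]` at distance at most `r`. -/
abbrev TimePair (T r : ℝ) : Type := {p : ℝ × ℝ // 0 ≤ p.1 ∧ p.1 ≤ p.2 ∧ p.2 ≤ T ∧ p.2 - p.1 ≤ r}

theorem exists_isRDEFlow [FiniteDimensional ℝ E] (hα : 1 / 3 < α) (hα' : α ≤ 1 / 2)
    (hT : 0 ≤ T) (hZ : IsRoughPath α T Z ZZ) (hV : CB 4 (fun _ : Unit => V))
    (hb : CB 2 (fun _ : Unit => b)) :
    ∃ C Φ, IsRDEFlow α T C Z ZZ b V Φ := by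
  have hα0 : 0 < α := by linarith
  obtain ⟨h₀, C, D, Φ, h00, hC, hrefl, hcomp, hdisp, hshort⟩ :=
    exists_flow_short hα hα' hZ hV hb
  obtain ⟨Cz, hCz, hz⟩ := hZ.bounds
  obtain ⟨Cd, hCd, hd⟩ := hV.fderiv.bounded
  obtain ⟨Cv, hCv, hv⟩ := hV.bounded
  obtain ⟨Cg, hCg, hg⟩ := (CB.gam hV.of_succ hV).bounded
  obtain ⟨Cb, hCb, hb0⟩ := hb.bounded
  set τ := T ^ α with hτ
  have hτ0 : 0 ≤ τ := Real.rpow_nonneg hT _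
  have hle : ∀ s t, 0 ≤ s → s ≤ t → t ≤ T → 0 ≤ (t - s) ^ α ∧ (t - s) ^ α ≤ τ :=
    fun s t hs hst htT => ⟨Real.rpow_nonneg (by linarith) _,
      Real.rpow_le_rpow (by linarith) (by linarith) hα0.le⟩
  have hzb : ∀ s t, 0 ≤ s → s ≤ t → t ≤ T → ‖Z t - Z s‖ ≤ Cz * τ := fun s t hs hst htT =>
    (hz s t hs hst htT).1.trans (by gcongr; exact (hle s t hs hst htT).2)
  have hflip : ∀ s t, 0 ≤ s → s ≤ t → t ≤ T → ∀ x,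
      ‖(fderiv ℝ V x).flip (Z t - Z s)‖ ≤ Cd * (Cz * τ) := fun s t hs hst htT x => by
    refine ((fderiv ℝ V x).flip.le_opNorm _).trans ?_
    rw [ContinuousLinearMap.opNorm_flip]
    gcongr
    · exact hd () x
    · exact hzb s t hs hst htT
  have hbase : (∀ p : TimePair T h₀, Differentiable ℝ (Φ p.1.1 p.1.2)) ∧
      CB 1 (fun (p : TimePair T h₀) x => fderiv ℝ (Φ p.1.1 p.1.2) x) := by
    have hs := fun p : TimePair T h₀ => hshort p.1.1 p.1.2 p.2.1 p.2.2.1 p.2.2.2.1 p.2.2.2.2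
    have hp := fun p : TimePair T h₀ => hle p.1.1 p.1.2 p.2.1 p.2.2.1 p.2.2.2.1
    refine ⟨fun p => (hs p).2.1, ⟨C * τ ^ 2 + (1 + Cd * (Cz * τ)), fun p x => ?_⟩,
      fun p => (hs p).2.2.1, CB.zero_intro (C := C * τ) (D := C) (fun p x => ?_) fun p x y => ?_⟩
    · have e : fderiv ℝ (Φ p.1.1 p.1.2) x = (fderiv ℝ (Φ p.1.1 p.1.2) x
          - ContinuousLinearMap.id ℝ E - (fderiv ℝ V x).flip (Z p.1.2 - Z p.1.1))
          + (ContinuousLinearMap.id ℝ E + (fderiv ℝ V x).flip (Z p.1.2 - Z p.1.1)) := by abel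
      beta_reduce
      rw [e]
      refine norm_add_le_of_le (((hs p).2.2.2.1 x).trans ?_)
        (norm_add_le_of_le ContinuousLinearMap.norm_id_le (hflip _ _ p.2.1 p.2.2.1 p.2.2.2.1 x))
      have := hp p
      gcongr
      · exact this.1
      · exact this.2
    · refine ((hs p).2.2.2.2.1 x).trans ?_
      gcongr
      exact (hp p).2
    · exact (hs p).2.2.2.2.2 x y
  -- Indexing by pairs of times makes `CB` carry the uniformity in s and t; the chain rule then
  -- propagates the regularity by one window. Only the derivatives form a bounded family, not the
  -- flow maps.
  have hlong : ∀ n : ℕ, (∀ p : TimePair T (n * h₀), Differentiable ℝ (Φ p.1.1 p.1.2)) ∧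
      CB 1 (fun (p : TimePair T (n * h₀)) x => fderiv ℝ (Φ p.1.1 p.1.2) x) := by
    intro n
    induction n with
    | zero =>
      let e : TimePair T ((0 : ℕ) * h₀) → TimePair T h₀ := fun p =>
        ⟨p.1, p.2.1, p.2.2.1, p.2.2.2.1, p.2.2.2.2.trans (by simpa using h00.le)⟩
      exact ⟨fun p => hbase.1 (e p), hbase.2.reindex e⟩
    | succ n ih =>
      let u : TimePair T ((n + 1 : ℕ) * h₀) → ℝ := fun p => max p.1.1 (p.1.2 - h₀)
      have h1 : ∀ p, p.1.1 ≤ u p := fun p => le_max_left _ _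
      have h2 : ∀ p, u p ≤ p.1.2 := fun p => max_le p.2.2.1 (by linarith)
      let e₁ : TimePair T ((n + 1 : ℕ) * h₀) → TimePair T (n * h₀) := fun p =>
        ⟨(p.1.1, u p), p.2.1, h1 p, (h2 p).trans p.2.2.2.1, by
          have h3 := p.2.2.2.2
          push_cast at h3
          have : u p ≤ p.1.1 + n * h₀ := max_le (by
            have := mul_nonneg n.cast_nonneg h00.le; linarith) (by linarith)
          simpa using by linarith⟩
      let e₂ : TimePair T ((n + 1 : ℕ) * h₀) → TimePair T h₀ := fun p =>
        ⟨(u p, p.1.2), p.2.1.trans (h1 p), h2 p, p.2.2.2.1, by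
          have : p.1.2 - h₀ ≤ u p := le_max_right _ _
          simpa using by linarith⟩
      have hc : ∀ p : TimePair T ((n + 1 : ℕ) * h₀), Φ p.1.1 p.1.2
          = fun x => Φ (e₂ p).1.1 (e₂ p).1.2 (Φ (e₁ p).1.1 (e₁ p).1.2 x) := fun p =>
        funext fun x => hcomp _ _ _ p.2.1 (h1 p) (h2 p) p.2.2.2.1 x
      have d1 := fun p => ih.1 (e₁ p)
      have d2 := fun p => hbase.1 (e₂ p)
      refine ⟨fun p => by rw [hc p]; exact (d2 p).comp (d1 p), ?_⟩
      have e : (fun (p : TimePair T ((n + 1 : ℕ) * h₀)) x => fderiv ℝ (Φ p.1.1 p.1.2) x)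
          = fun p x => ContinuousLinearMap.compL ℝ E E E
            (fderiv ℝ (Φ (e₂ p).1.1 (e₂ p).1.2) (Φ (e₁ p).1.1 (e₁ p).1.2 x))
            (fderiv ℝ (Φ (e₁ p).1.1 (e₁ p).1.2) x) := by
        funext p x
        rw [hc p]
        exact ((d2 p _).hasFDerivAt.comp x (d1 p x).hasFDerivAt).fderiv
      rw [e]
      exact CB.bilin _ ((hbase.2.reindex e₂).comp d1 (ih.2.of_succ.reindex e₁)) (ih.2.reindex e₁)
  obtain ⟨n, hn⟩ := exists_nat_ge (T / h₀)
  rw [div_le_iff₀ h00] at hn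
  obtain ⟨k1, k2⟩ := hlong n
  obtain ⟨M₁, hM₁, b1⟩ := k2.bounded
  obtain ⟨M₂, hM₂, b2⟩ := k2.fderiv.bounded
  obtain ⟨M₃, hM₃, b3⟩ := k2.fderiv.lipschitz
  have pt : ∀ s t, 0 ≤ s → s ≤ t → t ≤ T → ∃ p : TimePair T (n * h₀), p.1 = (s, t) :=
    fun s t hs hst htT => ⟨⟨(s, t), hs, hst, htT, by simpa using by linarith⟩, rfl⟩
  have hη : 0 < h₀ ^ α := Real.rpow_pos_of_pos h00 _
  have hDn : 0 ≤ D n := (norm_nonneg _).trans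
    (hdisp n 0 0 le_rfl le_rfl hT (by simpa using mul_nonneg n.cast_nonneg h00.le) 0)
  set R := Cv * (Cz * τ) + Cz * τ ^ 2 * Cg + T * Cb with hR
  have hR0 : 0 ≤ R := by positivity
  set C₃ := C + (D n + R) / (h₀ ^ α) ^ 3 with hC₃
  set C₂ := C + (M₁ + 1 + Cd * (Cz * τ)) / (h₀ ^ α) ^ 2 with hC₂
  set C₁ := C + M₂ / (h₀ ^ α) ^ 1 with hC₁
  have c3 : 0 ≤ C₃ := by positivity
  have c2 : 0 ≤ C₂ := by positivity
  have c1 : 0 ≤ C₁ := by positivity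
  refine ⟨C₃ + C₂ + C₁ + M₃, Φ, by positivity, hrefl, hcomp, ?_, ?_, ?_, ?_, ?_, ?_⟩
  · intro s t hs hst htT x
    have hH := hle s t hs hst htT
    refine (le_mul_pow_of_dichotomy (M := D n + R) hα0 h00 (by linarith : 0 ≤ t - s)
      (by positivity) hC 3 (fun h => (hshort s t hs hst htT h).1 x) ?_).trans
      (mul_le_mul_of_nonneg_right (by rw [← hC₃]; linarith) (pow_nonneg hH.1 3))
    have e : Φ s t x - rdeStep Z ZZ V b s t x = (Φ s t x - x)
        - (V x (Z t - Z s) + contract (Gam V V x) (ZZ s t) + (t - s) • b x) := by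
      simp only [rdeStep, roughInc]; abel
    rw [e]
    refine norm_sub_le_of_le (hdisp n s t hs hst htT (by linarith) x)
      (norm_add_le_of_le (norm_add_le_of_le ?_ ?_) ?_)
    · exact (V x).le_of_opNorm_le_of_le (hv () x) (hzb s t hs hst htT)
    · refine ((hz s t hs hst htT).2 _ _).trans ?_
      have := hH.1
      gcongr
      · exact hH.2
      · exact hg () x
    · rw [norm_smul, Real.norm_of_nonneg (by linarith)]
      gcongr
      · linarith
      · exact hb0 () x
  · intro s t hs hst htT
    obtain ⟨p, hp⟩ := pt s t hs hst htT
    have := k1 p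
    rwa [hp] at this
  · intro s t hs hst htT
    obtain ⟨p, hp⟩ := pt s t hs hst htT
    have := k2.differentiable p
    rwa [hp] at this
  · intro s t hs hst htT x
    have hH := hle s t hs hst htT
    obtain ⟨p, hp⟩ := pt s t hs hst htT
    have hb1 := b1 p x
    rw [hp] at hb1
    refine (le_mul_pow_of_dichotomy (M := M₁ + 1 + Cd * (Cz * τ)) hα0 h00
      (by linarith : 0 ≤ t - s) (by positivity) hC 2
      (fun h => (hshort s t hs hst htT h).2.2.2.1 x) ?_).trans
      (mul_le_mul_of_nonneg_right (by rw [← hC₂]; linarith) (pow_nonneg hH.1 2))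
    exact norm_sub_le_of_le (norm_sub_le_of_le hb1 ContinuousLinearMap.norm_id_le)
      (hflip s t hs hst htT x)
  · intro s t hs hst htT x
    have hH := hle s t hs hst htT
    obtain ⟨p, hp⟩ := pt s t hs hst htT
    have hb2 := b2 p x
    simp only [hp] at hb2
    have := le_mul_pow_of_dichotomy (M := M₂) hα0 h00 (by linarith : 0 ≤ t - s) hM₂ hC 1
      (fun h => by simpa using (hshort s t hs hst htT h).2.2.2.2.1 x) hb2
    rw [← hC₁, pow_one] at this
    exact this.trans (mul_le_mul_of_nonneg_right (by linarith) hH.1)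
  · intro s t hs hst htT x y
    obtain ⟨p, hp⟩ := pt s t hs hst htT
    have hb3 := b3 p x y
    simp only [hp] at hb3
    exact hb3.trans (mul_le_mul_of_nonneg_right (by linarith) (norm_nonneg _))

end LongFlow

/-! ### Partitions -/

theorem rpow_cube_eq_mul {α h : ℝ} (hα : 1 / 3 < α) (h0 : 0 ≤ h) :
    (h ^ α) ^ 3 = h * h ^ (3 * α - 1) := by
  rw [← Real.rpow_mul_natCast h0, ← Real.rpow_one_add' h0 (by linarith)]
  congr 1
  push_cast
  ring

/-- Each term is the length of its interval times that length to the power 3α - 1 > 0, which is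
small with the mesh. -/
theorem exists_mesh_sum_lt {α C L ε : ℝ} (hα : 1 / 3 < α) (hL : 0 ≤ L) (hε : 0 < ε) :
    ∃ δ > 0, ∀ (n : ℕ) (p : ℕ → ℝ), Monotone p → (∀ i < n, p (i + 1) - p i ≤ δ) →
      p n - p 0 = L → ∑ i ∈ Finset.range n, C * ((p (i + 1) - p i) ^ α) ^ 3 < ε := by
  obtain ⟨δ, hδ, _, h⟩ := exists_pos_forall_mul_rpow_le (α := 3 * α - 1) (by linarith) C
    (e := ε / (L + 1)) (by positivity)
  refine ⟨δ, hδ, fun n p hp hm hs => ?_⟩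
  calc ∑ i ∈ Finset.range n, C * ((p (i + 1) - p i) ^ α) ^ 3
      ≤ ∑ i ∈ Finset.range n, (p (i + 1) - p i) * (ε / (L + 1)) := by
        refine Finset.sum_le_sum fun i hi => ?_
        have h0 : 0 ≤ p (i + 1) - p i := sub_nonneg.2 (hp i.le_succ)
        rw [rpow_cube_eq_mul hα h0]
        calc C * ((p (i + 1) - p i) * (p (i + 1) - p i) ^ (3 * α - 1))
            = (p (i + 1) - p i) * (C * (p (i + 1) - p i) ^ (3 * α - 1)) := by ring
          _ ≤ _ := by gcongr; exact h _ h0 (hm i (Finset.mem_range.1 hi))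
    _ = L * (ε / (L + 1)) := by rw [← Finset.sum_mul, Finset.sum_range_sub, hs]
    _ < ε := by
        rw [mul_div_assoc', div_lt_iff₀ (by positivity)]
        nlinarith

theorem monotone_uniform {a c : ℝ} (hc : 0 ≤ c) : Monotone fun i : ℕ => a + i * c :=
  fun i j h => by
    have : (i : ℝ) ≤ j := Nat.cast_le.2 h
    simp only
    gcongr

/-- A path which is Hölder continuous of exponent `3 α > 1` is constant. -/
theorem eq_of_norm_sub_le_cube {F : Type} [NormedAddCommGroup F] {α C a b : ℝ} {D : ℝ → F}
    (hα : 1 / 3 < α) (hab : a ≤ b)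
    (h : ∀ s t, a ≤ s → s ≤ t → t ≤ b → ‖D t - D s‖ ≤ C * ((t - s) ^ α) ^ 3) : D b = D a := by
  refine eq_of_forall_dist_le fun ε hε => ?_
  obtain ⟨δ, hδ, H⟩ := exists_mesh_sum_lt (C := C) hα (sub_nonneg.2 hab) hε
  obtain ⟨n, hn⟩ := exists_nat_gt ((b - a) / δ)
  have hn0 : (0 : ℝ) < n := (div_nonneg (sub_nonneg.2 hab) hδ.le).trans_lt hn
  have hc : 0 ≤ (b - a) / n := div_nonneg (sub_nonneg.2 hab) hn0.le
  set p : ℕ → ℝ := fun i => a + i * ((b - a) / n) with hp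
  have hmono : Monotone p := monotone_uniform hc
  have p0 : p 0 = a := by simp [hp]
  have pn : p n = b := by simp only [hp]; field_simp; ring
  have hH := H n p hmono (fun i _ => by
    simp only [hp]
    push_cast
    rw [div_lt_iff₀ hδ, mul_comm, ← div_lt_iff₀ hn0] at hn
    linarith) (by rw [p0, pn])
  rw [dist_eq_norm, ← pn, ← p0, ← Finset.sum_range_sub (fun i => D (p i))]
  refine (norm_sum_le_of_le _ fun i hi => ?_).trans hH.le
  refine h _ _ (p0 ▸ hmono (Nat.zero_le i)) (hmono i.le_succ) ?_
  rw [← pn]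
  exact hmono (Finset.mem_range.1 hi)

/-- The sum of `Ξ` over the partition of `[s, t]` into `2 ^ n` intervals of equal length. -/
noncomputable def dyadicSum {F : Type} [AddCommMonoid F] (Ξ : ℝ → ℝ → F) (n : ℕ) (s t : ℝ) : F :=
  ∑ j ∈ Finset.range (2 ^ n), Ξ (s + j * ((t - s) / 2 ^ n)) (s + (j + 1 : ℕ) * ((t - s) / 2 ^ n))

theorem dyadicSum_succ {F : Type} [AddCommMonoid F] (Ξ : ℝ → ℝ → F) (n : ℕ) (s t : ℝ) :
    dyadicSum Ξ (n + 1) s t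
      = dyadicSum Ξ n s ((s + t) / 2) + dyadicSum Ξ n ((s + t) / 2) t := by
  have h2 : (2 : ℝ) ^ n ≠ 0 := by positivity
  rw [dyadicSum, pow_succ, mul_two, Finset.sum_range_add]
  refine congrArg₂ _ (Finset.sum_congr rfl fun j _ => ?_) (Finset.sum_congr rfl fun j _ => ?_)
  · congr 1 <;> · field_simp; ring
  · congr 1 <;> · push_cast; field_simp; ring

/-- With r = 2^{1-3α}, halving turns a bound K h^{3α} into (rK + C) h^{3α}, and K = C / (1 - r) is
the fixed point; hence the bound is uniform in n. -/
theorem norm_dyadicSum_sub_le {F : Type} [NormedAddCommGroup F] {Ξ : ℝ → ℝ → F} {α C a b : ℝ}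
    (hα : 1 / 3 < α) (hΞ : ∀ s u t, a ≤ s → s ≤ u → u ≤ t → t ≤ b →
      ‖Ξ s u + Ξ u t - Ξ s t‖ ≤ C * ((t - s) ^ α) ^ 3) (n : ℕ) :
    ∀ s t, a ≤ s → s ≤ t → t ≤ b →
      ‖dyadicSum Ξ n s t - Ξ s t‖ ≤ C / (1 - 2 ^ (1 - 3 * α)) * ((t - s) ^ α) ^ 3 := by
  have hr := two_rpow_lt_one hα
  set r : ℝ := 2 ^ (1 - 3 * α) with hr'
  have e1 : C = C / (1 - r) * (1 - r) := by field_simp [(sub_pos.2 hr).ne']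
  induction n with
  | zero =>
    intro s t hs hst ht
    have := hΞ s s t hs le_rfl hst ht
    have h1 := hΞ s s s hs le_rfl le_rfl (hst.trans ht)
    have h0 : 0 ≤ C * ((t - s) ^ α) ^ 3 := (norm_nonneg _).trans this
    simp only [dyadicSum, pow_zero, Finset.range_one, Finset.sum_singleton, Nat.cast_zero, zero_mul,
      add_zero, zero_add, Nat.cast_one, div_one, one_mul, add_sub_cancel, sub_self, norm_zero]
    rw [div_mul_eq_mul_div]
    exact div_nonneg h0 (by linarith)
  | succ n ih =>
    intro s t hs hst ht
    set u := (s + t) / 2 with hu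
    have hsu : s ≤ u := by linarith
    have hut : u ≤ t := by linarith
    have h1 := ih s u hs hsu (hut.trans ht)
    have h2 := ih u t (hs.trans hsu) hut ht
    have h3 := hΞ s u t hs hsu hut ht
    have e2 : u - s = (t - s) / 2 := by rw [hu]; ring
    have e3 : t - u = (t - s) / 2 := by rw [hu]; ring
    have e4 := half_rpow_cube (α := α) (sub_nonneg.2 hst)
    rw [e2] at h1
    rw [e3] at h2
    have e5 : dyadicSum Ξ (n + 1) s t - Ξ s t = (dyadicSum Ξ n s u - Ξ s u)
        + (dyadicSum Ξ n u t - Ξ u t) + (Ξ s u + Ξ u t - Ξ s t) := by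
      rw [dyadicSum_succ, ← hu]; abel
    rw [e5]
    refine (norm_add_le_of_le (norm_add_le_of_le h1 h2) h3).trans (le_of_eq ?_)
    rw [← hr'] at e4
    set K := C / (1 - r)
    rw [e1]
    linear_combination K * e4

/-- The uniform partition of `[r, s]` into `N` intervals, followed by that of `[s, t]`. -/
noncomputable def gluedPartition (r s t : ℝ) (N i : ℕ) : ℝ :=
  r + (min i N : ℕ) * ((s - r) / N) + (i - N : ℕ) * ((t - s) / N)

theorem monotone_gluedPartition {r s t : ℝ} (hrs : r ≤ s) (hst : s ≤ t) (N : ℕ) :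
    Monotone (gluedPartition r s t N) := by
  intro i j h
  have h1 : 0 ≤ (s - r) / N := div_nonneg (by linarith) N.cast_nonneg
  have h2 : 0 ≤ (t - s) / N := div_nonneg (by linarith) N.cast_nonneg
  unfold gluedPartition
  gcongr

theorem gluedPartition_left {r s t : ℝ} {N i : ℕ} (h : i ≤ N) :
    gluedPartition r s t N i = r + i * ((s - r) / N) := by
  simp [gluedPartition, h]

theorem gluedPartition_right {r s t : ℝ} {N i : ℕ} (hN : N ≠ 0) :
    gluedPartition r s t N (N + i) = s + i * ((t - s) / N) := by
  have : (N : ℝ) ≠ 0 := Nat.cast_ne_zero.2 hN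
  simp only [gluedPartition, Nat.le_add_right, inf_of_le_right, Nat.add_sub_cancel_left]
  field_simp
  ring

theorem gluedPartition_succ_sub_le {r s t δ : ℝ} {N : ℕ} (hN : N ≠ 0) (h1 : (s - r) / N ≤ δ)
    (h2 : (t - s) / N ≤ δ) (i : ℕ) :
    gluedPartition r s t N (i + 1) - gluedPartition r s t N i ≤ δ := by
  rcases lt_or_ge i N with h | h
  · rw [gluedPartition_left h, gluedPartition_left h.le]
    push_cast
    linarith
  · obtain ⟨j, rfl⟩ := Nat.exists_eq_add_of_le h
    rw [add_assoc, gluedPartition_right hN, gluedPartition_right hN]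
    push_cast
    linarith

/-! ### Rough integrals and differential equations -/

section RoughIntegral

variable {m : ℕ} {α T : ℝ} {Z : ℝ → EuclideanSpace ℝ (Fin m)}
  {ZZ : ℝ → ℝ → Matrix (Fin m) (Fin m) ℝ} {E : Type} [NormedAddCommGroup E] [NormedSpace ℝ E]
  {V : E → EuclideanSpace ℝ (Fin m) →L[ℝ] E} {b : E → E}

/-- The sewing estimate for the increments of a rough integral. -/
theorem HasRoughIntegral.norm_sub_le {Y : ℝ → EuclideanSpace ℝ (Fin m) →L[ℝ] E}
    {Y' : ℝ → EuclideanSpace ℝ (Fin m) →L[ℝ] EuclideanSpace ℝ (Fin m) →L[ℝ] E} {I : ℝ → E}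
    {C r : ℝ} (hα : 1 / 3 < α)
    (hI : ∀ t ∈ Icc r T, HasRoughIntegral Z ZZ Y Y' r t (I t))
    (hY : ∀ s u t, r ≤ s → s ≤ u → u ≤ t → t ≤ T →
      ‖(Y s (Z u - Z s) + contract (Y' s) (ZZ s u)) + (Y u (Z t - Z u) + contract (Y' u) (ZZ u t))
        - (Y s (Z t - Z s) + contract (Y' s) (ZZ s t))‖ ≤ C * ((t - s) ^ α) ^ 3) {s t : ℝ}
    (hrs : r ≤ s) (hst : s ≤ t) (htT : t ≤ T) :
    ‖I t - I s - (Y s (Z t - Z s) + contract (Y' s) (ZZ s t))‖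
      ≤ C / (1 - 2 ^ (1 - 3 * α)) * ((t - s) ^ α) ^ 3 := by
  set Ξ : ℝ → ℝ → E := fun s t => Y s (Z t - Z s) + contract (Y' s) (ZZ s t) with hΞ
  refine le_of_forall_pos_le_add fun ε hε => ?_
  obtain ⟨δ₁, h1, H1⟩ := hI s ⟨hrs, hst.trans htT⟩ (ε / 2) (by positivity)
  obtain ⟨δ₂, h2, H2⟩ := hI t ⟨hrs.trans hst, htT⟩ (ε / 2) (by positivity)
  set δ := min δ₁ δ₂
  have hδ : 0 < δ := lt_min h1 h2
  obtain ⟨n, hn⟩ := pow_unbounded_of_one_lt ((T - r) / δ) one_lt_two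
  have hN : 2 ^ n ≠ 0 := by positivity
  have hN0 : (0 : ℝ) < (2 ^ n : ℕ) := by positivity
  have hN1 : T - r ≤ δ * (2 ^ n : ℕ) := by
    rw [div_lt_iff₀ hδ] at hn
    push_cast
    linarith
  have m1 : (s - r) / (2 ^ n : ℕ) ≤ δ := by rw [div_le_iff₀ hN0]; linarith
  have m2 : (t - s) / (2 ^ n : ℕ) ≤ δ := by rw [div_le_iff₀ hN0]; linarith
  -- The same partition approximates both I(s) and I(t), so the difference of its two Riemann sums
  -- is the dyadic sum over [s, t].
  set p := gluedPartition r s t (2 ^ n) with hp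
  have hmesh := gluedPartition_succ_sub_le hN m1 m2
  have hmono := monotone_gluedPartition hrs hst (2 ^ n)
  rw [← hp] at hmesh hmono
  have p0 : p 0 = r := by rw [hp, gluedPartition_left (Nat.zero_le _)]; simp
  have p1 : p (2 ^ n) = s := by
    rw [hp, gluedPartition_left le_rfl]; field_simp; ring
  have p2 : p (2 ^ n + 2 ^ n) = t := by
    rw [hp, gluedPartition_right hN]; field_simp; ring
  have k1 := H1 _ p hmono p0 p1 fun i _ => (hmesh i).trans (min_le_left _ _)
  have k2 := H2 _ p hmono p0 p2 fun i _ => (hmesh i).trans (min_le_right _ _)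
  rw [Finset.sum_range_add] at k2
  have e1 : ∑ i ∈ Finset.range (2 ^ n),
      (Y (p (2 ^ n + i)) (Z (p (2 ^ n + i + 1)) - Z (p (2 ^ n + i)))
        + contract (Y' (p (2 ^ n + i))) (ZZ (p (2 ^ n + i)) (p (2 ^ n + i + 1))))
      = dyadicSum Ξ n s t := by
    refine Finset.sum_congr rfl fun i _ => ?_
    rw [add_assoc, hp, gluedPartition_right hN, gluedPartition_right hN]
    simp only [hΞ, Nat.cast_pow, Nat.cast_ofNat]
  rw [e1] at k2
  have k3 := norm_dyadicSum_sub_le (Ξ := Ξ) (a := r) (b := T) hα hY n s t hrs hst htT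
  set S := ∑ i ∈ Finset.range (2 ^ n), (Y (p i) (Z (p (i + 1)) - Z (p i))
        + contract (Y' (p i)) (ZZ (p i) (p (i + 1))))
  have e2 : I t - I s - Ξ s t = (dyadicSum Ξ n s t - Ξ s t) + ((S - I s)
      - (S + dyadicSum Ξ n s t - I t)) := by abel
  rw [e2]
  refine (norm_add_le_of_le k3 (norm_sub_le_of_le k1.le k2.le)).trans (le_of_eq ?_)
  ring

theorem continuousOn_of_norm_sub_le_rpow {F : Type} [NormedAddCommGroup F] {Y : ℝ → F} {C r : ℝ}
    (hα : 0 < α)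
    (hY : ∀ s t, r ≤ s → s ≤ t → t ≤ T → ‖Y t - Y s‖ ≤ C * (t - s) ^ α) :
    ContinuousOn Y (Icc r T) := by
  intro s hs
  refine tendsto_iff_norm_sub_tendsto_zero.2 (squeeze_zero' (g := fun t => C * |t - s| ^ α)
    (Filter.Eventually.of_forall fun _ => norm_nonneg _) ?_ ?_)
  · filter_upwards [self_mem_nhdsWithin] with t ht
    rcases le_total s t with h | h
    · rw [abs_of_nonneg (by linarith)]
      exact hY s t hs.1 h ht.2
    · rw [norm_sub_rev, abs_of_nonpos (by linarith), neg_sub]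
      exact hY t s ht.1 h hs.2
  · have hc : Continuous fun t => C * |t - s| ^ α := by
      have := (Real.continuous_rpow_const (q := α) hα.le).comp ((continuous_id.sub
        (continuous_const (y := s))).abs)
      exact continuous_const.mul this
    have := hc.tendsto s
    simp only [sub_self, abs_zero, Real.zero_rpow hα.ne', mul_zero] at this
    exact this.mono_left nhdsWithin_le_nhds

/-- The error is at most a multiple of h · h^α, and h is at most a multiple of h^{2α} on a bounded
interval because α ≤ 1/2. -/
theorem norm_integral_sub_smul_le [FiniteDimensional ℝ E] (hα : 1 / 3 < α) (hα' : α ≤ 1 / 2)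
    (hb : CB 0 (fun _ : Unit => b)) {Y : ℝ → E} {C r : ℝ}
    (hY : ∀ s t, r ≤ s → s ≤ t → t ≤ T → ‖Y t - Y s‖ ≤ C * (t - s) ^ α) :
    ∃ D, 0 ≤ D ∧ ∀ s t, r ≤ s → s ≤ t → t ≤ T →
      IntervalIntegrable (fun u => b (Y u)) MeasureTheory.volume s t ∧
      ‖(∫ u in s..t, b (Y u)) - (t - s) • b (Y s)‖ ≤ D * ((t - s) ^ α) ^ 3 := by
  have := FiniteDimensional.complete ℝ E
  have hα0 : 0 < α := by linarith
  obtain ⟨L, hL0, hL⟩ := hb.lipschitz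
  -- The second factor bounds h / h^{2α} on [r, T]; its form is that of `le_mul_pow_of_dichotomy`
  -- with threshold 1.
  refine ⟨|L * C| * (1 + |T - r| / (1 ^ α) ^ 2), by positivity, fun s t hrs hst htT => ?_⟩
  have hc : ContinuousOn (fun u => b (Y u)) (Icc r T) :=
    (hb.continuous ()).comp_continuousOn (continuousOn_of_norm_sub_le_rpow hα0 hY)
  have hi : IntervalIntegrable (fun u => b (Y u)) MeasureTheory.volume s t := by
    refine (hc.mono ?_).intervalIntegrable
    rw [uIcc_of_le hst]
    exact Icc_subset_Icc hrs htT
  refine ⟨hi, ?_⟩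
  have e : (∫ u in s..t, b (Y u)) - (t - s) • b (Y s) = ∫ u in s..t, (b (Y u) - b (Y s)) := by
    rw [intervalIntegral.integral_sub hi intervalIntegrable_const, intervalIntegral.integral_const]
  have hH : 0 ≤ (t - s) ^ α := Real.rpow_nonneg (by linarith) _
  have h1 : ‖∫ u in s..t, (b (Y u) - b (Y s))‖ ≤ |L * C| * (t - s) ^ α * |t - s| := by
    refine intervalIntegral.norm_integral_le_of_norm_le_const fun u hu => ?_
    rw [uIoc_of_le hst] at hu
    calc ‖b (Y u) - b (Y s)‖ ≤ L * (C * (u - s) ^ α) :=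
          (hL () _ _).trans (by gcongr; exact hY s u hrs hu.1.le (hu.2.trans htT))
      _ = (L * C) * (u - s) ^ α := by ring
      _ ≤ |L * C| * (t - s) ^ α := by
          gcongr
          · exact Real.rpow_nonneg (by linarith [hu.1]) _
          · exact le_abs_self _
          · linarith [hu.1]
          · exact hu.2
  have h2 : t - s ≤ (1 + |T - r| / (1 ^ α) ^ 2) * ((t - s) ^ α) ^ 2 := by
    refine le_mul_pow_of_dichotomy hα0 one_pos (by linarith) (abs_nonneg _) zero_le_one 2
      (fun h => ?_) ((by linarith : t - s ≤ T - r).trans (le_abs_self _))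
    rw [one_mul]
    exact le_rpow_sq hα' (by linarith) h
  rw [e]
  refine h1.trans ?_
  rw [abs_of_nonneg (sub_nonneg.2 hst)]
  calc |L * C| * (t - s) ^ α * (t - s)
      ≤ |L * C| * (t - s) ^ α * ((1 + |T - r| / (1 ^ α) ^ 2) * ((t - s) ^ α) ^ 2) := by gcongr
    _ = _ := by ring

/-! ### The integral equation and the local Davie expansion -/

/-- A path which is locally described by the Davie scheme. -/
def IsDavieSolution (α T r : ℝ) (Z : ℝ → EuclideanSpace ℝ (Fin m))
    (ZZ : ℝ → ℝ → Matrix (Fin m) (Fin m) ℝ) (b : E → E)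
    (V : E → EuclideanSpace ℝ (Fin m) →L[ℝ] E) (Y : ℝ → E) : Prop :=
  ∃ C, 0 ≤ C ∧ ∀ s t, r ≤ s → s ≤ t → t ≤ T →
    ‖Y t - rdeStep Z ZZ V b s t (Y s)‖ ≤ C * ((t - s) ^ α) ^ 3

/-- Chen's relation and the controlledness of Y make the compensated summands additive up to order
three, so the sewing estimate localises the rough integral; the drift integral is treated
separately. -/
theorem IsRDESolution.isDavieSolution [FiniteDimensional ℝ E] (hα : 1 / 3 < α) (hα' : α ≤ 1 / 2)
    (hZ : IsRoughPath α T Z ZZ) (hV : CB 2 (fun _ : Unit => V)) (hb : CB 0 (fun _ : Unit => b))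
    {r : ℝ} (hr : 0 ≤ r) {x : E} {Y : ℝ → E} (hY : IsRDESolution α T Z ZZ b V r x Y) :
    IsDavieSolution α T r Z ZZ b V Y := by
  have hα0 : 0 < α := by linarith
  obtain ⟨A₀, hA₀, hz⟩ := hZ.bounds
  obtain ⟨A₁, hA₁, v0⟩ := hV.bounded
  obtain ⟨A₂, hA₂, v1⟩ := hV.fderiv.bounded
  obtain ⟨A₃, hA₃, v2⟩ := hV.of_succ.taylor_one
  obtain ⟨A₄, hA₄, v3⟩ := (CB.gam hV.of_succ hV).lipschitz
  obtain ⟨K', hK'⟩ := hY.controlled.remainder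
  set K := |K'| with hK
  have hsq : ∀ s t : ℝ, s ≤ t → (t - s) ^ (2 * α) = ((t - s) ^ α) ^ 2 := fun s t h => by
    rw [← Real.rpow_mul_natCast (sub_nonneg.2 h), mul_comm]; rfl
  have hrem : ∀ s t, r ≤ s → s ≤ t → t ≤ T →
      ‖Y t - Y s - V (Y s) (Z t - Z s)‖ ≤ K * ((t - s) ^ α) ^ 2 := fun s t h1 h2 h3 => by
    have := hK' s t h1 h2 h3
    rw [hsq s t h2] at this
    exact this.trans (by gcongr; exact le_abs_self _)
  set τ := (T - r) ^ α with hτ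
  have hle : ∀ s t, r ≤ s → s ≤ t → t ≤ T → 0 ≤ (t - s) ^ α ∧ (t - s) ^ α ≤ τ :=
    fun s t h1 h2 h3 => ⟨Real.rpow_nonneg (by linarith) _,
      Real.rpow_le_rpow (by linarith) (by linarith) hα0.le⟩
  have hinc : ∀ s t, r ≤ s → s ≤ t → t ≤ T →
      ‖Y t - Y s‖ ≤ (K * |τ| + A₁ * A₀) * (t - s) ^ α := fun s t h1 h2 h3 => by
    have hH := hle s t h1 h2 h3
    have e : Y t - Y s = (Y t - Y s - V (Y s) (Z t - Z s)) + V (Y s) (Z t - Z s) := by abel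
    rw [e]
    refine (norm_add_le_of_le (hrem s t h1 h2 h3) ((V (Y s)).le_of_opNorm_le_of_le (v0 () _)
      (hz s t (hr.trans h1) h2 h3).1)).trans ?_
    have : K * ((t - s) ^ α) ^ 2 ≤ K * (|τ| * (t - s) ^ α) := by
      rw [pow_two]
      gcongr
      exact hH.2.trans (le_abs_self _)
    linarith
  set L := K * |τ| + A₁ * A₀ with hL
  have hL0 : 0 ≤ L := by positivity
  obtain ⟨D, hD, hint⟩ := norm_integral_sub_smul_le hα hα' hb hinc
  have hdef : ∀ s u t, r ≤ s → s ≤ u → u ≤ t → t ≤ T →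
      ‖(V (Y s) (Z u - Z s) + contract (Gam V V (Y s)) (ZZ s u))
        + (V (Y u) (Z t - Z u) + contract (Gam V V (Y u)) (ZZ u t))
        - (V (Y s) (Z t - Z s) + contract (Gam V V (Y s)) (ZZ s t))‖
        ≤ ((A₃ * L ^ 2 + A₂ * K) * A₀ + A₀ * (A₄ * L)) * ((t - s) ^ α) ^ 3 := by
    intro s u t hrs hsu hut htT
    have hs : 0 ≤ s := hr.trans hrs
    have e1 : (V (Y s) (Z u - Z s) + contract (Gam V V (Y s)) (ZZ s u))
        + (V (Y u) (Z t - Z u) + contract (Gam V V (Y u)) (ZZ u t))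
        - (V (Y s) (Z t - Z s) + contract (Gam V V (Y s)) (ZZ s t))
        = ((V (Y u) - V (Y s) - fderiv ℝ V (Y s) (Y u - Y s))
          + fderiv ℝ V (Y s) (Y u - Y s - V (Y s) (Z u - Z s))) (Z t - Z u)
          + contract (Gam V V (Y u) - Gam V V (Y s)) (ZZ u t) := by
      have e2 : Z t - Z s = (Z u - Z s) + (Z t - Z u) := by abel
      rw [hZ.contract_chen hs hsu hut htT, contract_sub, e2]
      simp only [map_add, map_sub, add_apply, sub_apply, Gam,
        ContinuousLinearMap.comp_apply]
      abel
    have hsu' := hinc s u hrs hsu (hut.trans htT)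
    have q1 : (u - s) ^ α ≤ (t - s) ^ α := Real.rpow_le_rpow (by linarith) (by linarith) hα0.le
    have q2 : (t - u) ^ α ≤ (t - s) ^ α := Real.rpow_le_rpow (by linarith) (by linarith) hα0.le
    have q0 : 0 ≤ (u - s) ^ α := Real.rpow_nonneg (by linarith) _
    have q3 : 0 ≤ (t - u) ^ α := Real.rpow_nonneg (by linarith) _
    set H := (t - s) ^ α with hH
    have hH0 : 0 ≤ H := q0.trans q1
    have hb1 : ‖Y u - Y s‖ ≤ L * H := hsu'.trans (by gcongr)
    rw [e1]
    refine (norm_add_le_of_le (ContinuousLinearMap.le_of_opNorm_le_of_le _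
      (show ‖_ + _‖ ≤ A₃ * (L * H) ^ 2 + A₂ * (K * H ^ 2) from norm_add_le_of_le ?_ ?_)
      ((hz u t (by linarith) hut htT).1.trans (by gcongr : _ ≤ A₀ * H)))
      ((hz u t (by linarith) hut htT).2 _ _)).trans ?_
    · refine (v2 () _ _).trans ?_
      gcongr
    · refine ContinuousLinearMap.le_of_opNorm_le_of_le _ (v1 () _) ((hrem s u hrs hsu
        (hut.trans htT)).trans ?_)
      gcongr
    · have : A₀ * ((t - u) ^ α) ^ 2 * ‖Gam V V (Y u) - Gam V V (Y s)‖
          ≤ A₀ * H ^ 2 * (A₄ * (L * H)) := by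
        gcongr
        exact (v3 () _ _).trans (by gcongr)
      refine (add_le_add le_rfl this).trans (le_of_eq ?_)
      ring
  refine ⟨((A₃ * L ^ 2 + A₂ * K) * A₀ + A₀ * (A₄ * L)) / (1 - 2 ^ (1 - 3 * α)) + D, ?_,
    fun s t hrs hst htT => ?_⟩
  · have := sub_pos.2 (two_rpow_lt_one hα)
    positivity
  · have h1 := HasRoughIntegral.norm_sub_le hα hY.equation hdef hrs hst htT
    have h2 := (hint s t hrs hst htT).2
    have e3 : Y t - rdeStep Z ZZ V b s t (Y s)
        = ((Y t - x - ∫ u in r..t, b (Y u)) - (Y s - x - ∫ u in r..s, b (Y u))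
          - (V (Y s) (Z t - Z s) + contract (Gam V V (Y s)) (ZZ s t)))
          + ((∫ u in s..t, b (Y u)) - (t - s) • b (Y s)) := by
      rw [← intervalIntegral.integral_add_adjacent_intervals
        (hint r s le_rfl hrs (hst.trans htT)).1 (hint s t hrs hst htT).1, rdeStep, roughInc]
      abel
    rw [e3, add_mul]
    exact norm_add_le_of_le h1 h2

/-- The Davie errors sum to zero as the mesh shrinks, so the compensated sums converge to Y_t - Y_r
- ∫ b(Y): the existence of the rough integral is a conclusion, not a prerequisite. -/
theorem IsDavieSolution.isRDESolution [FiniteDimensional ℝ E] (hα : 1 / 3 < α) (hα' : α ≤ 1 / 2)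
    (hZ : IsRoughPath α T Z ZZ) (hV : CB 2 (fun _ : Unit => V)) (hb : CB 0 (fun _ : Unit => b))
    {r : ℝ} (hr : 0 ≤ r) {Y : ℝ → E} (hY : IsDavieSolution α T r Z ZZ b V Y) :
    IsRDESolution α T Z ZZ b V r (Y r) Y := by
  have hα0 : 0 < α := by linarith
  obtain ⟨A₀, hA₀, hz⟩ := hZ.bounds
  obtain ⟨A₁, hA₁, v0⟩ := hV.bounded
  obtain ⟨A₂, hA₂, v1⟩ := hV.lipschitz
  obtain ⟨A₃, hA₃, v2⟩ := (CB.gam hV.of_succ hV).bounded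
  obtain ⟨A₄, hA₄, v3⟩ := hb.bounded
  obtain ⟨K, hK, hstep⟩ := hY
  set τ := |T - r| ^ α with hτ
  have hτ0 : 0 ≤ τ := Real.rpow_nonneg (abs_nonneg _) _
  have hle : ∀ s t, r ≤ s → s ≤ t → t ≤ T → 0 ≤ (t - s) ^ α ∧ (t - s) ^ α ≤ τ :=
    fun s t h1 h2 h3 => ⟨Real.rpow_nonneg (by linarith) _,
      Real.rpow_le_rpow (by linarith) ((by linarith : t - s ≤ T - r).trans (le_abs_self _)) hα0.le⟩
  have hlin : ∀ s t, r ≤ s → s ≤ t → t ≤ T →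
      t - s ≤ (1 + |T - r| / (1 ^ α) ^ 2) * ((t - s) ^ α) ^ 2 := fun s t h1 h2 h3 => by
    refine le_mul_pow_of_dichotomy hα0 one_pos (by linarith) (abs_nonneg _) zero_le_one 2
      (fun h => ?_) ((by linarith : t - s ≤ T - r).trans (le_abs_self _))
    rw [one_mul]
    exact le_rpow_sq hα' (by linarith) h
  set Λ := 1 + |T - r| / (1 ^ α) ^ 2 with hΛ
  have hΛ0 : 0 ≤ Λ := by positivity
  set R := K * τ + A₀ * A₃ + Λ * A₄ with hR
  have hR0 : 0 ≤ R := by positivity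
  have hrem : ∀ s t, r ≤ s → s ≤ t → t ≤ T →
      ‖Y t - Y s - V (Y s) (Z t - Z s)‖ ≤ R * ((t - s) ^ α) ^ 2 := fun s t h1 h2 h3 => by
    have hH := hle s t h1 h2 h3
    have e : Y t - Y s - V (Y s) (Z t - Z s) = (Y t - rdeStep Z ZZ V b s t (Y s))
        + contract (Gam V V (Y s)) (ZZ s t) + (t - s) • b (Y s) := by
      rw [rdeStep, roughInc]; abel
    have k1 : K * ((t - s) ^ α) ^ 3 ≤ K * τ * ((t - s) ^ α) ^ 2 := by
      rw [pow_succ', mul_assoc]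
      have := hH.1
      gcongr
      exact hH.2
    have k2 : ‖contract (Gam V V (Y s)) (ZZ s t)‖ ≤ A₀ * A₃ * ((t - s) ^ α) ^ 2 := by
      refine ((hz s t (by linarith) h2 h3).2 _ _).trans ?_
      rw [mul_right_comm]
      gcongr
      exact v2 () _
    have k3 : ‖(t - s) • b (Y s)‖ ≤ Λ * A₄ * ((t - s) ^ α) ^ 2 := by
      rw [norm_smul, Real.norm_of_nonneg (by linarith), mul_right_comm]
      gcongr
      · exact hlin s t h1 h2 h3
      · exact v3 () _
    rw [e]
    refine (norm_add_le_of_le (norm_add_le_of_le ((hstep s t h1 h2 h3).trans k1) k2) k3).trans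
      (le_of_eq ?_)
    rw [hR]; ring
  set L := R * τ + A₁ * A₀ with hL
  have hL0 : 0 ≤ L := by positivity
  have hinc : ∀ s t, r ≤ s → s ≤ t → t ≤ T → ‖Y t - Y s‖ ≤ L * (t - s) ^ α :=
    fun s t h1 h2 h3 => by
    have hH := hle s t h1 h2 h3
    have e : Y t - Y s = (Y t - Y s - V (Y s) (Z t - Z s)) + V (Y s) (Z t - Z s) := by abel
    rw [e]
    refine (norm_add_le_of_le (hrem s t h1 h2 h3) ((V (Y s)).le_of_opNorm_le_of_le (v0 () _)
      (hz s t (hr.trans h1) h2 h3).1)).trans ?_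
    have : R * ((t - s) ^ α) ^ 2 ≤ R * (τ * (t - s) ^ α) := by
      rw [pow_two]
      gcongr
      exact hH.2
    linarith
  obtain ⟨D, hD, hint⟩ := norm_integral_sub_smul_le hα hα' hb hinc
  refine ⟨⟨⟨R, fun s t h1 h2 h3 => ?_⟩, ⟨A₂ * L, fun s t h1 h2 h3 => ?_⟩⟩, rfl, fun t ht ε hε => ?_⟩
  · rw [mul_comm 2 α, show (2 : ℝ) = ((2 : ℕ) : ℝ) by norm_num,
      Real.rpow_mul_natCast (sub_nonneg.2 h2)]
    exact hrem s t h1 h2 h3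
  · rw [mul_assoc]
    exact (v1 () _ _).trans (by gcongr; exact hinc s t h1 h2 h3)
  · obtain ⟨δ, hδ, H⟩ := exists_mesh_sum_lt (C := K + D) hα (sub_nonneg.2 ht.1) hε
    refine ⟨δ, hδ, fun n p hp p0 pn hm => ?_⟩
    have hpr : ∀ i, r ≤ p i := fun i => p0 ▸ hp (Nat.zero_le i)
    have hpt : ∀ i ≤ n, p i ≤ T := fun i hi => (pn ▸ hp hi : p i ≤ t).trans ht.2
    have hi : ∀ i < n, IntervalIntegrable (fun u => b (Y u)) MeasureTheory.volume (p i)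
        (p (i + 1)) := fun i hi => (hint _ _ (hpr i) (hp i.le_succ) (hpt _ hi)).1
    have e1 : Y t - Y r - ∫ s in r..t, b (Y s) = ∑ i ∈ Finset.range n,
        (Y (p (i + 1)) - Y (p i) - ∫ s in (p i)..(p (i + 1)), b (Y s)) := by
      rw [Finset.sum_sub_distrib, Finset.sum_range_sub (fun i => Y (p i)),
        intervalIntegral.sum_integral_adjacent_intervals hi, p0, pn]
    rw [e1, ← Finset.sum_sub_distrib]
    refine (norm_sum_le_of_le _ fun i hi' => ?_).trans_lt (H n p hp hm (by rw [p0, pn]))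
    have hi'' := Finset.mem_range.1 hi'
    have h1 := hstep _ _ (hpr i) (hp i.le_succ) (hpt _ hi'')
    have h2 := (hint _ _ (hpr i) (hp i.le_succ) (hpt _ hi'')).2
    set s := p i
    set u := p (i + 1)
    have e2 : V (Y s) (Z u - Z s) + contract (Gam V V (Y s)) (ZZ s u)
        - (Y u - Y s - ∫ v in s..u, b (Y v)) = ((∫ v in s..u, b (Y v)) - (u - s) • b (Y s))
          - (Y u - rdeStep Z ZZ V b s u (Y s)) := by
      rw [rdeStep, roughInc]; abel
    rw [e2, add_comm K D, add_mul]
    exact norm_sub_le_of_le h2 h1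

namespace IsRDEFlow

variable {C : ℝ} {Φ : ℝ → ℝ → E → E}

theorem isDavieSolution (hΦ : IsRDEFlow α T C Z ZZ b V Φ) {r : ℝ} (hr : 0 ≤ r) (x : E) :
    IsDavieSolution α T r Z ZZ b V (fun t => Φ r t x) := by
  refine ⟨C, hΦ.nonneg, fun s t hrs hst htT => ?_⟩
  simp only
  rw [hΦ.comp r s t hr hrs hst htT]
  exact hΦ.step s t (hr.trans hrs) hst htT _

theorem norm_fderiv_le (hΦ : IsRDEFlow α T C Z ZZ b V Φ) (hα : 0 < α) (hT : 0 ≤ T)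
    (hZ : IsRoughPath α T Z ZZ) (hV : CB 1 (fun _ : Unit => V)) :
    ∃ L, 0 ≤ L ∧ ∀ s t, 0 ≤ s → s ≤ t → t ≤ T → ∀ x, ‖fderiv ℝ (Φ s t) x‖ ≤ L := by
  obtain ⟨A₀, hA₀, hz⟩ := hZ.bounds
  obtain ⟨A₁, hA₁, v1⟩ := hV.fderiv.bounded
  have hC := hΦ.nonneg
  have hτ : 0 ≤ T ^ α := Real.rpow_nonneg hT _
  refine ⟨C * (T ^ α) ^ 2 + (1 + A₁ * (A₀ * T ^ α)), by positivity, fun s t hs hst htT x => ?_⟩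
  have hH0 : 0 ≤ (t - s) ^ α := Real.rpow_nonneg (by linarith) _
  have hH : (t - s) ^ α ≤ T ^ α := Real.rpow_le_rpow (by linarith) (by linarith) hα.le
  have e : fderiv ℝ (Φ s t) x = (fderiv ℝ (Φ s t) x - ContinuousLinearMap.id ℝ E
      - (fderiv ℝ V x).flip (Z t - Z s))
      + (ContinuousLinearMap.id ℝ E + (fderiv ℝ V x).flip (Z t - Z s)) := by abel
  rw [e]
  refine norm_add_le_of_le ((hΦ.deriv s t hs hst htT x).trans (by gcongr))
    (norm_add_le_of_le ContinuousLinearMap.norm_id_le ?_)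
  refine ContinuousLinearMap.le_of_opNorm_le_of_le _ ?_ ((hz s t hs hst htT).1.trans (by gcongr))
  rw [ContinuousLinearMap.opNorm_flip]
  exact v1 () x

/-- Uniqueness of solutions. -/
theorem eq_of_isDavieSolution (hΦ : IsRDEFlow α T C Z ZZ b V Φ) (hα : 1 / 3 < α) (hT : 0 ≤ T)
    (hZ : IsRoughPath α T Z ZZ) (hV : CB 1 (fun _ : Unit => V)) {r t : ℝ} (hr : 0 ≤ r)
    (hrt : r ≤ t) (htT : t ≤ T) {Y : ℝ → E} (hY : IsDavieSolution α T r Z ZZ b V Y) :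
    Y t = Φ r t (Y r) := by
  obtain ⟨L, hL, hLip⟩ := hΦ.norm_fderiv_le (by linarith) hT hZ hV
  obtain ⟨K, hK, hstep⟩ := hY
  -- The map s ↦ Φ_{s,t}(Y_s) leads from Φ_{r,t}(Y_r) to Y_t. By the flow property its increments
  -- compare Y_u with Φ_{s,u}(Y_s) through a Lipschitz map, and both points lie within order three
  -- of the same Davie step.
  have := eq_of_norm_sub_le_cube (D := fun s => Φ s t (Y s)) (C := L * (K + C)) hα hrt
    fun s u hrs hsu hut => by
      have hs : 0 ≤ s := hr.trans hrs
      rw [hΦ.comp s u t hs hsu hut htT]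
      refine (CB.lipschitz_of_fderiv_le (hΦ.diff u t (hs.trans hsu) hut htT)
        (hLip u t (hs.trans hsu) hut htT) _ _).trans ?_
      rw [mul_assoc]
      gcongr
      rw [add_mul, ← sub_sub_sub_cancel_right _ _ (rdeStep Z ZZ V b s u (Y s))]
      exact norm_sub_le_of_le (hstep s u hrs hsu (hut.trans htT))
        (hΦ.step s u hs hsu (hut.trans htT) _)
  simpa only [hΦ.refl t (hr.trans hrt) htT] using this

end IsRDEFlow

end RoughIntegral

/-! ### Second order Taylor expansions -/

theorem fderiv_fderiv_comm {W U : Type} [NormedAddCommGroup W] [NormedSpace ℝ W]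
    [NormedAddCommGroup U] [NormedSpace ℝ U] {f : W → U} (hf : Differentiable ℝ f)
    (hf' : Differentiable ℝ (fderiv ℝ f)) (x v w : W) :
    fderiv ℝ (fderiv ℝ f) x v w = fderiv ℝ (fderiv ℝ f) x w v :=
  second_derivative_symmetric (fun y => (hf y).hasFDerivAt) (hf' x).hasFDerivAt v w

theorem CB.taylor_two {ι W U : Type} [NormedAddCommGroup W] [NormedSpace ℝ W]
    [NormedAddCommGroup U] [NormedSpace ℝ U] {f : ι → W → U} (hf : CB 2 f) :
    ∃ C : ℝ, 0 ≤ C ∧ ∀ i x y, ‖f i y - f i x - _root_.fderiv ℝ (f i) x (y - x)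
      - (1 / 2 : ℝ) • _root_.fderiv ℝ (_root_.fderiv ℝ (f i)) x (y - x) (y - x)‖
      ≤ C * ‖y - x‖ ^ 3 := by
  obtain ⟨C, hC, h⟩ := hf.fderiv.taylor_one
  refine ⟨C, hC, fun i x y => ?_⟩
  set A := _root_.fderiv ℝ (_root_.fderiv ℝ (f i)) x with hA
  have hd : ∀ z, HasFDerivAt (fun z => f i z - _root_.fderiv ℝ (f i) x (z - x)
      - (1 / 2 : ℝ) • A (z - x) (z - x))
      (_root_.fderiv ℝ (f i) z - _root_.fderiv ℝ (f i) x - A (z - x)) z := by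
    intro z
    have h0 : HasFDerivAt (fun z => z - x) (ContinuousLinearMap.id ℝ W) z :=
      (hasFDerivAt_id z).sub_const x
    have h1 : HasFDerivAt (fun z => _root_.fderiv ℝ (f i) x (z - x)) _ z :=
      (_root_.fderiv ℝ (f i) x).hasFDerivAt.comp z h0
    have h2 : HasFDerivAt (fun z => A (z - x)) _ z := A.hasFDerivAt.comp z h0
    have h3 := ((hf.differentiable i z).hasFDerivAt.sub h1).sub
      ((h2.clm_apply h0).const_smul (1 / 2 : ℝ))
    refine h3.congr_fderiv ?_
    ext v
    have h4 := fderiv_fderiv_comm (hf.differentiable i) (hf.fderiv.differentiable i) x v (z - x)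
    rw [← hA] at h4
    simp only [ContinuousLinearMap.comp_id, sub_apply, add_apply, smul_apply,
      ContinuousLinearMap.flip_apply, h4, ← two_smul ℝ (A (z - x) v), smul_smul]
    norm_num
  have := (convex_segment x y).norm_image_sub_le_of_norm_hasFDerivWithin_le
    (C := C * ‖y - x‖ ^ 2) (fun z _ => (hd z).hasFDerivWithinAt) (fun z hz => ?_)
    (left_mem_segment ℝ x y) (right_mem_segment ℝ x y)
  · simp only [sub_self, map_zero, smul_zero, sub_zero] at this
    refine (le_of_eq ?_).trans (this.trans (le_of_eq (by ring)))
    congr 1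
    abel
  · refine (h i x z).trans ?_
    gcongr
    simpa [dist_eq_norm] using norm_sub_le_of_mem_segment hz

/-! ### Calculus of orders of vanishing -/

namespace VanishesToOrder

variable {α T : ℝ} {k l : ℕ} {W F G X : Type} [NormedAddCommGroup W] [NormedAddCommGroup F]
  [NormedAddCommGroup G] [NormedAddCommGroup X] {A B : ℝ → ℝ → W → W → F}
  {D : ℝ → ℝ → W → W → G}

theorem max_nonneg (α s t : ℝ) (x y : W) : 0 ≤ max (|t - s| ^ α) ‖y - x‖ :=
  le_max_of_le_right (norm_nonneg _)

theorem exists_nonneg (hA : VanishesToOrder α T k A) : ∃ C : ℝ, 0 ≤ C ∧ ∀ s t, 0 ≤ s → s ≤ t →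
    t ≤ T → ∀ x y, ‖A s t x y‖ ≤ C * (max (|t - s| ^ α) ‖y - x‖) ^ k := by
  obtain ⟨C, hC⟩ := hA
  refine ⟨|C|, abs_nonneg _, fun s t hs hst htT x y => (hC s t hs hst htT x y).trans ?_⟩
  have := max_nonneg α s t x y
  gcongr
  exact le_abs_self _

theorem congr (hA : VanishesToOrder α T k A)
    (h : ∀ s t, 0 ≤ s → s ≤ t → t ≤ T → ∀ x y, B s t x y = A s t x y) :
    VanishesToOrder α T k B := by
  obtain ⟨C, hC⟩ := hA
  exact ⟨C, fun s t hs hst htT x y => by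
    rw [h s t hs hst htT]; exact hC s t hs hst htT x y⟩

theorem add (hA : VanishesToOrder α T k A) (hB : VanishesToOrder α T k B) :
    VanishesToOrder α T k fun s t x y => A s t x y + B s t x y := by
  obtain ⟨C, hC⟩ := hA
  obtain ⟨C', hC'⟩ := hB
  exact ⟨C + C', fun s t hs hst htT x y => (norm_add_le_of_le (hC s t hs hst htT x y)
    (hC' s t hs hst htT x y)).trans (le_of_eq (by ring))⟩

theorem neg (hA : VanishesToOrder α T k A) : VanishesToOrder α T k fun s t x y => -A s t x y := by
  obtain ⟨C, hC⟩ := hA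
  exact ⟨C, fun s t hs hst htT x y => by rw [norm_neg]; exact hC s t hs hst htT x y⟩

theorem sub (hA : VanishesToOrder α T k A) (hB : VanishesToOrder α T k B) :
    VanishesToOrder α T k fun s t x y => A s t x y - B s t x y :=
  (hA.add hB.neg).congr fun _ _ _ _ _ _ _ => sub_eq_add_neg _ _

theorem of_le_pow (hA : VanishesToOrder α T 1 A) (n : ℕ) {C : ℝ} (hC : 0 ≤ C)
    (h : ∀ s t, 0 ≤ s → s ≤ t → t ≤ T → ∀ x y, ‖D s t x y‖ ≤ C * ‖A s t x y‖ ^ n) :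
    VanishesToOrder α T n D := by
  obtain ⟨K, hK0, hK⟩ := hA.exists_nonneg
  refine ⟨C * K ^ n, fun s t hs hst htT x y => (h s t hs hst htT x y).trans ?_⟩
  rw [mul_assoc, ← mul_pow]
  gcongr
  simpa using hK s t hs hst htT x y

theorem of_bounded {C : ℝ} (h : ∀ s t, 0 ≤ s → s ≤ t → t ≤ T → ∀ x y, ‖A s t x y‖ ≤ C) :
    VanishesToOrder α T 0 A :=
  ⟨C, fun s t hs hst htT x y => by simpa using h s t hs hst htT x y⟩

theorem of_time {A : ℝ → ℝ → W → F} {C : ℝ} (hC : 0 ≤ C)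
    (h : ∀ s t, 0 ≤ s → s ≤ t → t ≤ T → ∀ x, ‖A s t x‖ ≤ C * ((t - s) ^ α) ^ k) :
    VanishesToOrder α T k fun s t x (_ : W) => A s t x := by
  refine ⟨C, fun s t hs hst htT x y => (h s t hs hst htT x).trans ?_⟩
  have : 0 ≤ (t - s) ^ α := Real.rpow_nonneg (by linarith) _
  gcongr
  rw [abs_of_nonneg (by linarith)]
  exact le_max_left _ _

theorem time {A : ℝ → ℝ → W → F} (hA : VanishesToOrder α T k fun s t x (_ : W) => A s t x) :
    ∃ C : ℝ, 0 ≤ C ∧ ∀ s t, 0 ≤ s → s ≤ t → t ≤ T → ∀ x, ‖A s t x‖ ≤ C * ((t - s) ^ α) ^ k := by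
  obtain ⟨C, hC0, hC⟩ := hA.exists_nonneg
  refine ⟨C, hC0, fun s t hs hst htT x => ?_⟩
  have h1 := hC s t hs hst htT x x
  rwa [sub_self, norm_zero, abs_of_nonneg (by linarith),
    max_eq_left (Real.rpow_nonneg (by linarith) _)] at h1

/-- Lowering the order is possible only for expressions that do not depend on y: time is bounded,
while y - x is not. -/
theorem time_of_succ {A : ℝ → ℝ → W → F} (hα : 0 < α) (hT : 0 ≤ T)
    (hA : VanishesToOrder α T (k + 1) fun s t x (_ : W) => A s t x) :
    VanishesToOrder α T k fun s t x (_ : W) => A s t x := by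
  obtain ⟨C, hC0, hC⟩ := hA.time
  refine of_time (C := C * T ^ α) (mul_nonneg hC0 (Real.rpow_nonneg hT _))
    fun s t hs hst htT x => (hC s t hs hst htT x).trans ?_
  have h0 : 0 ≤ (t - s) ^ α := Real.rpow_nonneg (by linarith) _
  rw [pow_succ', mul_assoc]
  gcongr
  linarith

theorem space : VanishesToOrder α T 1 fun (_ _ : ℝ) (x y : W) => y - x :=
  ⟨1, fun s t _ _ _ x y => by simp⟩

variable [NormedSpace ℝ F] [NormedSpace ℝ G] [NormedSpace ℝ X]

theorem bilin (L : F →L[ℝ] G →L[ℝ] X) (hA : VanishesToOrder α T k A)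
    (hD : VanishesToOrder α T l D) :
    VanishesToOrder α T (k + l) fun s t x y => L (A s t x y) (D s t x y) := by
  obtain ⟨C, hC0, hC⟩ := hA.exists_nonneg
  obtain ⟨C', hC0', hC'⟩ := hD.exists_nonneg
  refine ⟨‖L‖ * (C * C'), fun s t hs hst htT x y => ?_⟩
  have h1 := hC s t hs hst htT x y
  have h2 := hC' s t hs hst htT x y
  have h0 := max_nonneg α s t x y
  refine (L.le_opNorm₂ _ _).trans ?_
  calc ‖L‖ * ‖A s t x y‖ * ‖D s t x y‖
      ≤ ‖L‖ * (C * (max (|t - s| ^ α) ‖y - x‖) ^ k)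
        * (C' * (max (|t - s| ^ α) ‖y - x‖) ^ l) := by gcongr
    _ = _ := by rw [pow_add]; ring

theorem clm (L : F →L[ℝ] G) (hA : VanishesToOrder α T k A) :
    VanishesToOrder α T k fun s t x y => L (A s t x y) := by
  obtain ⟨C, hC0, hC⟩ := hA.exists_nonneg
  refine ⟨‖L‖ * C, fun s t hs hst htT x y => ?_⟩
  rw [mul_assoc]
  exact (L.le_opNorm _).trans (by gcongr; exact hC s t hs hst htT x y)

theorem apply {A : ℝ → ℝ → W → W → F →L[ℝ] X} {D : ℝ → ℝ → W → W → F}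
    (hA : VanishesToOrder α T k A) (hD : VanishesToOrder α T l D) :
    VanishesToOrder α T (k + l) fun s t x y => A s t x y (D s t x y) :=
  bilin (ContinuousLinearMap.id ℝ (F →L[ℝ] X)) hA hD

theorem clm_comp {A : ℝ → ℝ → W → W → G →L[ℝ] X} {D : ℝ → ℝ → W → W → F →L[ℝ] G}
    (hA : VanishesToOrder α T k A) (hD : VanishesToOrder α T l D) :
    VanishesToOrder α T (k + l) fun s t x y => (A s t x y).comp (D s t x y) :=
  bilin (ContinuousLinearMap.compL ℝ F G X) hA hD

theorem flip {A : ℝ → ℝ → W → W → F →L[ℝ] G →L[ℝ] X} (hA : VanishesToOrder α T k A) :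
    VanishesToOrder α T k fun s t x y => (A s t x y).flip := by
  obtain ⟨C, hC⟩ := hA
  exact ⟨C, fun s t hs hst htT x y => by
    rw [ContinuousLinearMap.opNorm_flip]; exact hC s t hs hst htT x y⟩

theorem of_cb [NormedSpace ℝ W] {f : Icc (0 : ℝ) T → W → F} (hf : CB k f) {g : ℝ → W → F}
    (hg : ∀ t : Icc (0 : ℝ) T, g t = f t) :
    VanishesToOrder α T 0 (fun s _ x (_ : W) => g s x) ∧
    VanishesToOrder α T 0 (fun _ t x (_ : W) => g t x) ∧
    VanishesToOrder α T 1 (fun _ t x y => g t y - g t x) := by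
  obtain ⟨C, _, hC⟩ := hf.bounded
  obtain ⟨D, hD, hD'⟩ := hf.lipschitz
  refine ⟨of_bounded (C := C) fun s t hs hst htT x _ => ?_,
    of_bounded (C := C) fun s t hs hst htT x _ => ?_,
    of_le_pow space 1 hD fun s t hs hst htT x y => ?_⟩
  · rw [hg ⟨s, hs, hst.trans htT⟩]; exact hC _ _
  · rw [hg ⟨t, hs.trans hst, htT⟩]; exact hC _ _
  · rw [hg ⟨t, hs.trans hst, htT⟩, pow_one]; exact hD' _ _ _

end VanishesToOrder

/-! ### Orders of the rough increments and weak geometricity -/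

section RoughOrders

variable {m : ℕ} {α T : ℝ} {k : ℕ} {Z : ℝ → EuclideanSpace ℝ (Fin m)}
  {ZZ : ℝ → ℝ → Matrix (Fin m) (Fin m) ℝ} {W U : Type} [NormedAddCommGroup W]
  [NormedAddCommGroup U] [NormedSpace ℝ U]

theorem IsRoughPath.vanishesToOrder_fst (hZ : IsRoughPath α T Z ZZ) :
    VanishesToOrder α T 1 fun s t (_ _ : W) => Z t - Z s := by
  obtain ⟨C, hC, h⟩ := hZ.bounds
  refine VanishesToOrder.of_time (A := fun s t _ => Z t - Z s) hC fun s t hs hst htT _ => ?_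
  rw [pow_one]
  exact (h s t hs hst htT).1

theorem IsRoughPath.vanishesToOrder_contract (hZ : IsRoughPath α T Z ZZ)
    {B : ℝ → ℝ → W → W → EuclideanSpace ℝ (Fin m) →L[ℝ] EuclideanSpace ℝ (Fin m) →L[ℝ] U}
    (hB : VanishesToOrder α T k B) :
    VanishesToOrder α T (k + 2) fun s t x y => contract (B s t x y) (ZZ s t) := by
  obtain ⟨C, hC, h⟩ := hZ.bounds
  obtain ⟨D, hD, hB⟩ := hB.exists_nonneg
  refine ⟨C * D, fun s t hs hst htT x y => ((h s t hs hst htT).2 U _).trans ?_⟩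
  have h0 : 0 ≤ (t - s) ^ α := Real.rpow_nonneg (by linarith) _
  have h1 : (t - s) ^ α ≤ max (|t - s| ^ α) ‖y - x‖ := by
    rw [abs_of_nonneg (by linarith)]; exact le_max_left _ _
  have h2 := hB s t hs hst htT x y
  calc C * ((t - s) ^ α) ^ 2 * ‖B s t x y‖
      ≤ C * (max (|t - s| ^ α) ‖y - x‖) ^ 2 * (D * (max (|t - s| ^ α) ‖y - x‖) ^ k) := by
        gcongr
    _ = _ := by ring

theorem vanishesToOrder_time (hα : 0 < α) (hα' : α ≤ 1 / 2) :
    VanishesToOrder α T 2 fun s t (_ _ : W) => t - s := by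
  refine VanishesToOrder.of_time (A := fun s t _ => t - s) (C := 1 + |T| / (1 ^ α) ^ 2)
    (by positivity) fun s t hs hst htT _ => ?_
  rw [Real.norm_of_nonneg (by linarith)]
  refine le_mul_pow_of_dichotomy hα one_pos (by linarith) (abs_nonneg _) zero_le_one 2
    (fun h => ?_) ((by linarith : t - s ≤ T).trans (le_abs_self _))
  rw [one_mul]
  exact le_rpow_sq hα' (by linarith) h

/-- This is δZ ⊗ δZ = ℤ + ℤᵀ tested against B, and the only place where the vanishing of the bracket
is used directly. -/
theorem IsWeaklyGeometricRoughPath.apply_apply (hZ : IsWeaklyGeometricRoughPath α T Z ZZ) {s t : ℝ}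
    (hs : 0 ≤ s) (hst : s ≤ t) (htT : t ≤ T)
    (B : EuclideanSpace ℝ (Fin m) →L[ℝ] EuclideanSpace ℝ (Fin m) →L[ℝ] U) :
    B (Z t - Z s) (Z t - Z s) = contract B (ZZ s t) + contract B.flip (ZZ s t) := by
  have h : ∀ i j, (Z t - Z s) i * (Z t - Z s) j = ZZ s t i j + ZZ s t j i := fun i j => by
    have := congrFun₂ (hZ.bracket_eq_zero s t hs hst htT) i j
    simpa [roughBracket, sub_eq_zero] using this
  rw [apply_apply_eq_sum]
  simp only [h, add_smul, Finset.sum_add_distrib, contract, ContinuousLinearMap.flip_apply]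
  congr 1
  exact Finset.sum_comm

end RoughOrders

/-! ### The transport equation -/

section Transport

variable {m : ℕ} {α T C : ℝ} {Z : ℝ → EuclideanSpace ℝ (Fin m)}
  {ZZ : ℝ → ℝ → Matrix (Fin m) (Fin m) ℝ} {E U : Type} [NormedAddCommGroup E] [NormedSpace ℝ E]
  [NormedAddCommGroup U] [NormedSpace ℝ U]
  {V : E → EuclideanSpace ℝ (Fin m) →L[ℝ] E} {b : E → E} {Φ : ℝ → ℝ → E → E}

theorem hasFDerivAt_gam_of_differentiable (hV : Differentiable ℝ V) {f : E → U}
    (hf : Differentiable ℝ (fderiv ℝ f)) (x : E) :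
    HasFDerivAt (Gam V f) ((ContinuousLinearMap.compL ℝ (EuclideanSpace ℝ (Fin m)) E U
        (fderiv ℝ f x)).comp (fderiv ℝ V x)
      + ((ContinuousLinearMap.compL ℝ (EuclideanSpace ℝ (Fin m)) E U).flip (V x)).comp
        (fderiv ℝ (fderiv ℝ f) x)) x :=
  (hf x).hasFDerivAt.clm_comp (hV x).hasFDerivAt

theorem fderiv_gam_apply_apply (hV : Differentiable ℝ V) {f : E → U}
    (hf : Differentiable ℝ (fderiv ℝ f)) (x v : E) (a : EuclideanSpace ℝ (Fin m)) :
    fderiv ℝ (Gam V f) x v a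
      = fderiv ℝ f x (fderiv ℝ V x v a) + fderiv ℝ (fderiv ℝ f) x v (V x a) := by
  rw [(hasFDerivAt_gam_of_differentiable hV hf x).fderiv]
  simp

theorem gam_gam_apply (hV : Differentiable ℝ V) {f : E → U}
    (hf : Differentiable ℝ (fderiv ℝ f)) (x : E) (a c : EuclideanSpace ℝ (Fin m)) :
    Gam V (Gam V f) x a c
      = fderiv ℝ f x (Gam V V x a c) + fderiv ℝ (fderiv ℝ f) x (V x a) (V x c) :=
  fderiv_gam_apply_apply hV hf x (V x a) c

namespace IsRDEFlow

theorem transport_cb (hΦ : IsRDEFlow α T C Z ZZ b V Φ) (hα : 0 < α) (hT : 0 ≤ T)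
    (hZ : IsRoughPath α T Z ZZ) (hV : CB 1 (fun _ : Unit => V)) {g : E → U}
    (hg : CB 2 (fun _ : Unit => g)) : CB 2 (fun (t : Icc (0 : ℝ) T) x => g (Φ t T x)) := by
  obtain ⟨L, hL, hΦ1⟩ := hΦ.norm_fderiv_le hα hT hZ hV
  have hC := hΦ.nonneg
  refine CB.comp (hg.reindex fun _ => ()) (fun t => hΦ.diff t T t.2.1 t.2.2 le_rfl)
    ⟨⟨L, fun t => hΦ1 t T t.2.1 t.2.2 le_rfl⟩, fun t => hΦ.diff₂ t T t.2.1 t.2.2 le_rfl,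
      CB.zero_intro (C := C * T ^ α) (fun t x => (hΦ.deriv₂ t T t.2.1 t.2.2 le_rfl x).trans ?_)
        fun t => hΦ.deriv₂_lip t T t.2.1 t.2.2 le_rfl⟩
  have h0 : (0 : ℝ) ≤ T - t := by linarith [t.2.2]
  have h1 : (T : ℝ) - t ≤ T := by linarith [t.2.1]
  gcongr

/-- The orders of the increments of a flow and its derivatives. -/
theorem orders (hΦ : IsRDEFlow α T C Z ZZ b V Φ) (hα : 0 < α) (hα' : α ≤ 1 / 2) (hT : 0 ≤ T)
    (hZ : IsRoughPath α T Z ZZ) (hV : CB 2 (fun _ : Unit => V)) (hb : CB 0 (fun _ : Unit => b)) :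
    VanishesToOrder α T 3 (fun s t x (_ : E) => Φ s t x - rdeStep Z ZZ V b s t x) ∧
    VanishesToOrder α T 2 (fun s t x (_ : E) => Φ s t x - x - V x (Z t - Z s)) ∧
    VanishesToOrder α T 1 (fun s t x (_ : E) => Φ s t x - x) ∧
    VanishesToOrder α T 2 (fun s t x (_ : E) => fderiv ℝ (Φ s t) x - ContinuousLinearMap.id ℝ E
      - (fderiv ℝ V x).flip (Z t - Z s)) ∧
    VanishesToOrder α T 1
      (fun s t x (_ : E) => fderiv ℝ (Φ s t) x - ContinuousLinearMap.id ℝ E) ∧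
    VanishesToOrder α T 0 (fun s t x (_ : E) => fderiv ℝ (Φ s t) x) ∧
    VanishesToOrder α T 1 (fun s t x (_ : E) => fderiv ℝ (fderiv ℝ (Φ s t)) x) := by
  obtain ⟨A₀, _, v0⟩ := hV.bounded
  obtain ⟨A₁, _, v1⟩ := hV.fderiv.bounded
  obtain ⟨A₂, _, v2⟩ := (CB.gam hV.of_succ hV).bounded
  obtain ⟨A₃, _, v3⟩ := hb.bounded
  obtain ⟨L, hL, hΦ1⟩ := hΦ.norm_fderiv_le hα hT hZ hV.of_succ
  have oz : VanishesToOrder α T 1 (fun s t (_ _ : E) => Z t - Z s) := hZ.vanishesToOrder_fst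
  have ov : VanishesToOrder α T 0 (fun (_ _ : ℝ) (x _ : E) => V x) :=
    .of_bounded fun _ _ _ _ _ x _ => v0 () x
  have ov' : VanishesToOrder α T 0 (fun (_ _ : ℝ) (x _ : E) => fderiv ℝ V x) :=
    .of_bounded fun _ _ _ _ _ x _ => v1 () x
  have og : VanishesToOrder α T 0 (fun (_ _ : ℝ) (x _ : E) => Gam V V x) :=
    .of_bounded fun _ _ _ _ _ x _ => v2 () x
  have ob : VanishesToOrder α T 0 (fun (_ _ : ℝ) (x _ : E) => b x) :=
    .of_bounded fun _ _ _ _ _ x _ => v3 () x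
  have o1 : VanishesToOrder α T 3 (fun s t x (_ : E) => Φ s t x - rdeStep Z ZZ V b s t x) :=
    .of_time (A := fun s t x => Φ s t x - rdeStep Z ZZ V b s t x) hΦ.nonneg hΦ.step
  have o2 : VanishesToOrder α T 2 (fun s t x (_ : E) => Φ s t x - x - V x (Z t - Z s)) := by
    have h1 := VanishesToOrder.time_of_succ (A := fun s t x => Φ s t x - rdeStep Z ZZ V b s t x)
      hα hT o1
    have h2 := hZ.vanishesToOrder_contract og
    have h3 := ob.bilin (ContinuousLinearMap.lsmul ℝ ℝ (E := E)).flip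
      (vanishesToOrder_time (T := T) (W := E) hα hα')
    refine ((h1.add h2).add h3).congr fun s t _ _ _ x y => ?_
    simp only [rdeStep, roughInc, ContinuousLinearMap.flip_apply, ContinuousLinearMap.lsmul_apply]
    abel
  have o3 : VanishesToOrder α T 1 (fun s t x (_ : E) => Φ s t x - x) := by
    have h1 := VanishesToOrder.time_of_succ (A := fun s t x => Φ s t x - x - V x (Z t - Z s))
      hα hT o2
    refine (h1.add (ov.apply oz)).congr fun s t _ _ _ x y => ?_
    abel
  have o4 : VanishesToOrder α T 2 (fun s t x (_ : E) => fderiv ℝ (Φ s t) x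
      - ContinuousLinearMap.id ℝ E - (fderiv ℝ V x).flip (Z t - Z s)) :=
    .of_time (A := fun s t x => fderiv ℝ (Φ s t) x
      - ContinuousLinearMap.id ℝ E - (fderiv ℝ V x).flip (Z t - Z s)) hΦ.nonneg hΦ.deriv
  refine ⟨o1, o2, o3, o4, ?_, .of_bounded fun s t hs hst htT x _ => hΦ1 s t hs hst htT x,
    .of_time (A := fun s t x => fderiv ℝ (fderiv ℝ (Φ s t)) x) hΦ.nonneg ?_⟩
  · have h1 := VanishesToOrder.time_of_succ (A := fun s t x => fderiv ℝ (Φ s t) x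
      - ContinuousLinearMap.id ℝ E - (fderiv ℝ V x).flip (Z t - Z s)) hα hT o4
    refine (h1.add (ov'.flip.apply oz)).congr fun s t _ _ _ x y => ?_
    abel
  · intro s t hs hst htT x
    rw [pow_one]
    exact hΦ.deriv₂ s t hs hst htT x

variable {u : ℝ → E → U}

/-- Time regularity of the derivatives of a function transported by the flow. -/
theorem transport_fderiv (hΦ : IsRDEFlow α T C Z ZZ b V Φ) (hα : 0 < α) (hα' : α ≤ 1 / 2)
    (hT : 0 ≤ T) (hZ : IsRoughPath α T Z ZZ) (hV : CB 2 (fun _ : Unit => V))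
    (hb : CB 0 (fun _ : Unit => b)) (hu : CB 2 (fun (t : Icc (0 : ℝ) T) x => u t x))
    (huΦ : ∀ s t, 0 ≤ s → s ≤ t → t ≤ T → u s = fun x => u t (Φ s t x)) :
    VanishesToOrder α T 1 (fun s t x (_ : E) => fderiv ℝ (fderiv ℝ (u t)) x
      - fderiv ℝ (fderiv ℝ (u s)) x) ∧
    VanishesToOrder α T 1 (fun s t x (_ : E) => fderiv ℝ (u t) x - fderiv ℝ (u s) x) ∧
    VanishesToOrder α T 1 (fun s t x (_ : E) => fderiv ℝ (Gam V (u t)) x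
      - fderiv ℝ (Gam V (u s)) x) ∧
    VanishesToOrder α T 2 (fun s t x (_ : E) => fderiv ℝ (u t) x - fderiv ℝ (u s) x
      + (fderiv ℝ (Gam V (u s)) x).flip (Z t - Z s)) := by
  obtain ⟨_, p2, p1, p4, p3, p0, p5⟩ := hΦ.orders hα hα' hT hZ hV hb
  have oz : VanishesToOrder α T 1 (fun s t (_ _ : E) => Z t - Z s) := hZ.vanishesToOrder_fst
  obtain ⟨A₀, _, v0⟩ := hV.bounded
  obtain ⟨A₁, _, v1⟩ := hV.fderiv.bounded
  have ov : VanishesToOrder α T 0 (fun (_ _ : ℝ) (x _ : E) => V x) :=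
    .of_bounded fun _ _ _ _ _ x _ => v0 () x
  have ov' : VanishesToOrder α T 0 (fun (_ _ : ℝ) (x _ : E) => fderiv ℝ V x) :=
    .of_bounded fun _ _ _ _ _ x _ => v1 () x
  have hud : ∀ t, 0 ≤ t → t ≤ T → Differentiable ℝ (u t) :=
    fun t h0 hT => hu.differentiable ⟨t, h0, hT⟩
  have hud' : ∀ t, 0 ≤ t → t ≤ T → Differentiable ℝ (fderiv ℝ (u t)) :=
    fun t h0 hT => hu.fderiv.differentiable ⟨t, h0, hT⟩
  obtain ⟨B₁, hB₁, w1⟩ := hu.fderiv.bounded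
  obtain ⟨B₂, hB₂, w2⟩ := hu.fderiv.fderiv.bounded
  obtain ⟨B₃, hB₃, w3⟩ := hu.fderiv.fderiv.lipschitz
  obtain ⟨B₄, hB₄, w4⟩ := hu.fderiv.taylor_one
  obtain ⟨B₅, hB₅, w5⟩ := hu.fderiv.lipschitz
  have q1 : VanishesToOrder α T 0 (fun s t x (_ : E) => fderiv ℝ (u t) (Φ s t x)) :=
    .of_bounded fun s t hs hst htT x _ => w1 ⟨t, hs.trans hst, htT⟩ _
  have q2 : VanishesToOrder α T 0 (fun s t x (_ : E) => fderiv ℝ (fderiv ℝ (u t)) (Φ s t x)) :=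
    .of_bounded fun s t hs hst htT x _ => w2 ⟨t, hs.trans hst, htT⟩ _
  have q3 : VanishesToOrder α T 1 (fun s t x (_ : E) => fderiv ℝ (fderiv ℝ (u t)) (Φ s t x)
      - fderiv ℝ (fderiv ℝ (u t)) x) :=
    p1.of_le_pow 1 hB₃ fun s t hs hst htT x _ => by
      rw [pow_one]; exact w3 ⟨t, hs.trans hst, htT⟩ _ _
  have q4 : VanishesToOrder α T 2 (fun s t x (_ : E) => fderiv ℝ (u t) (Φ s t x)
      - fderiv ℝ (u t) x - fderiv ℝ (fderiv ℝ (u t)) x (Φ s t x - x)) :=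
    p1.of_le_pow 2 hB₄ fun s t hs hst htT x _ => w4 ⟨t, hs.trans hst, htT⟩ _ _
  have q5 : VanishesToOrder α T 1 (fun s t x (_ : E) => fderiv ℝ (u t) (Φ s t x)
      - fderiv ℝ (u t) x) :=
    p1.of_le_pow 1 hB₅ fun s t hs hst htT x _ => by
      rw [pow_one]; exact w5 ⟨t, hs.trans hst, htT⟩ _ _
  have q6 : VanishesToOrder α T 0 (fun (_ : ℝ) t x (_ : E) => fderiv ℝ (fderiv ℝ (u t)) x) :=
    .of_bounded fun s t hs hst htT x _ => w2 ⟨t, hs.trans hst, htT⟩ _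
  have e1 : ∀ s t, 0 ≤ s → s ≤ t → t ≤ T → fderiv ℝ (u s)
      = fun x => (fderiv ℝ (u t) (Φ s t x)).comp (fderiv ℝ (Φ s t) x) := by
    intro s t hs hst htT
    funext x
    rw [huΦ s t hs hst htT]
    exact ((hud t (hs.trans hst) htT _).hasFDerivAt.comp x
      (hΦ.diff s t hs hst htT x).hasFDerivAt).fderiv
  have e2 : ∀ s t, 0 ≤ s → s ≤ t → t ≤ T → ∀ x, fderiv ℝ (fderiv ℝ (u s)) x
      = (ContinuousLinearMap.compL ℝ E E U (fderiv ℝ (u t) (Φ s t x))).comp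
          (fderiv ℝ (fderiv ℝ (Φ s t)) x)
        + ((ContinuousLinearMap.compL ℝ E E U).flip (fderiv ℝ (Φ s t) x)).comp
          ((fderiv ℝ (fderiv ℝ (u t)) (Φ s t x)).comp (fderiv ℝ (Φ s t) x)) := by
    intro s t hs hst htT x
    rw [e1 s t hs hst htT]
    exact (((hud' t (hs.trans hst) htT _).hasFDerivAt.comp x
      (hΦ.diff s t hs hst htT x).hasFDerivAt).clm_comp
      (hΦ.diff₂ s t hs hst htT x).hasFDerivAt).fderiv
  have o2 : VanishesToOrder α T 1 (fun s t x (_ : E) => fderiv ℝ (fderiv ℝ (u t)) x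
      - fderiv ℝ (fderiv ℝ (u s)) x) := by
    -- Three sources of variation, each with a factor of order one: the second derivative of the
    -- flow, the deviation of its first derivative from the identity, and the displacement of the
    -- base point.
    have h1 := (q1.clm (ContinuousLinearMap.compL ℝ E E U)).clm_comp p5
    have h2 := (p3.clm (ContinuousLinearMap.compL ℝ E E U).flip).clm_comp (q2.clm_comp p0)
    have h3 := q2.clm_comp p3
    refine ((h1.add (h2.add (h3.add q3))).neg).congr fun s t hs hst htT x _ => ?_
    rw [e2 s t hs hst htT x]
    ext v w
    simp
    abel
  -- Since u_s = u_t ∘ Φ_{s,t}, the natural expansion has its coefficients at the later time t. At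
  -- the end of the proof they are moved to s, at the cost of an order one increment times δZ.
  have o4 : VanishesToOrder α T 2 (fun s t x (_ : E) => fderiv ℝ (u s) x - fderiv ℝ (u t) x
      - (fderiv ℝ (Gam V (u t)) x).flip (Z t - Z s)) := by
    have h1 := q1.clm_comp p4
    have h2 := q6.apply p2
    have h3 := q5.clm_comp (ov'.flip.apply oz)
    refine (((h1.add q4).add h2).add h3).congr fun s t hs hst htT x _ => ?_
    rw [e1 s t hs hst htT]
    ext v
    have h4 := fderiv_gam_apply_apply (hV.differentiable ()) (hud' t (hs.trans hst) htT) x v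
      (Z t - Z s)
    have h5 := fderiv_fderiv_comm (hud t (hs.trans hst) htT) (hud' t (hs.trans hst) htT) x v
      (V x (Z t - Z s))
    rw [h5] at h4
    generalize Z t - Z s = z at h4 ⊢
    simp only [sub_apply, add_apply, ContinuousLinearMap.comp_apply,
      ContinuousLinearMap.flip_apply, h4, map_sub, ContinuousLinearMap.id_apply]
    abel
  have og : ∀ (f : ℝ → ℝ → ℝ), (∀ s t, 0 ≤ s → s ≤ t → t ≤ T → 0 ≤ f s t ∧ f s t ≤ T) →
      VanishesToOrder α T 0 (fun s t x (_ : E) => fderiv ℝ (Gam V (u (f s t))) x) := by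
    intro f hf
    have h1 : CB 1 (fun (t : Icc (0 : ℝ) T) x => Gam V (u t) x) :=
      CB.gam (hV.of_succ.reindex fun _ => ()) hu
    obtain ⟨K, _, hK⟩ := h1.fderiv.bounded
    exact .of_bounded fun s t hs hst htT x _ => hK ⟨f s t, hf s t hs hst htT⟩ x
  have o1 : VanishesToOrder α T 1 (fun s t x (_ : E) => fderiv ℝ (u t) x - fderiv ℝ (u s) x) := by
    have h1 := VanishesToOrder.time_of_succ (A := fun s t x => fderiv ℝ (u s) x - fderiv ℝ (u t) x
      - (fderiv ℝ (Gam V (u t)) x).flip (Z t - Z s)) hα hT o4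
    have h2 := (og (fun _ t => t) fun s t hs hst htT => ⟨hs.trans hst, htT⟩).flip.apply oz
    refine (h1.add h2).neg.congr fun s t hs hst htT x _ => ?_
    abel
  have o3 : VanishesToOrder α T 1 (fun s t x (_ : E) => fderiv ℝ (Gam V (u t)) x
      - fderiv ℝ (Gam V (u s)) x) := by
    have h1 := (o1.clm (ContinuousLinearMap.compL ℝ (EuclideanSpace ℝ (Fin m)) E U)).clm_comp ov'
    have h2 := (ov.clm (ContinuousLinearMap.compL ℝ (EuclideanSpace ℝ (Fin m)) E U).flip).clm_comp
      o2
    rw [zero_add] at h2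
    refine (h1.add h2).congr fun s t hs hst htT x _ => ?_
    rw [(hasFDerivAt_gam_of_differentiable (hV.differentiable ()) (hud' t (hs.trans hst) htT)
      x).fderiv, (hasFDerivAt_gam_of_differentiable (hV.differentiable ())
      (hud' s hs (hst.trans htT)) x).fderiv]
    ext v w
    simp
    abel
  refine ⟨o2, o1, o3, ?_⟩
  refine (o4.add (o3.flip.apply oz)).neg.congr fun s t hs hst htT x _ => ?_
  ext v
  simp
  abel

end IsRDEFlow

end Transport

/-! ### Existence: the transported function is a controlled field -/

section RegularSolution

variable {m : ℕ} {α T C : ℝ} {Z : ℝ → EuclideanSpace ℝ (Fin m)}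
  {ZZ : ℝ → ℝ → Matrix (Fin m) (Fin m) ℝ} {E U : Type} [NormedAddCommGroup E] [NormedSpace ℝ E]
  [NormedAddCommGroup U] [NormedSpace ℝ U]
  {V : E → EuclideanSpace ℝ (Fin m) →L[ℝ] E} {b : E → E} {Φ : ℝ → ℝ → E → E}

/-- The second order terms in the chain rule along the flow of a weakly geometric rough path. -/
theorem IsWeaklyGeometricRoughPath.gam_gam_apply (hZ : IsWeaklyGeometricRoughPath α T Z ZZ)
    (hV : Differentiable ℝ V) {f : E → U} (hf : Differentiable ℝ f)
    (hf' : Differentiable ℝ (fderiv ℝ f)) {s t : ℝ} (hs : 0 ≤ s) (hst : s ≤ t) (htT : t ≤ T)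
    (x : E) :
    Gam V (Gam V f) x (Z t - Z s) (Z t - Z s) = fderiv ℝ f x (contract (Gam V V x) (ZZ s t))
      + (1 / 2 : ℝ) • fderiv ℝ (fderiv ℝ f) x (V x (Z t - Z s)) (V x (Z t - Z s))
      + contract (Gam V (Gam V f) x).flip (ZZ s t) := by
  -- Γ²f is Df(ΓV) plus this symmetric form. For a symmetric B, contracting with ℤ gives half of
  -- B(δZ, δZ), the quadratic Taylor term.
  set B := (fderiv ℝ (fderiv ℝ f) x).bilinearComp (V x) (V x) with hB
  have hB' : B.flip = B := by
    ext v w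
    simp [hB, fderiv_fderiv_comm hf hf' x (V x v) (V x w)]
  have hA : Gam V (Gam V f) x = (ContinuousLinearMap.compL ℝ _ E U (fderiv ℝ f x)).comp (Gam V V x)
      + B := by
    ext v w
    simp [hB, _root_.gam_gam_apply hV hf']
  have h1 := hZ.apply_apply hs hst htT B
  rw [hB', ← two_smul ℝ] at h1
  rw [hZ.apply_apply hs hst htT, map_contract, hA, contract_add]
  have h2 : B (Z t - Z s) (Z t - Z s)
      = fderiv ℝ (fderiv ℝ f) x (V x (Z t - Z s)) (V x (Z t - Z s)) := by simp [hB]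
  rw [← h2, h1, smul_smul]
  norm_num

/-- Functions transported by the flow are controlled fields. -/
theorem IsRDEFlow.isControlledField_transportJet (hΦ : IsRDEFlow α T C Z ZZ b V Φ) (hα : 0 < α)
    (hα' : α ≤ 1 / 2) (hT : 0 ≤ T) (hZ : IsWeaklyGeometricRoughPath α T Z ZZ)
    (hV : CB 2 (fun _ : Unit => V)) (hb : CB 0 (fun _ : Unit => b)) {u : ℝ → E → U}
    (hu : CB 2 (fun (t : Icc (0 : ℝ) T) x => u t x))
    (huΦ : ∀ s t, 0 ≤ s → s ≤ t → t ≤ T → u s = fun x => u t (Φ s t x)) :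
    IsControlledField α T Z ZZ (transportJet b V u) := by
  obtain ⟨p6, p2, p1, _⟩ := hΦ.orders hα hα' hT hZ.toIsRoughPath hV hb
  obtain ⟨o2, o1, o3, o4⟩ := hΦ.transport_fderiv hα hα' hT hZ.toIsRoughPath hV hb hu huΦ
  have oz : VanishesToOrder α T 1 (fun s t (_ _ : E) => Z t - Z s) :=
    hZ.toIsRoughPath.vanishesToOrder_fst
  have hud : ∀ t, 0 ≤ t → t ≤ T → Differentiable ℝ (u t) :=
    fun t h0 hT => hu.differentiable ⟨t, h0, hT⟩
  have hud' : ∀ t, 0 ≤ t → t ≤ T → Differentiable ℝ (fderiv ℝ (u t)) :=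
    fun t h0 hT => hu.fderiv.differentiable ⟨t, h0, hT⟩
  have hVd := hV.differentiable ()
  have hVI : CB 2 (fun _ : Icc (0 : ℝ) T => V) := hV.reindex fun _ => ()
  have hbI : CB 0 (fun _ : Icc (0 : ℝ) T => b) := hb.reindex fun _ => ()
  have cb1 : CB 1 (fun (t : Icc (0 : ℝ) T) x => Gam V (u t) x) := CB.gam hVI.of_succ hu
  have cb2 : CB 0 (fun (t : Icc (0 : ℝ) T) x => Gam V (Gam V (u t)) x) :=
    CB.gam hVI.of_succ.of_succ cb1
  have cb3 : CB 0 (fun (t : Icc (0 : ℝ) T) x => fderiv ℝ (u t) x (b x)) :=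
    CB.bilin (ContinuousLinearMap.id ℝ (E →L[ℝ] U)) hu.fderiv.of_succ hbI
  obtain ⟨A₀, _, v0⟩ := hV.bounded
  obtain ⟨A₂, _, v2⟩ := (CB.gam hV.of_succ hV).bounded
  obtain ⟨A₃, _, v3⟩ := hb.bounded
  have ov : VanishesToOrder α T 0 (fun (_ _ : ℝ) (x _ : E) => V x) :=
    .of_bounded fun _ _ _ _ _ x _ => v0 () x
  have og : VanishesToOrder α T 0 (fun (_ _ : ℝ) (x _ : E) => Gam V V x) :=
    .of_bounded fun _ _ _ _ _ x _ => v2 () x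
  have ob : VanishesToOrder α T 0 (fun (_ _ : ℝ) (x _ : E) => b x) :=
    .of_bounded fun _ _ _ _ _ x _ => v3 () x
  obtain ⟨-, d1, -⟩ := VanishesToOrder.of_cb (α := α) hu.fderiv.of_succ
    (g := fun t x => fderiv ℝ (u t) x) fun _ => rfl
  obtain ⟨-, d2, d2'⟩ := VanishesToOrder.of_cb (α := α) hu.fderiv.fderiv
    (g := fun t x => fderiv ℝ (fderiv ℝ (u t)) x) fun _ => rfl
  obtain ⟨-, -, d3'⟩ := VanishesToOrder.of_cb (α := α) cb1.fderiv
    (g := fun t x => fderiv ℝ (Gam V (u t)) x) fun _ => rfl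
  obtain ⟨-, -, d4'⟩ := VanishesToOrder.of_cb (α := α) cb2
    (g := fun t x => Gam V (Gam V (u t)) x) fun _ => rfl
  obtain ⟨-, -, d5'⟩ := VanishesToOrder.of_cb (α := α) cb3
    (g := fun t x => fderiv ℝ (u t) x (b x)) fun _ => rfl
  obtain ⟨K₂, hK₂, k2⟩ := hu.taylor_two
  obtain ⟨K₁, hK₁, k1⟩ := hu.fderiv.taylor_one
  obtain ⟨K₀, hK₀, k0⟩ := cb1.taylor_one
  have osp : VanishesToOrder α T 1 (fun (_ _ : ℝ) (x y : E) => y - x) := .space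
  have t2 : VanishesToOrder α T 3 (fun (_ : ℝ) t x y => u t y - u t x - fderiv ℝ (u t) x (y - x)
      - (1 / 2 : ℝ) • fderiv ℝ (fderiv ℝ (u t)) x (y - x) (y - x)) :=
    osp.of_le_pow 3 hK₂ fun s t hs hst htT => k2 ⟨t, hs.trans hst, htT⟩
  have t1 : VanishesToOrder α T 2 (fun (_ : ℝ) t x y => fderiv ℝ (u t) y - fderiv ℝ (u t) x
      - fderiv ℝ (fderiv ℝ (u t)) x (y - x)) :=
    osp.of_le_pow 2 hK₁ fun s t hs hst htT => k1 ⟨t, hs.trans hst, htT⟩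
  have t0 : VanishesToOrder α T 2 (fun (_ : ℝ) t x y => Gam V (u t) y - Gam V (u t) x
      - fderiv ℝ (Gam V (u t)) x (y - x)) :=
    osp.of_le_pow 2 hK₀ fun s t hs hst htT => k0 ⟨t, hs.trans hst, htT⟩
  -- The expansion in time alone, at a fixed point x; the displacement y - x is added afterwards.
  have hval : VanishesToOrder α T 3 (fun s t x (_ : E) => u t x - u s x
      + Gam V (u s) x (Z t - Z s) - contract (Gam V (Gam V (u s)) x).flip (ZZ s t)
      + (t - s) • fderiv ℝ (u s) x (b x)) := by
    have oq := ov.apply oz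
    -- The errors in turn: Taylor remainder of u_t; flow against Davie step; displacement against
    -- VδZ in the quadratic term; D²u_t against D²u_s; Du_t against its first order expansion at s
    -- in the term with VδZ; Du_t against Du_s in the terms with ℤ and with the drift. The term
    -- D(Γu_s) arising from `a5` is Γ²u_s(δZ, δZ), which `hkey` resolves.
    have a1 : VanishesToOrder α T 3 (fun s t x (_ : E) => u t (Φ s t x) - u t x
        - fderiv ℝ (u t) x (Φ s t x - x)
        - (1 / 2 : ℝ) • fderiv ℝ (fderiv ℝ (u t)) x (Φ s t x - x) (Φ s t x - x)) :=
      p1.of_le_pow 3 hK₂ fun s t hs hst htT x _ => k2 ⟨t, hs.trans hst, htT⟩ x _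
    have a2 := d1.apply p6
    have a3 := (((d2.apply p2).apply p1).add ((d2.apply oq).apply p2)).clm
      ((1 / 2 : ℝ) • ContinuousLinearMap.id ℝ U)
    have a4 := ((o2.apply oq).apply oq).clm ((1 / 2 : ℝ) • ContinuousLinearMap.id ℝ U)
    have a5 := o4.apply oq
    have a6 := o1.apply (hZ.toIsRoughPath.vanishesToOrder_contract og)
    have a7 := (o1.apply ob).bilin (ContinuousLinearMap.lsmul ℝ ℝ (E := U)).flip
      (vanishesToOrder_time (T := T) (W := E) hα hα')
    refine ((((((a1.add a2).add a3).add a4).add a5).add a6).add a7).neg.congr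
      fun s t hs hst htT x _ => ?_
    have hkey := hZ.gam_gam_apply hVd (hud s hs (hst.trans htT)) (hud' s hs (hst.trans htT)) hs hst
      htT x
    have hΓ : ∀ a c, Gam V (Gam V (u s)) x a c = fderiv ℝ (Gam V (u s)) x (V x a) c :=
      fun _ _ => rfl
    have hΓ' : ∀ a, Gam V (u s) x a = fderiv ℝ (u s) x (V x a) := fun _ => rfl
    rw [hΓ] at hkey
    have hval : u s x = u t (Φ s t x) := congrFun (huΦ s t hs hst htT) x
    rw [hval]
    simp only [rdeStep, roughInc, hΓ']
    generalize Z t - Z s = z at hkey ⊢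
    simp only [sub_apply, add_apply, smul_apply,
      ContinuousLinearMap.id_apply, ContinuousLinearMap.flip_apply,
      ContinuousLinearMap.lsmul_apply, map_add, map_sub, map_smul]
    rw [eq_sub_of_add_eq' hkey.symm]
    module
  refine ⟨fun t ht x => fderiv_fderiv_comm (hud t ht.1 ht.2) (hud' t ht.1 ht.2) x, ?_, ?_, ?_, ?_,
    ?_, ?_, ?_⟩
  -- Expand in space at time t, then move the coefficients to time s. The first order variation of
  -- Du is what produces the mixed term in (y - x) ⊗ δZ.
  · refine (((t2.add hval).add (o4.apply osp)).add (((o2.apply osp).apply osp).clm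
      ((1 / 2 : ℝ) • ContinuousLinearMap.id ℝ U))).congr fun s t hs hst htT x y => ?_
    simp only [transportJet, sub_apply, add_apply, smul_apply, neg_apply,
      ContinuousLinearMap.id_apply, ContinuousLinearMap.flip_apply]
    module
  · refine ((t0.add ((o4.clm_comp ov))).add (o3.apply osp)).neg.congr fun s t hs hst htT x y => ?_
    have hΓ : ∀ a c, Gam V (Gam V (u s)) x a c = fderiv ℝ (Gam V (u s)) x (V x a) c :=
      fun _ _ => rfl
    have hΓ' : ∀ t a, Gam V (u t) x a = fderiv ℝ (u t) x (V x a) := fun _ _ => rfl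
    ext v
    simp only [transportJet, sub_apply, add_apply, neg_apply,
      ContinuousLinearMap.comp_apply, ContinuousLinearMap.flip_apply, hΓ, hΓ']
    abel
  · refine ((t1.add o4).add (o2.apply osp)).congr fun s t hs hst htT x y => ?_
    ext v
    simp only [transportJet, sub_apply, add_apply, neg_apply, ContinuousLinearMap.flip_apply]
    abel
  · refine (d4'.add (o3.clm_comp ov)).flip.congr fun s t hs hst htT x y => ?_
    ext v w
    have hΓ : ∀ t a c, Gam V (Gam V (u t)) x a c = fderiv ℝ (Gam V (u t)) x (V x a) c :=
      fun _ _ _ => rfl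
    simp only [transportJet, sub_apply, add_apply, ContinuousLinearMap.comp_apply,
      ContinuousLinearMap.flip_apply, hΓ]
    abel
  · refine (d3'.add o3).neg.congr fun s t hs hst htT x y => ?_
    simp only [transportJet]
    abel
  · refine (d2'.add o2).congr fun s t hs hst htT x y => ?_
    simp only [transportJet]
    abel
  · refine (d5'.add (o1.apply ob)).neg.congr fun s t hs hst htT x y => ?_
    simp only [transportJet, sub_apply]
    abel

end RegularSolution

/-! ### Uniqueness: regular solutions are constant along the flow -/

section Uniqueness

variable {m : ℕ} {α T C : ℝ} {Z : ℝ → EuclideanSpace ℝ (Fin m)}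
  {ZZ : ℝ → ℝ → Matrix (Fin m) (Fin m) ℝ} {E U : Type} [NormedAddCommGroup E] [NormedSpace ℝ E]
  [NormedAddCommGroup U] [NormedSpace ℝ U]
  {V : E → EuclideanSpace ℝ (Fin m) →L[ℝ] E} {b : E → E} {Φ : ℝ → ℝ → E → E}

namespace IsControlledField

variable {F : Jet m E U}

/-- At equal times the rough increments vanish and the expansion is a spatial Taylor formula. This
gives an arbitrary solution the smoothness needed to compute with `Gam`. -/
theorem hasFDerivAt_val (hF : IsControlledField α T Z ZZ F) (hα : 0 < α)
    (hZ : IsRoughPath α T Z ZZ) {t : ℝ} (h0 : 0 ≤ t) (hT : t ≤ T) (x : E) :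
    HasFDerivAt (F.val t) (F.dx t x) x := by
  obtain ⟨K, hK0, hK⟩ := hF.expand_val.exists_nonneg
  obtain ⟨A₀, hA₀, hz⟩ := hZ.bounds
  have hc : contract (F.gub2 t x) (ZZ t t) = 0 := by
    have := (hz t t h0 le_rfl hT).2 U (F.gub2 t x)
    simpa [Real.zero_rpow hα.ne'] using this
  refine hasFDerivAt_of_norm_sub_le_sq (C := K + ‖F.dx2 t x‖) fun y hy => ?_
  have h1 := hK t t h0 le_rfl hT x y
  simp only [sub_self, abs_zero, Real.zero_rpow hα.ne', map_zero, zero_smul, add_zero, hc,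
    max_eq_right (norm_nonneg (y - x))] at h1
  have e : F.val t y - F.val t x - F.dx t x (y - x) = (F.val t y - (F.val t x + F.dx t x (y - x)
      + (1 / 2 : ℝ) • F.dx2 t x (y - x) (y - x))) + (1 / 2 : ℝ) • F.dx2 t x (y - x) (y - x) := by
    abel
  rw [e, add_mul]
  refine norm_add_le_of_le (h1.trans ?_) ?_
  · gcongr ?_ * ?_
    exact pow_le_pow_of_le_one (norm_nonneg _) hy (by norm_num)
  · rw [norm_smul]
    have := (F.dx2 t x).le_opNorm₂ (y - x) (y - x)
    have h2 : ‖(1 / 2 : ℝ)‖ ≤ 1 := by norm_num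
    calc ‖(1 / 2 : ℝ)‖ * ‖F.dx2 t x (y - x) (y - x)‖
        ≤ 1 * (‖F.dx2 t x‖ * ‖y - x‖ * ‖y - x‖) := by gcongr
      _ = _ := by ring

theorem hasFDerivAt_dx (hF : IsControlledField α T Z ZZ F) (hα : 0 < α) {t : ℝ} (h0 : 0 ≤ t)
    (hT : t ≤ T) (x : E) : HasFDerivAt (F.dx t) (F.dx2 t x) x := by
  obtain ⟨K, hK⟩ := hF.expand_dx
  refine hasFDerivAt_of_norm_sub_le_sq (C := K) fun y _ => ?_
  have h1 := hK t t h0 le_rfl hT x y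
  simp only [sub_self, abs_zero, Real.zero_rpow hα.ne', map_zero, add_zero,
    max_eq_right (norm_nonneg (y - x)), ← sub_sub] at h1
  exact h1

/-- The components of a controlled field are not assumed bounded. Expanding from the single point
(r, Y_r) bounds them along one path, which is all that uniqueness requires. -/
theorem bounded_along (hF : IsControlledField α T Z ZZ F) (hα : 0 < α)
    (hZ : IsRoughPath α T Z ZZ) {r L : ℝ} (hr : 0 ≤ r) (hL : 0 ≤ L) {Y : ℝ → E}
    (hY : ∀ s, r ≤ s → s ≤ T → ‖Y s - Y r‖ ≤ L * (s - r) ^ α) :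
    ∃ M, 0 ≤ M ∧ ∀ s, r ≤ s → s ≤ T →
      ‖F.dx s (Y s)‖ ≤ M ∧ ‖F.dxgub s (Y s)‖ ≤ M ∧ ‖F.dx2 s (Y s)‖ ≤ M := by
  obtain ⟨K₁, hK₁, h1⟩ := hF.expand_dx.exists_nonneg
  obtain ⟨K₂, hK₂, h2⟩ := hF.expand_dxgub.exists_nonneg
  obtain ⟨K₃, hK₃, h3⟩ := hF.expand_dx2.exists_nonneg
  obtain ⟨A₀, hA₀, hz⟩ := hZ.bounds
  set τ := |T| ^ α with hτ
  have hτ0 : 0 ≤ τ := Real.rpow_nonneg (abs_nonneg _) _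
  set N := (1 + L) * τ with hN
  have hN0 : 0 ≤ N := by positivity
  set a := ‖F.dx r (Y r)‖
  set c := ‖F.dxgub r (Y r)‖
  set e := ‖F.dx2 r (Y r)‖
  set M₁ := K₁ * N ^ 2 + (a + c * (A₀ * τ) + e * (L * τ))
  set M₂ := K₂ * N ^ 1 + c
  set M₃ := K₃ * N ^ 1 + e
  have m1 : 0 ≤ M₁ := by positivity
  have m2 : 0 ≤ M₂ := by positivity
  have m3 : 0 ≤ M₃ := by positivity
  refine ⟨M₁ + M₂ + M₃, by positivity, fun s hrs hsT => ?_⟩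
  have hH0 : 0 ≤ (s - r) ^ α := Real.rpow_nonneg (by linarith) _
  have hH : (s - r) ^ α ≤ τ :=
    Real.rpow_le_rpow (by linarith) ((by linarith : s - r ≤ T).trans (le_abs_self _)) hα.le
  have hYs : ‖Y s - Y r‖ ≤ L * τ := (hY s hrs hsT).trans (by gcongr)
  have hmax : max (|s - r| ^ α) ‖Y s - Y r‖ ≤ N := by
    have : 0 ≤ L * τ := by positivity
    refine max_le ?_ (by linarith)
    rw [abs_of_nonneg (by linarith)]
    linarith
  have h0 := VanishesToOrder.max_nonneg α r s (Y r) (Y s)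
  have hzs : ‖Z s - Z r‖ ≤ A₀ * τ := (hz r s hr hrs hsT).1.trans (by gcongr)
  have g1 : ‖F.dx s (Y s)‖ ≤ M₁ := by
    have e1 : F.dx s (Y s) = (F.dx s (Y s) - (F.dx r (Y r) + (F.dxgub r (Y r)).flip (Z s - Z r)
        + F.dx2 r (Y r) (Y s - Y r))) + (F.dx r (Y r) + (F.dxgub r (Y r)).flip (Z s - Z r)
        + F.dx2 r (Y r) (Y s - Y r)) := by abel
    rw [e1]
    refine norm_add_le_of_le ((h1 r s hr hrs hsT _ _).trans (by gcongr))
      (norm_add_le_of_le (norm_add_le_of_le le_rfl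
        (ContinuousLinearMap.le_of_opNorm_le_of_le _ ?_ hzs))
        (ContinuousLinearMap.le_of_opNorm_le_of_le _ le_rfl hYs))
    rw [ContinuousLinearMap.opNorm_flip]
  have g2 : ‖F.dxgub s (Y s)‖ ≤ M₂ := by
    have e1 := norm_add_le (F.dxgub s (Y s) - F.dxgub r (Y r)) (F.dxgub r (Y r))
    rw [sub_add_cancel] at e1
    have e2 : K₂ * (max (|s - r| ^ α) ‖Y s - Y r‖) ^ 1 ≤ K₂ * N ^ 1 := by
      gcongr
    exact e1.trans (add_le_add ((h2 r s hr hrs hsT (Y r) (Y s)).trans e2) le_rfl)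
  have g3 : ‖F.dx2 s (Y s)‖ ≤ M₃ := by
    have e1 := norm_add_le (F.dx2 s (Y s) - F.dx2 r (Y r)) (F.dx2 r (Y r))
    rw [sub_add_cancel] at e1
    have e2 : K₃ * (max (|s - r| ^ α) ‖Y s - Y r‖) ^ 1 ≤ K₃ * N ^ 1 := by
      gcongr
    exact e1.trans (add_le_add ((h3 r s hr hrs hsT (Y r) (Y s)).trans e2) le_rfl)
  exact ⟨by linarith, by linarith, by linarith⟩

end IsControlledField

/-- Regular solutions of the transport equation are constant along the flow. -/
theorem IsSpaceTimeRegularSolution.val_eq {g : E → U} {F : Jet m E U}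
    (hF : IsSpaceTimeRegularSolution α T Z ZZ b V g F) (hΦ : IsRDEFlow α T C Z ZZ b V Φ)
    (hα : 1 / 3 < α) (hα' : α ≤ 1 / 2) (hT : 0 ≤ T) (hZ : IsWeaklyGeometricRoughPath α T Z ZZ)
    (hV : CB 2 (fun _ : Unit => V)) (hb : CB 0 (fun _ : Unit => b)) {r : ℝ} (hr : r ∈ Icc 0 T)
    (x : E) : F.val r x = g (Φ r T x) := by
  have hα0 : 0 < α := by linarith
  obtain ⟨p3, p2, p1, _⟩ := hΦ.orders hα0 hα' hT hZ.toIsRoughPath hV hb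
  obtain ⟨K₃, hK₃, k3⟩ := p3.time (A := fun s t x => Φ s t x - rdeStep Z ZZ V b s t x)
  obtain ⟨K₂, hK₂, k2⟩ := p2.time (A := fun s t x => Φ s t x - x - V x (Z t - Z s))
  obtain ⟨K₁, hK₁, k1⟩ := p1.time (A := fun s t x => Φ s t x - x)
  obtain ⟨A₀, hA₀, hz⟩ := hZ.toIsRoughPath.bounds
  obtain ⟨A₁, hA₁, v0⟩ := hV.bounded
  set Y : ℝ → E := fun s => Φ r s x with hY
  have hYc : ∀ s t, r ≤ s → s ≤ t → t ≤ T → Y t = Φ s t (Y s) := fun s t hs hst htT =>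
    hΦ.comp r s t hr.1 hs hst htT x
  have hYr : Y r = x := hΦ.refl r hr.1 hr.2 x
  obtain ⟨M, hM, hMb⟩ := hF.controlled.bounded_along hα0 hZ.toIsRoughPath hr.1 hK₁ (Y := Y)
    fun s hs hsT => by
      rw [hYc r s le_rfl hs hsT]
      simpa using k1 r s hr.1 hs hsT (Y r)
  obtain ⟨K₀, hK₀, k0⟩ := hF.controlled.expand_val.exists_nonneg
  have hconst := eq_of_norm_sub_le_cube (D := fun s => F.val s (Y s)) (a := r) (b := T)
    (C := K₀ * (1 + K₁) ^ 3 + M * K₃ + M * K₂ * A₀ + (M * K₂ * K₁ + M * (A₁ * A₀) * K₂)) hα hr.2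
    fun s t hrs hst htT => by
      have hs : 0 ≤ s := hr.1.trans hrs
      have hsI : s ∈ Icc 0 T := ⟨hs, hst.trans htT⟩
      obtain ⟨-, x2, x3, x4, x5, x6, x7⟩ := hF.expansion s hsI
      have hd : Differentiable ℝ (F.val s) := fun y =>
        (hF.controlled.hasFDerivAt_val hα0 hZ.toIsRoughPath hs (hst.trans htT) y).differentiableAt
      have hd' : Differentiable ℝ (fderiv ℝ (F.val s)) := fun y => by
        have := (hF.controlled.hasFDerivAt_dx hα0 hs (hst.trans htT) y).differentiableAt
        rwa [x3] at this
      have hH0 : 0 ≤ (t - s) ^ α := Real.rpow_nonneg (by linarith) _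
      have k0' := k0 s t hs hst htT (Y s) (Y t)
      obtain ⟨b1, b2, b3⟩ := hMb s hrs (hst.trans htT)
      have k3' := k3 s t hs hst htT (Y s)
      have k2' := k2 s t hs hst htT (Y s)
      have k1' := k1 s t hs hst htT (Y s)
      have kz := (hz s t hs hst htT).1
      have kv := (V (Y s)).le_of_opNorm_le_of_le (v0 () (Y s)) kz
      have hkey := hZ.gam_gam_apply (hV.differentiable ()) hd hd' hs hst htT (Y s)
      rw [← hYc s t hrs hst htT] at k1' k2' k3'
      rw [pow_one] at k1'
      have hmax : max (|t - s| ^ α) ‖Y t - Y s‖ ≤ (1 + K₁) * (t - s) ^ α := by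
        have : 0 ≤ K₁ * (t - s) ^ α := by positivity
        refine max_le ?_ (by linarith)
        rw [abs_of_nonneg (by linarith)]
        linarith
      have k0'' := k0'.trans (mul_le_mul_of_nonneg_left
        (pow_le_pow_left₀ (VanishesToOrder.max_nonneg α s t (Y s) (Y t)) hmax 3) hK₀)
      -- By (*) and `hkey` all terms of order below three cancel: -ΓuδZ and the drift term against
      -- those of Du(Y_t - Y_s), and the second order terms by weak geometricity. What remains is
      -- the expansion error and the errors of replacing Y_t - Y_s by the Davie increment or by VδZ.
      have e : F.val t (Y t) - F.val s (Y s) = (F.val t (Y t) - (F.val s (Y s)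
          + F.gub s (Y s) (Z t - Z s) + F.dx s (Y s) (Y t - Y s)
          + contract (F.gub2 s (Y s)) (ZZ s t) + F.dxgub s (Y s) (Y t - Y s) (Z t - Z s)
          + (1 / 2 : ℝ) • F.dx2 s (Y s) (Y t - Y s) (Y t - Y s) + (t - s) • F.dot s (Y s)))
          + F.dx s (Y s) (Y t - rdeStep Z ZZ V b s t (Y s))
          + F.dxgub s (Y s) (Y t - Y s - V (Y s) (Z t - Z s)) (Z t - Z s)
          + (1 / 2 : ℝ) • (F.dx2 s (Y s) (Y t - Y s - V (Y s) (Z t - Z s)) (Y t - Y s)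
            + F.dx2 s (Y s) (V (Y s) (Z t - Z s)) (Y t - Y s - V (Y s) (Z t - Z s))) := by
        have hΓ : ∀ a c, Gam V (Gam V (F.val s)) (Y s) a c
            = fderiv ℝ (Gam V (F.val s)) (Y s) (V (Y s) a) c := fun _ _ => rfl
        have hΓ' : ∀ a, Gam V (F.val s) (Y s) a = fderiv ℝ (F.val s) (Y s) (V (Y s) a) :=
          fun _ => rfl
        rw [hΓ] at hkey
        rw [x2, x3, x4, x5, x6, x7]
        simp only [transportJet, rdeStep, roughInc]
        rw [eq_sub_of_add_eq' hkey.symm]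
        generalize Z t - Z s = z
        simp only [neg_apply, map_add, map_sub, map_smul, hΓ', sub_apply]
        module
      rw [e]
      have h1 : ‖F.dx s (Y s) (Y t - rdeStep Z ZZ V b s t (Y s))‖ ≤ M * (K₃ * ((t - s) ^ α) ^ 3) :=
        ContinuousLinearMap.le_of_opNorm_le_of_le _ b1 k3'
      have h2 : ‖F.dxgub s (Y s) (Y t - Y s - V (Y s) (Z t - Z s)) (Z t - Z s)‖
          ≤ M * (K₂ * ((t - s) ^ α) ^ 2) * (A₀ * (t - s) ^ α) :=
        ContinuousLinearMap.le_of_opNorm_le_of_le _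
          (ContinuousLinearMap.le_of_opNorm_le_of_le _ b2 k2') kz
      have h3 : ‖F.dx2 s (Y s) (Y t - Y s - V (Y s) (Z t - Z s)) (Y t - Y s)‖
          ≤ M * (K₂ * ((t - s) ^ α) ^ 2) * (K₁ * (t - s) ^ α) :=
        ContinuousLinearMap.le_of_opNorm_le_of_le _
          (ContinuousLinearMap.le_of_opNorm_le_of_le _ b3 k2') k1'
      have h4 : ‖F.dx2 s (Y s) (V (Y s) (Z t - Z s)) (Y t - Y s - V (Y s) (Z t - Z s))‖
          ≤ M * (A₁ * (A₀ * (t - s) ^ α)) * (K₂ * ((t - s) ^ α) ^ 2) :=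
        ContinuousLinearMap.le_of_opNorm_le_of_le _
          (ContinuousLinearMap.le_of_opNorm_le_of_le _ b3 kv) k2'
      have h5 := norm_add_le_of_le h3 h4
      refine (norm_add_le_of_le (norm_add_le_of_le (norm_add_le_of_le k0'' h1) h2)
        ((norm_smul_le _ _).trans (mul_le_of_le_one_left (norm_nonneg _) (by norm_num) |>.trans
          h5))).trans (le_of_eq ?_)
      ring
  simp only [hYr] at hconst
  rw [← hconst, hF.terminal]

end Uniqueness

/-! ### Assembly of the theorem -/

theorem mainTheorem3 {d m : ℕ} {α T : ℝ} (hα : 1 / 3 < α) (hα' : α ≤ 1 / 2) (hT : 0 < T)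
    (Z : ℝ → EuclideanSpace ℝ (Fin m)) (ZZ : ℝ → ℝ → Matrix (Fin m) (Fin m) ℝ)
    (hZ : IsWeaklyGeometricRoughPath α T Z ZZ)
    (μ : EuclideanSpace ℝ (Fin d) → EuclideanSpace ℝ (Fin d))
    (σ : EuclideanSpace ℝ (Fin d) → EuclideanSpace ℝ (Fin m) →L[ℝ] EuclideanSpace ℝ (Fin d))
    (g : EuclideanSpace ℝ (Fin d) → ℝ)
    (hμ : IsLip 3 μ) (hσ : IsLip 5 σ) (hg : IsLip 3 g) :
    -- the differential equation has exactly one solution on `[r, T]` started from `x` at time `r`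
    (∀ r ∈ Icc 0 T, ∀ x, ∃ X : ℝ → EuclideanSpace ℝ (Fin d),
      IsRDESolution α T Z ZZ μ σ r x X ∧
        ∀ Y, IsRDESolution α T Z ZZ μ σ r x Y → EqOn Y X (Icc r T)) ∧
    -- and `u_t(x) = g(X_T)` induces the unique space-time regular solution
    ∀ u : ℝ → EuclideanSpace ℝ (Fin d) → ℝ,
      (∀ t ∈ Icc 0 T, ∀ x X, IsRDESolution α T Z ZZ μ σ t x X → u t x = g (X T)) →
        IsSpaceTimeRegularSolution α T Z ZZ μ σ g (transportJet μ σ u) ∧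
        ∀ 𝓥 : Jet m (EuclideanSpace ℝ (Fin d)) ℝ,
          IsSpaceTimeRegularSolution α T Z ZZ μ σ g 𝓥 → 𝓥.EqUpTo T (transportJet μ σ u) := by
  have hα0 : 0 < α := by linarith
  have hb : CB 2 (fun _ : Unit => μ) := IsLip.cb (by norm_num; exact hμ)
  have hV : CB 4 (fun _ : Unit => σ) := IsLip.cb (by norm_num; exact hσ)
  have hG : CB 2 (fun _ : Unit => g) := IsLip.cb (by norm_num; exact hg)
  have hV2 : CB 2 (fun _ : Unit => σ) := hV.of_succ.of_succ
  have hb0 : CB 0 (fun _ : Unit => μ) := hb.of_succ.of_succ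
  obtain ⟨C, Φ, hΦ⟩ := exists_isRDEFlow hα hα' hT.le hZ.toIsRoughPath hV hb
  have hsol : ∀ r ∈ Icc 0 T, ∀ x, IsRDESolution α T Z ZZ μ σ r x fun t => Φ r t x := by
    intro r hr x
    have := (hΦ.isDavieSolution hr.1 x).isRDESolution hα hα' hZ.toIsRoughPath hV2 hb0 hr.1
    rwa [hΦ.refl r hr.1 hr.2] at this
  refine ⟨fun r hr x => ⟨_, hsol r hr x, fun Y hY t ht => ?_⟩, fun u hu => ?_⟩
  · have := hΦ.eq_of_isDavieSolution hα hT.le hZ.toIsRoughPath hV2.of_succ hr.1 ht.1 ht.2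
      (hY.isDavieSolution hα hα' hZ.toIsRoughPath hV2 hb0 hr.1)
    rw [this, hY.initial]
  · have hu' : ∀ t ∈ Icc 0 T, u t = fun x => g (Φ t T x) := fun t ht =>
      funext fun x => hu t ht x _ (hsol t ht x)
    have hcb : CB 2 (fun (t : Icc (0 : ℝ) T) x => u t x) := by
      have := hΦ.transport_cb hα0 hT.le hZ.toIsRoughPath hV2.of_succ hG
      convert this using 1
      funext t
      exact hu' t t.2
    have huΦ : ∀ s t, 0 ≤ s → s ≤ t → t ≤ T → u s = fun x => u t (Φ s t x) := by
      intro s t hs hst htT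
      rw [hu' s ⟨hs, hst.trans htT⟩, hu' t ⟨hs.trans hst, htT⟩]
      funext x
      rw [hΦ.comp s t T hs hst htT le_rfl]
    refine ⟨⟨hΦ.isControlledField_transportJet hα0 hα' hT.le hZ hV2 hb0 hcb huΦ, fun x => ?_,
      fun t ht => ⟨rfl, rfl, rfl, rfl, rfl, rfl, rfl⟩⟩, fun 𝓥 h𝓥 t ht => ?_⟩
    · exact (congrFun (hu' T ⟨hT.le, le_rfl⟩) x).trans (by rw [hΦ.refl T hT.le le_rfl])
    -- Once the first components agree on the whole space, so do their spatial derivatives, and (*)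
    -- expresses the other six components through these.
    · have hval : 𝓥.val t = u t := by
        rw [hu' t ht]
        exact funext (h𝓥.val_eq hΦ hα hα' hT.le hZ hV2 hb0 ht)
      obtain ⟨-, x2, x3, x4, x5, x6, x7⟩ := h𝓥.expansion t ht
      refine ⟨hval, ?_, ?_, ?_, ?_, ?_, ?_⟩ <;> simp only [x2, x3, x4, x5, x6, x7] <;>
        simp only [transportJet, hval]
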